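/- Let $w\in[0,1]$, $\nu=\frac12\,\frac{5+3w}{1+3w}$, and let $T^3=\mathbb R^3/\Lambda$ be a flat torus with Laplacian $\Delta$. Consider smooth real solutions $\Phi(\eta,x)$ on $(0,\infty)\times T^3$ of $$\Phi''+\frac{6(1+w)}{1+3w}\,\frac1\eta\,\Phi'=w\,\Delta\Phi ,\qquad {}'=\frac{d}{d\eta}. \tag{1}$$ A singular expansion of $\Phi$ is a formal series $\sum_k(\Phi_{k,0}+\Phi_{k,1}\log\eta)\,\eta^k$, with $k\ge-2\nu$ running through an increasing sequence $\kappa_0<\kappa_1<\cdots$ of real numbers tending to infinity and with smooth coefficients $\Phi_{k,l}$ on $T^3$ (set to zero for all other $k$), which is asymptotic to $\Phi$ as $\eta\to0$: for every $n$, the difference between $\Phi$ and the sum of the terms with $k\le\kappa_n$ is $o(\eta^{\kappa_n})$ uniformly on $T^3$, and so are all its spatial derivatives. (a) For all smooth functions $\Psi_1,\Psi_2$ on $T^3$ there is a smooth solution $\Phi$ of (1) that has a singular expansion with $\Phi_{-2\nu,0}=\Psi_1$ and $\Phi_{0,0}=\Psi_2$, and any smooth solution of (1) that has a singular expansion with $\Phi_{-2\nu,0}=\Psi_1$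 and $\Phi_{0,0}=\Psi_2$ coincides with it. The expansion of the solution can be taken such that $\Phi_{k,0}\neq0$ only for $k\in\{-2\nu+2i,\,2i: i=0,1,2,\dots\}$, $\Phi_{k,1}\ne0$ only for $k\in\{2i: i=0,1,2,\dots\}$, and for all real $k$ $$k(k+2\nu)\Phi_{k,0}=w\Delta\Phi_{k-2,0}-(2k+2\nu)\Phi_{k,1},\qquad k(k+2\nu)\Phi_{k,1}=w\Delta\Phi_{k-2,1}.$$ (b) Thus the solutions are parametrized by these asymptotic data at the big bang $\eta=0$: for every smooth solution $\Phi$ of (1) there is exactly one pair $(\Psi_1,\Psi_2)$ of smooth functions on $T^3$ such that $\Phi$ has a singular expansion with $\Phi_{-2\nu,0}=\Psi_1$ and $\Phi_{0,0}=\Psi_2$. -/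

import Mathlib

open scoped ContDiff Topology

noncomputable section

/-- Euclidean three-space, the universal cover of the flat three-torus. -/
abbrev E3 : Type := EuclideanSpace ℝ (Fin 3)

/-- Smooth real functions on the flat torus `T³ = ℝ³ / (ℤ b₀ + ℤ b₁ + ℤ b₂)`, as smooth functions
on `ℝ³` that are periodic with respect to the lattice spanned by the basis `b`.  Every flat
metric on the torus arises in this way from some `b`; its Laplacian is the usual one on `ℝ³`. -/
structure IsSmoothOnTorus (b : Module.Basis (Fin 3) ℝ E3) (f : E3 → ℝ) : Prop where
  smooth : ContDiff ℝ ∞ f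
  periodic : ∀ (i : Fin 3) (x : E3), f (x + b i) = f x

/-- `Φ` (with arguments `η` and `x`) is a smooth solution on `(0,∞) × T³` of
`Φ'' + (6 (1 + w) / (1 + 3 w)) (1 / η) Φ' = w Δ Φ`.  Values at `η ≤ 0` are irrelevant. -/
structure IsSmoothSolution (b : Module.Basis (Fin 3) ℝ E3) (w : ℝ) (Φ : ℝ → E3 → ℝ) : Prop where
  smooth : ContDiffOn ℝ ∞ (fun p : ℝ × E3 => Φ p.1 p.2) (Set.Ioi 0 ×ˢ Set.univ)
  periodic : ∀ η : ℝ, 0 < η → ∀ (i : Fin 3) (x : E3), Φ η (x + b i) = Φ η x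
  equation : ∀ η : ℝ, 0 < η → ∀ x : E3,
    iteratedDeriv 2 (fun s => Φ s x) η
      + 6 * (1 + w) / (1 + 3 * w) * (1 / η) * deriv (fun s => Φ s x) η
      = w * Laplacian.laplacian (Φ η) x

/-- The exponent `ν = (1/2) (5 + 3 w) / (1 + 3 w)`. -/
def nuExp (w : ℝ) : ℝ := 1 / 2 * ((5 + 3 * w) / (1 + 3 * w))

/-- The formal series `∑ₖ (c k 0 + c k 1 * log η) η ^ k` is asymptotic to `Φ` as `η → 0`, uniformly
on the torus together with all spatial derivatives.  The exponents `k ≥ -2ν` run through an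
increasing sequence `κ` of real numbers tending to infinity, the coefficients `c k l` are smooth
functions on the torus (zero for any `k` outside the sequence), and for every `n` the remainder
after the terms with exponents `κ 0, …, κ n` is `o(η ^ κ n)`, as are all its spatial
derivatives, uniformly in `x`. -/
def IsSingularExpansion (b : Module.Basis (Fin 3) ℝ E3) (w : ℝ) (Φ : ℝ → E3 → ℝ)
    (c : ℝ → Fin 2 → E3 → ℝ) : Prop :=
  (∀ (k : ℝ) (l : Fin 2), IsSmoothOnTorus b (c k l)) ∧
  ∃ κ : ℕ → ℝ, StrictMono κ ∧ Filter.Tendsto κ Filter.atTop Filter.atTop ∧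
    (∀ n, -2 * nuExp w ≤ κ n) ∧
    (∀ k : ℝ, k ∉ Set.range κ → ∀ l : Fin 2, c k l = 0) ∧
    ∀ n m : ℕ, ∀ ε : ℝ, 0 < ε → ∀ᶠ η in 𝓝[>] (0 : ℝ), ∀ x : E3,
      ‖iteratedFDeriv ℝ m (fun y => Φ η y
          - ∑ j ∈ Finset.range (n + 1), (c (κ j) 0 y + c (κ j) 1 y * Real.log η) * η ^ (κ j)) x‖
        ≤ ε * η ^ (κ n)

/-- The form of the coefficients: `c k 0` can be nonzero only for `k = -2ν + 2i` or `k = 2i`, and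
`c k 1` only for `k = 2i`, with `i` a non-negative integer, and the coefficients satisfy the
recursion obtained by inserting the series in the equation. -/
structure IsFormalSolution (w : ℝ) (c : ℝ → Fin 2 → E3 → ℝ) : Prop where
  support_zero : ∀ k : ℝ, c k 0 ≠ 0 → ∃ i : ℕ, k = -2 * nuExp w + 2 * i ∨ k = 2 * i
  support_log : ∀ k : ℝ, c k 1 ≠ 0 → ∃ i : ℕ, k = 2 * i
  recursion_zero : ∀ (k : ℝ) (x : E3), k * (k + 2 * nuExp w) * c k 0 x
    = w * Laplacian.laplacian (c (k - 2) 0) x - (2 * k + 2 * nuExp w) * c k 1 x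
  recursion_log : ∀ (k : ℝ) (x : E3), k * (k + 2 * nuExp w) * c k 1 x
    = w * Laplacian.laplacian (c (k - 2) 1) x

/-- `Φ` has a singular expansion at `η = 0` in which the coefficient of `η ^ (-2ν)` is `Ψ₁` and the
coefficient of `η ^ 0` is `Ψ₂`. -/
def HasSingularData (b : Module.Basis (Fin 3) ℝ E3) (w : ℝ) (Φ : ℝ → E3 → ℝ)
    (Ψ₁ Ψ₂ : E3 → ℝ) : Prop :=
  ∃ c : ℝ → Fin 2 → E3 → ℝ, IsSingularExpansion b w Φ c ∧
    c (-2 * nuExp w) 0 = Ψ₁ ∧ c 0 0 = Ψ₂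

end

/-! Put `a = 2 * nuExp w > 0`. The Fourier expansion on the torus decouples the equation: the
coefficient belonging to the eigenvalue λ of -Δ satisfies u'' + (a + 1) / η * u' = -μ u with μ = w λ
≥ 0. The point η = 0 is regular singular with exponents -a and 0. There are thus two Frobenius
solutions, η ^ (-a) and 1 times power series in -μ η², with a logarithm in the first one if a is an
even integer 2m. In that resonant case the η ^ 0 coefficient of the singular solution is free;
choosing it to be zero makes Ψ₁ and Ψ₂ exactly the amplitudes of the two branches.

The analytic issue is uniformity in μ. After N + 1 terms the tail of a Frobenius series is (-μ) ^ (N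
+ 1) times a solution of the same equation with a source (x + y log η) η ^ (s - 2) that does not
depend on μ. Because the friction term has the good sign, the energy u'² + μ u² bounds this solution
with a constant independent of μ (`IsFrobenius.energy_bound`). So the error of the expansion of a
mode is a power of μ times a power of η (`mode_remainder`). Fourier coefficients of smooth functions
decay faster than any power of λ, hence the expansions of the modes may be summed, with all spatial
derivatives (`hasExpansion_branch`). The same polynomial bounds make the sum smooth in (η, x)
(`contDiffOn_synth`). This gives existence.

Conversely, constancy of Wronskians writes each Fourier coefficient of an arbitrary solution as a
combination of the two modes, with amplitudes computed at η = 1 that again decay rapidly. Every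
solution is therefore a sum of two branches (`IsSmoothSolution.eq_branchSolution`) and has an
expansion of Frobenius form. Expansion coefficients are unique, even along different exponent
sequences (`HasExpansion.unique`), which gives (b). Two solutions with the same data share their
expansion, so their difference is o(1). Its Fourier coefficients are combinations of the modes that
tend to zero, and the leading behaviour η ^ (-a) and 1 of the modes forces them to vanish
(`IsSmoothSolution.eq_zero_of_isLittleORpow`). -/

noncomputable section

/-! ### Entire power series and Frobenius series -/

/-- The coefficients `p` define an everywhere convergent power series. -/
def EntireCoeff (p : ℕ → ℝ) : Prop := ∀ r : ℝ, Summable fun i => p i * r ^ i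

namespace EntireCoeff

variable {p q : ℕ → ℝ}

lemma add (hp : EntireCoeff p) (hq : EntireCoeff q) : EntireCoeff (fun i => p i + q i) := by
  intro r
  simpa [add_mul] using (hp r).add (hq r)

lemma const_mul (hp : EntireCoeff p) (c : ℝ) : EntireCoeff (fun i => c * p i) := by
  intro r
  simpa [mul_assoc] using (hp r).mul_left c

/-- Since i ≤ 2 ^ i, the series at r is dominated by the original one at 2r. -/
lemma natCast_mul (hp : EntireCoeff p) : EntireCoeff (fun i => (i : ℝ) * p i) := by
  intro r
  refine Summable.of_norm_bounded ((hp (2 * r)).abs) fun i => ?_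
  have h : (i : ℝ) ≤ 2 ^ i := by exact_mod_cast (Nat.lt_two_pow_self (n := i)).le
  rw [Real.norm_eq_abs, mul_pow, mul_assoc, abs_mul, abs_of_nonneg (by positivity : (0 : ℝ) ≤ i),
    show p i * (2 ^ i * r ^ i) = 2 ^ i * (p i * r ^ i) by ring, abs_mul ((2 : ℝ) ^ i),
    abs_of_pos (by positivity : (0 : ℝ) < 2 ^ i), abs_mul]
  gcongr

lemma affine_mul (hp : EntireCoeff p) (s : ℝ) : EntireCoeff (fun i => (s + 2 * i) * p i) := by
  convert (hp.const_mul s).add (hp.natCast_mul.const_mul 2) using 2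
  ring

lemma tail (hp : EntireCoeff p) (N : ℕ) : EntireCoeff (fun i => p (i + N)) := by
  intro r
  by_cases hr : r = 0
  · subst hr
    refine summable_of_ne_finset_zero (s := {0}) fun i hi => ?_
    have : i ≠ 0 := by simpa using hi
    simp [this]
  · have h := ((summable_nat_add_iff N).2 (hp r)).mul_left ((r ^ N)⁻¹)
    refine h.congr fun i => ?_
    rw [pow_add]
    field_simp

lemma hasDerivAt (hp : EntireCoeff p) (t : ℝ) :
    HasDerivAt (fun t => ∑' i, p i * t ^ i) (∑' i, p i * (i * t ^ (i - 1))) t := by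
  -- On the ball of radius R ≥ 1 the differentiated terms are dominated by the original terms at 2R,
  -- from i ≤ 2 ^ i and R ^ (i - 1) ≤ R ^ i.
  set R : ℝ := |t| + 1
  have hR : 1 ≤ R := by simp [R]
  have hs : Summable fun i => |p i * (2 * R) ^ i| := (hp (2 * R)).abs
  have ht : t ∈ Metric.ball (0 : ℝ) R := by simp [R]
  refine hasDerivAt_tsum_of_isPreconnected (g := fun i t => p i * t ^ i)
    (g' := fun i t => p i * (i * t ^ (i - 1))) hs Metric.isOpen_ball
    (convex_ball _ _).isPreconnected (fun i y _ => (hasDerivAt_pow i y).const_mul _)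
    (fun i y hy => ?_) ht (hp t) ht
  have hy' : |y| ≤ R := by simpa using (Metric.mem_ball.1 hy).le
  have h : (i : ℝ) ≤ 2 ^ i := by exact_mod_cast (Nat.lt_two_pow_self (n := i)).le
  rw [Real.norm_eq_abs, abs_mul, abs_mul, abs_mul, abs_of_nonneg (by positivity : (0 : ℝ) ≤ i),
    abs_pow, abs_of_nonneg (by positivity : 0 ≤ (2 * R) ^ i), mul_pow]
  gcongr
  calc |y| ^ (i - 1) ≤ R ^ (i - 1) := by gcongr
    _ ≤ R ^ i := pow_le_pow_right₀ hR (by omega)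

lemma continuous (hp : EntireCoeff p) : Continuous fun t => ∑' i, p i * t ^ i :=
  continuous_iff_continuousAt.2 fun t => (hp.hasDerivAt t).continuousAt

end EntireCoeff

/-- The series `∑ i, p i * z ^ i * η ^ (s + 2 * i)`. -/
def genPow (s z : ℝ) (p : ℕ → ℝ) (η : ℝ) : ℝ := η ^ s * ∑' i, p i * (z * η ^ 2) ^ i

/-- The series `∑ i, (p i + q i * log η) * z ^ i * η ^ (s + 2 * i)`. -/
def frob (s z : ℝ) (p q : ℕ → ℝ) (η : ℝ) : ℝ := genPow s z p η + Real.log η * genPow s z q η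

/-! ### Termwise calculus of Frobenius series -/

section frob

variable {s z η : ℝ} {p q x y : ℕ → ℝ}

lemma genPow_add (hp : EntireCoeff p) (hq : EntireCoeff q) :
    genPow s z (fun i => p i + q i) η = genPow s z p η + genPow s z q η := by
  simp only [genPow, add_mul, ← mul_add]
  rw [(hp _).tsum_add (hq _)]

lemma genPow_const_mul (c : ℝ) :
    genPow s z (fun i => c * p i) η = c * genPow s z p η := by
  simp only [genPow, mul_assoc, tsum_mul_left]
  ring

lemma hasDerivAt_genPow (hp : EntireCoeff p) (hη : 0 < η) :
    HasDerivAt (genPow s z p) (genPow s z (fun i => (s + 2 * i) * p i) η / η) η := by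
  have h1 : HasDerivAt (fun η : ℝ => η ^ s) (s * η ^ (s - 1)) η :=
    Real.hasDerivAt_rpow_const (Or.inl hη.ne')
  have h2 : HasDerivAt (fun η : ℝ => z * η ^ 2) (z * (2 * η)) η := by
    simpa using (hasDerivAt_pow 2 η).const_mul z
  have h3 := h1.mul ((hp.hasDerivAt (z * η ^ 2)).comp η h2)
  refine h3.congr_deriv ?_
  have e : (fun i : ℕ => (s + 2 * i) * p i) = fun i => s * p i + 2 * (i * p i) := by
    ext i; ring
  rw [e, genPow_add (hp.const_mul s) (hp.natCast_mul.const_mul 2), genPow_const_mul,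
    genPow_const_mul]
  have e2 : ∑' i : ℕ, (i * p i) * (z * η ^ 2) ^ i
      = (z * η ^ 2) * ∑' i, p i * (i * (z * η ^ 2) ^ (i - 1)) := by
    rw [← tsum_mul_left]
    refine tsum_congr fun i => ?_
    rcases i with _ | i
    · simp
    · simp [pow_succ]; ring
  simp only [genPow, Function.comp_def]
  rw [e2, Real.rpow_sub_one hη.ne']
  field_simp

/-- The Euler operator η d/dη multiplies η ^ k by k and sends η ^ k log η to k η ^ k log η + η ^ k,
so it maps Frobenius series to Frobenius series. -/
lemma hasDerivAt_frob (hp : EntireCoeff p) (hq : EntireCoeff q) (hη : 0 < η) :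
    HasDerivAt (frob s z p q)
      (frob s z (fun i => (s + 2 * i) * p i + q i) (fun i => (s + 2 * i) * q i) η / η) η := by
  have h := (hasDerivAt_genPow (s := s) (z := z) hp hη).add
    ((Real.hasDerivAt_log hη.ne').mul (hasDerivAt_genPow (s := s) (z := z) hq hη))
  refine h.congr_deriv ?_
  rw [frob, genPow_add (hp.affine_mul s) hq]
  field_simp
  ring

lemma frob_add (hp : EntireCoeff p) (hq : EntireCoeff q) (hx : EntireCoeff x)
    (hy : EntireCoeff y) :
    frob s z (fun i => p i + x i) (fun i => q i + y i) η = frob s z p q η + frob s z x y η := by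
  simp only [frob, genPow_add hp hx, genPow_add hq hy]
  ring

lemma frob_const_mul (c : ℝ) :
    frob s z (fun i => c * p i) (fun i => c * q i) η = c * frob s z p q η := by
  simp only [frob, genPow_const_mul]
  ring

lemma genPow_eq_sum_add (hp : EntireCoeff p) (N : ℕ) (hη : 0 < η) :
    genPow s z p η = (∑ i ∈ Finset.range N, p i * z ^ i * η ^ (s + 2 * i))
      + z ^ N * genPow (s + 2 * N) z (fun i => p (i + N)) η := by
  have h := (hp (z * η ^ 2)).sum_add_tsum_nat_add N
  have e (n : ℕ) : η ^ (s + 2 * n) = η ^ s * (η ^ 2) ^ n := by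
    rw [Real.rpow_add hη, ← pow_mul, ← Real.rpow_natCast]
    push_cast; rfl
  rw [genPow, ← h, mul_add, Finset.mul_sum]
  congr 1
  · refine Finset.sum_congr rfl fun i _ => ?_
    rw [e, mul_pow]; ring
  · simp only [genPow, e, pow_add, ← mul_assoc]
    rw [tsum_mul_right]
    ring

/-- The factor `z ^ N` in front of the tail later becomes the power of the spectral parameter in the
remainder estimate; the tail itself is a series of the same kind with a larger exponent. -/
lemma frob_eq_sum_add (hp : EntireCoeff p) (hq : EntireCoeff q) (N : ℕ) (hη : 0 < η) :
    frob s z p q η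
      = (∑ i ∈ Finset.range N, (p i + q i * Real.log η) * z ^ i * η ^ (s + 2 * i))
        + z ^ N * frob (s + 2 * N) z (fun i => p (i + N)) (fun i => q (i + N)) η := by
  rw [frob, genPow_eq_sum_add hp N hη, genPow_eq_sum_add hq N hη, frob]
  simp only [add_mul, Finset.sum_add_distrib, mul_add, Finset.mul_sum]
  have : ∑ i ∈ Finset.range N, Real.log η * (q i * z ^ i * η ^ (s + 2 * (i : ℝ)))
      = ∑ i ∈ Finset.range N, q i * Real.log η * z ^ i * η ^ (s + 2 * (i : ℝ)) :=
    Finset.sum_congr rfl fun i _ => by ring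
  rw [this]
  ring

end frob

/-! ### Frobenius recursions and the mode equation with a source -/

/-- Prepend a term to a sequence. -/
def seqCons (x : ℝ) (p : ℕ → ℝ) : ℕ → ℝ
  | 0 => x
  | i + 1 => p i

/-- The recursion for the coefficients of the series `frob s z p q` to solve
`u'' + (a + 1) / η * u' = z * u + (x + y * log η) * η ^ (s - 2)`. -/
structure IsFrobenius (a s x y : ℝ) (p q : ℕ → ℝ) : Prop where
  entire_fst : EntireCoeff p
  entire_snd : EntireCoeff q
  rec_fst : ∀ i : ℕ, (s + 2 * i) * (s + 2 * i + a) * p i + (2 * (s + 2 * i) + a) * q i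
    = seqCons x p i
  rec_snd : ∀ i : ℕ, (s + 2 * i) * (s + 2 * i + a) * q i = seqCons y q i

/-- The derivative of the series `frob s z p q`. -/
def frobDeriv (s z : ℝ) (p q : ℕ → ℝ) (η : ℝ) : ℝ :=
  frob s z (fun i => (s + 2 * i) * p i + q i) (fun i => (s + 2 * i) * q i) η / η

lemma EntireCoeff.seqCons {p : ℕ → ℝ} (hp : EntireCoeff p) (x : ℝ) :
    EntireCoeff (seqCons x p) := by
  intro r
  rw [← summable_nat_add_iff 1]
  refine ((hp r).mul_left r).congr fun i => ?_
  simp only [_root_.seqCons, pow_succ]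
  ring

/-- Shifting the index by one is multiplication by z η², because the series advances in steps of
two. -/
lemma genPow_seqCons {s z η x : ℝ} {p : ℕ → ℝ} (hp : EntireCoeff p) :
    genPow s z (seqCons x p) η = x * η ^ s + z * η ^ 2 * genPow s z p η := by
  rw [genPow, (hp.seqCons x _).tsum_eq_zero_add]
  simp only [seqCons, pow_succ _ (_ : ℕ), genPow, ← mul_assoc, tsum_mul_right]
  simp
  ring

namespace IsFrobenius

variable {a s x y z η : ℝ} {p q : ℕ → ℝ}

lemma hasDerivAt (h : IsFrobenius a s x y p q) (hη : 0 < η) :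
    HasDerivAt (frob s z p q) (frobDeriv s z p q η) η :=
  hasDerivAt_frob h.entire_fst h.entire_snd hη

/-- With θ = η d/dη one has η² (u'' + (a + 1) / η * u') = θ (θ + a) u. On coefficients θ (θ + a)
acts by k (k + a), plus the derivative 2k + a times the logarithmic coefficient, which is the left
side of the recursion. The right side is the shifted series, that is z η² u plus the source. -/
lemma hasDerivAt_frobDeriv (h : IsFrobenius a s x y p q) (hη : 0 < η) :
    HasDerivAt (frobDeriv s z p q)
      (-((a + 1) / η) * frobDeriv s z p q η + z * frob s z p q η
        + (x + y * Real.log η) * η ^ (s - 2)) η := by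
  have hp := h.entire_fst
  have hq := h.entire_snd
  have hP := (hp.affine_mul s).add hq
  have hQ := hq.affine_mul s
  have h1 := (hasDerivAt_frob (s := s) (z := z) hP hQ hη).div (hasDerivAt_id η) hη.ne'
  refine h1.congr_deriv ?_
  have e1 : frob s z (seqCons x p) (seqCons y q) η
      = (x + y * Real.log η) * η ^ s + z * η ^ 2 * frob s z p q η := by
    rw [frob, genPow_seqCons hp, genPow_seqCons hq, frob]
    ring
  -- The recursion in the form: shifted series = θ² u + a θ u.
  have e2 : frob s z (seqCons x p) (seqCons y q) η
      = frob s z (fun i => (s + 2 * i) * ((s + 2 * i) * p i + q i) + (s + 2 * i) * q i)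
          (fun i => (s + 2 * i) * ((s + 2 * i) * q i)) η
        + a * frob s z (fun i => (s + 2 * i) * p i + q i) (fun i => (s + 2 * i) * q i) η := by
    rw [← frob_const_mul, ← frob_add ((hP.affine_mul s).add hQ) (hQ.affine_mul s)
      (hP.const_mul a) (hQ.const_mul a)]
    congr 1 <;> ext i
    · rw [← h.rec_fst]; ring
    · rw [← h.rec_snd]; ring
  have e3 : η ^ (s - 2) = η ^ s / η ^ 2 := by
    rw [Real.rpow_sub hη, Real.rpow_two]
  rw [e1] at e2
  have e4 : frob s z (fun i => (s + 2 * i) * ((s + 2 * i) * p i + q i) + (s + 2 * i) * q i)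
          (fun i => (s + 2 * i) * ((s + 2 * i) * q i)) η
      = (x + y * Real.log η) * η ^ s + z * η ^ 2 * frob s z p q η
        - a * frob s z (fun i => (s + 2 * i) * p i + q i) (fun i => (s + 2 * i) * q i) η := by
    linarith
  rw [e4, e3]
  simp only [frobDeriv, id]
  field_simp
  ring

/-- The tail obeys the same recursion, with the last discarded coefficients as source. The parameter
z does not occur in the recursion, so the source is independent of it. -/
lemma tail (h : IsFrobenius a s x y p q) (N : ℕ) :
    IsFrobenius a (s + 2 * (N + 1 : ℕ)) (p N) (q N)
      (fun i => p (i + (N + 1))) (fun i => q (i + (N + 1))) where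
  entire_fst := h.entire_fst.tail _
  entire_snd := h.entire_snd.tail _
  rec_fst i := by
    have := h.rec_fst (i + (N + 1))
    have e : seqCons x p (i + (N + 1)) = seqCons (p N) (fun i => p (i + (N + 1))) i := by
      rcases i with _ | i
      · rw [zero_add]; rfl
      · rw [show i + 1 + (N + 1) = (i + (N + 1)) + 1 by ring]; rfl
    rw [← e, ← this]
    push_cast
    ring
  rec_snd i := by
    have := h.rec_snd (i + (N + 1))
    have e : seqCons y q (i + (N + 1)) = seqCons (q N) (fun i => q (i + (N + 1))) i := by
      rcases i with _ | i
      · rw [zero_add]; rfl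
      · rw [show i + 1 + (N + 1) = (i + (N + 1)) + 1 by ring]; rfl
    rw [← e, ← this]
    push_cast
    ring

end IsFrobenius

/-! ### Limits at zero -/

lemma tendsto_genPow_div (s z : ℝ) {p : ℕ → ℝ} (hp : EntireCoeff p) :
    Filter.Tendsto (fun η => η ^ (-s) * genPow s z p η) (𝓝[>] 0) (𝓝 (p 0)) := by
  have h1 : Filter.Tendsto (fun η : ℝ => ∑' i, p i * (z * η ^ 2) ^ i) (𝓝[>] 0)
      (𝓝 (∑' i, p i * (z * (0 : ℝ) ^ 2) ^ i)) :=
    ((hp.continuous.comp (by fun_prop : Continuous fun η : ℝ => z * η ^ 2)).tendsto 0).mono_left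
      nhdsWithin_le_nhds
  have h2 : ∑' i, p i * (z * (0 : ℝ) ^ 2) ^ i = p 0 := by
    rw [tsum_eq_single 0 (fun i hi => by simp [hi])]
    simp
  rw [h2] at h1
  refine h1.congr' ?_
  filter_upwards [self_mem_nhdsWithin] with η hη
  rw [genPow, ← mul_assoc, ← Real.rpow_add hη]
  simp

lemma tendsto_log_mul_rpow {r : ℝ} (hr : 0 < r) :
    Filter.Tendsto (fun η : ℝ => Real.log η * η ^ r) (𝓝[>] 0) (𝓝 0) :=
  tendsto_log_mul_rpow_nhdsGT_zero hr

lemma tendsto_rpow_nhdsGT_zero {r : ℝ} (hr : 0 < r) :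
    Filter.Tendsto (fun η : ℝ => η ^ r) (𝓝[>] 0) (𝓝 0) := by
  have := (Real.continuousAt_rpow_const 0 r (Or.inr hr.le)).tendsto
  rw [Real.zero_rpow hr.ne'] at this
  exact this.mono_left nhdsWithin_le_nhds

lemma tendsto_frob_mul_rpow {s z r : ℝ} {p q : ℕ → ℝ} (hp : EntireCoeff p) (hq : EntireCoeff q)
    (hr : 0 < s + r) :
    Filter.Tendsto (fun η => η ^ r * frob s z p q η) (𝓝[>] 0) (𝓝 0) := by
  have h := ((tendsto_genPow_div s z hp).mul (tendsto_rpow_nhdsGT_zero hr)).add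
    ((tendsto_genPow_div s z hq).mul (tendsto_log_mul_rpow hr))
  simp only [mul_zero, add_zero] at h
  refine h.congr' ?_
  filter_upwards [self_mem_nhdsWithin] with η hη
  have : η ^ r = η ^ (-s) * η ^ (s + r) := by
    rw [← Real.rpow_add hη]; ring_nf
  rw [this, frob]
  ring

/-- When the first logarithmic coefficient is zero, logarithms enter only from η ^ (s + 2) log η on
and do not disturb the leading term. -/
lemma tendsto_frob_leading (s z : ℝ) {p q : ℕ → ℝ} (hp : EntireCoeff p) (hq : EntireCoeff q)
    (hq0 : q 0 = 0) :
    Filter.Tendsto (fun η => η ^ (-s) * frob s z p q η) (𝓝[>] 0) (𝓝 (p 0)) := by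
  have h1 := tendsto_frob_mul_rpow (s := s + 2) (z := z) (r := -s) (p := 0)
    (fun r => by simp) (hq.tail 1) (by linarith)
  have h := (tendsto_genPow_div s z hp).add (h1.const_mul z)
  simp only [mul_zero, add_zero] at h
  refine h.congr' ?_
  filter_upwards [self_mem_nhdsWithin] with η hη
  have e := genPow_eq_sum_add (s := s) (z := z) hq 1 hη
  simp only [Finset.range_one, Finset.sum_singleton, hq0, zero_mul, zero_add, pow_one,
    Nat.cast_one, mul_one] at e
  have e0 : genPow (s + 2) z (0 : ℕ → ℝ) η = 0 := by simp [genPow]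
  rw [frob, frob, e, e0]
  ring

/-! ### The Frobenius coefficients for the exponents `0` and `-a` -/

/-- Coefficients of the Frobenius series with exponent `s`, which is `0` or `-a`. -/
def frobCoeff (a s : ℝ) : ℕ → ℝ × ℝ
  | 0 => (1, 0)
  | i + 1 =>
    let c := frobCoeff a s i
    let k := s + 2 * ((i + 1 : ℕ) : ℝ)
    -- At a resonance the recursion leaves the non-logarithmic coefficient free and determines the
    -- logarithmic one. The free coefficient is set to zero, so that the singular branch does not
    -- contribute to the datum at η ^ 0.
    if k * (k + a) = 0 then (0, c.1 / (2 * k + a))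
    else ((c.1 - (2 * k + a) * (c.2 / (k * (k + a)))) / (k * (k + a)), c.2 / (k * (k + a)))

section frobCoeff

variable {a s : ℝ}

/-- A resonance occurs only when the singular branch reaches the other exponent 0. -/
lemma indicial_eq_zero_iff (ha : 0 < a) (hs : s = 0 ∨ s = -a) (m : ℕ) (hm : 1 ≤ m) :
    (s + 2 * m) * (s + 2 * m + a) = 0 ↔ s = -a ∧ a = 2 * m := by
  have hm' : (1 : ℝ) ≤ m := by exact_mod_cast hm
  rw [mul_eq_zero]
  rcases hs with rfl | rfl
  · constructor
    · rintro (h | h) <;> linarith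
    · rintro ⟨h, -⟩; linarith
  · constructor
    · rintro (h | h)
      · exact ⟨rfl, by linarith⟩
      · linarith
    · rintro ⟨-, h⟩
      left; linarith

/-- Logarithms start at zero, are created only at a resonance, and otherwise are only propagated by
division; so a logarithm betrays a resonance at or before its index. -/
lemma frobCoeff_log_ne_zero (ha : 0 < a) (hs : s = 0 ∨ s = -a) (j : ℕ)
    (h : (frobCoeff a s j).2 ≠ 0) : ∃ m : ℕ, 1 ≤ m ∧ m ≤ j ∧ s = -a ∧ a = 2 * m := by
  induction j with
  | zero => simp [frobCoeff] at h
  | succ j ih =>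
    by_cases hk : (s + 2 * ((j + 1 : ℕ) : ℝ)) * (s + 2 * ((j + 1 : ℕ) : ℝ) + a) = 0
    · have := (indicial_eq_zero_iff ha hs (j + 1) (by omega)).1 hk
      exact ⟨j + 1, by omega, le_rfl, this⟩
    · simp only [frobCoeff, hk, if_false] at h
      obtain ⟨m, h1, h2, h3⟩ := ih (fun h0 => h (by rw [h0, zero_div]))
      exact ⟨m, h1, by omega, h3⟩

lemma frobCoeff_succ_of_resonant {m : ℕ} (hs : s = -a) (hm : a = 2 * (m + 1 : ℕ)) :
    (frobCoeff a s (m + 1)).1 = 0 := by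
  have hk : (s + 2 * ((m + 1 : ℕ) : ℝ)) * (s + 2 * ((m + 1 : ℕ) : ℝ) + a) = 0 := by
    rw [hs, ← hm]; ring
  simp only [frobCoeff, hk, if_true]

/-- Once i ≥ a the exponent k = s + 2(i + 1) is at least i in both branches, so no resonance remains
and the divisor k (k + a) is at least i. The constant 4 covers one contribution from the first
coefficient and three from the logarithmic one. -/
lemma frobCoeff_bound (ha : 0 < a) (hs : s = 0 ∨ s = -a) {i : ℕ} (hi : a ≤ i) (hi1 : 1 ≤ i) :
    |(frobCoeff a s (i + 1)).1| + |(frobCoeff a s (i + 1)).2|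
      ≤ 4 / i * (|(frobCoeff a s i).1| + |(frobCoeff a s i).2|) := by
  set k := s + 2 * ((i + 1 : ℕ) : ℝ) with hk
  have hi1' : (1 : ℝ) ≤ i := by exact_mod_cast hi1
  have hik : (i : ℝ) ≤ k := by
    rw [hk]; push_cast
    rcases hs with rfl | rfl <;> linarith
  have hk0 : 0 < k := by linarith
  have hne : k * (k + a) ≠ 0 := by positivity
  simp only [frobCoeff, ← hk, hne, if_false]
  set P := (frobCoeff a s i).1
  set Q := (frobCoeff a s i).2
  have hA : 1 / (k * (k + a)) ≤ 1 / i := by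
    apply one_div_le_one_div_of_le (by linarith)
    nlinarith
  have hB : (2 * k + a) / (k * (k + a)) ≤ 2 / i := by
    rw [div_le_div_iff₀ (by positivity) (by linarith)]
    nlinarith
  have hA1 : 1 / (k * (k + a)) ≤ 1 := hA.trans (by rw [div_le_one (by linarith)]; exact hi1')
  have h1 : |(P - (2 * k + a) * (Q / (k * (k + a)))) / (k * (k + a))|
      ≤ 1 / i * |P| + 2 / i * |Q| := by
    have e : (P - (2 * k + a) * (Q / (k * (k + a)))) / (k * (k + a))
        = 1 / (k * (k + a)) * P - (2 * k + a) / (k * (k + a)) * (1 / (k * (k + a))) * Q := by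
      field_simp
    rw [e]
    refine (abs_sub _ _).trans ?_
    rw [abs_mul, abs_mul, abs_mul, abs_of_pos (by positivity : 0 < 1 / (k * (k + a))),
      abs_of_pos (by positivity : 0 < (2 * k + a) / (k * (k + a)))]
    gcongr
    calc (2 * k + a) / (k * (k + a)) * (1 / (k * (k + a))) ≤ 2 / i * 1 := by gcongr
      _ = 2 / i := mul_one _
  have h2 : |Q / (k * (k + a))| ≤ 1 / i * |Q| := by
    rw [div_eq_mul_one_div, abs_mul, abs_of_pos (by positivity : 0 < 1 / (k * (k + a))), mul_comm]
    gcongr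
  have h3 : 0 ≤ |P| / (i : ℝ) := by positivity
  have h4 : 0 ≤ |Q| / (i : ℝ) := by positivity
  calc _ ≤ 1 / i * |P| + 2 / i * |Q| + 1 / i * |Q| := add_le_add h1 h2
    _ = |P| / i + 3 * (|Q| / i) := by ring
    _ ≤ 4 * (|P| / i) + 4 * (|Q| / i) := by linarith
    _ = _ := by ring

lemma frobCoeff_summable (ha : 0 < a) (hs : s = 0 ∨ s = -a) (r : ℝ) :
    Summable fun i => (|(frobCoeff a s i).1| + |(frobCoeff a s i).2|) * r ^ i := by
  refine summable_of_ratio_norm_eventually_le (r := 1 / 2) (by norm_num) ?_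
  -- Beyond a the coefficient bound 4 / i applies, and beyond 8|r| the ratio 4|r| / i is at most
  -- 1/2.
  filter_upwards [Filter.eventually_ge_atTop (max 1 (max ⌈a⌉₊ ⌈8 * |r|⌉₊))] with i hi
  have h1 : 1 ≤ i := le_trans (le_max_left _ _) hi
  have h2 : a ≤ i := Nat.ceil_le.1 (le_trans ((le_max_left _ _).trans (le_max_right _ _)) hi)
  have h3 : 8 * |r| ≤ i :=
    Nat.ceil_le.1 (le_trans ((le_max_right _ _).trans (le_max_right _ _)) hi)
  have hi0 : (0 : ℝ) < i := by exact_mod_cast h1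
  have hb := frobCoeff_bound ha hs h2 h1
  set M := |(frobCoeff a s i).1| + |(frobCoeff a s i).2|
  set M' := |(frobCoeff a s (i + 1)).1| + |(frobCoeff a s (i + 1)).2|
  have hM : 0 ≤ M := by positivity
  have hM' : 0 ≤ M' := by positivity
  rw [norm_mul, norm_mul, Real.norm_of_nonneg hM, Real.norm_of_nonneg hM', norm_pow, norm_pow,
    pow_succ, Real.norm_eq_abs]
  have : 4 / i * |r| ≤ 1 / 2 := by
    rw [div_mul_eq_mul_div, div_le_iff₀ hi0]; linarith
  calc M' * (|r| ^ i * |r|) ≤ 4 / i * M * (|r| ^ i * |r|) := by gcongr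
    _ = (4 / i * |r|) * (M * |r| ^ i) := by ring
    _ ≤ 1 / 2 * (M * |r| ^ i) := by gcongr

/-- The sequence of non-logarithmic coefficients. -/
def frobFst (a s : ℝ) (i : ℕ) : ℝ := (frobCoeff a s i).1

/-- The sequence of logarithmic coefficients. -/
def frobSnd (a s : ℝ) (i : ℕ) : ℝ := (frobCoeff a s i).2

lemma isFrobenius_frobCoeff (ha : 0 < a) (hs : s = 0 ∨ s = -a) :
    IsFrobenius a s 0 0 (frobFst a s) (frobSnd a s) where
  entire_fst r := by
    refine Summable.of_norm_bounded (frobCoeff_summable ha hs |r|) fun i => ?_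
    rw [norm_mul, norm_pow, Real.norm_eq_abs, Real.norm_eq_abs]
    gcongr
    exact le_add_of_nonneg_right (abs_nonneg _)
  entire_snd r := by
    refine Summable.of_norm_bounded (frobCoeff_summable ha hs |r|) fun i => ?_
    rw [norm_mul, norm_pow, Real.norm_eq_abs, Real.norm_eq_abs]
    gcongr
    exact le_add_of_nonneg_left (abs_nonneg _)
  rec_fst i := by
    rcases i with _ | i
    · simp only [frobFst, frobSnd, frobCoeff, seqCons]
      rcases hs with rfl | rfl <;> simp
    · simp only [frobFst, frobSnd, frobCoeff, seqCons]
      by_cases hk : (s + 2 * ((i + 1 : ℕ) : ℝ)) * (s + 2 * ((i + 1 : ℕ) : ℝ) + a) = 0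
      · have h := (indicial_eq_zero_iff ha hs (i + 1) (by omega)).1 hk
        -- At the resonance k = 0, so this number is a.
        have : 2 * (s + 2 * ((i + 1 : ℕ) : ℝ)) + a ≠ 0 := by
          rw [← h.2, h.1]; linarith
        simp only [hk, if_true]
        field_simp
        ring
      · simp only [hk, if_false]
        generalize s + 2 * ((i + 1 : ℕ) : ℝ) = k at hk ⊢
        have h1 : k ≠ 0 := left_ne_zero_of_mul hk
        have h2 : k + a ≠ 0 := right_ne_zero_of_mul hk
        field_simp
        ring
  rec_snd i := by
    rcases i with _ | i
    · simp [frobSnd, frobCoeff, seqCons]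
    · simp only [frobSnd, seqCons]
      by_cases hk : (s + 2 * ((i + 1 : ℕ) : ℝ)) * (s + 2 * ((i + 1 : ℕ) : ℝ) + a) = 0
      · have h := (indicial_eq_zero_iff ha hs (i + 1) (by omega)).1 hk
        rw [hk, zero_mul]
        -- At the resonance the equation demands that the preceding logarithmic coefficient vanish.
        -- Otherwise an earlier resonance a = 2m with m ≤ i would exist, while here a = 2(i + 1).
        by_contra hne
        obtain ⟨m, h1, h2, h3, h4⟩ := frobCoeff_log_ne_zero ha hs i (Ne.symm hne)
        have : (m : ℝ) = ((i + 1 : ℕ) : ℝ) := by linarith [h.2]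
        have : m = i + 1 := by exact_mod_cast this
        omega
      · simp only [frobCoeff, hk, if_false]
        rw [mul_div_cancel₀ _ hk]

end frobCoeff

/-! ### Energy estimate -/

/-- Integration from 0: the difference between the antiderivative of the bound and g is monotone and
tends to zero at 0. -/
lemma le_rpow_of_deriv_le {g g' : ℝ → ℝ} {C d T : ℝ} (hd : -1 < d)
    (h0 : Filter.Tendsto g (𝓝[>] 0) (𝓝 0))
    (hg : ∀ η ∈ Set.Ioc 0 T, HasDerivAt g (g' η) η)
    (hle : ∀ η ∈ Set.Ioc 0 T, g' η ≤ C * η ^ d) {η : ℝ} (hη : η ∈ Set.Ioc 0 T) :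
    g η ≤ C / (d + 1) * η ^ (d + 1) := by
  have hd1 : 0 < d + 1 := by linarith
  set h : ℝ → ℝ := fun η => C / (d + 1) * η ^ (d + 1) - g η with hh
  have hder : ∀ η ∈ Set.Ioc 0 T, HasDerivAt h (C * η ^ d - g' η) η := fun η hη => by
    have h1 : HasDerivAt (fun η : ℝ => η ^ (d + 1)) ((d + 1) * η ^ (d + 1 - 1)) η :=
      Real.hasDerivAt_rpow_const (Or.inl hη.1.ne')
    refine ((h1.const_mul (C / (d + 1))).sub (hg η hη)).congr_deriv ?_
    rw [add_sub_cancel_right]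
    field_simp
  have hmono : MonotoneOn h (Set.Ioc 0 T) := by
    refine monotoneOn_of_deriv_nonneg (convex_Ioc 0 T)
      (fun x hx => (hder x hx).continuousAt.continuousWithinAt) (fun x hx => ?_) (fun x hx => ?_)
    · exact (hder x (interior_subset hx)).differentiableAt.differentiableWithinAt
    · rw [(hder x (interior_subset hx)).deriv]
      linarith [hle x (interior_subset hx)]
  have hlim : Filter.Tendsto h (𝓝[>] 0) (𝓝 0) := by
    simpa using ((tendsto_rpow_nhdsGT_zero hd1).const_mul (C / (d + 1))).sub h0
  have : 0 ≤ h η := by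
    refine le_of_tendsto hlim ?_
    filter_upwards [Ioo_mem_nhdsGT hη.1] with ε hε
    exact hmono ⟨hε.1, hε.2.le.trans hη.2⟩ hη hε.2.le
  simp only [hh] at this
  linarith

/-- The logarithm is traded for half a power of η, after rescaling to η / T in (0, 1], where |log τ|
τ ^ (1/2) < 2. This is the source of the half powers lost in the estimates below. -/
lemma exists_bound_log (x y : ℝ) {T : ℝ} (hT : 0 < T) :
    ∃ B : ℝ, 0 ≤ B ∧ ∀ η ∈ Set.Ioc 0 T, |x + y * Real.log η| ≤ B * η ^ (-(1 / 2) : ℝ) := by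
  refine ⟨T ^ (1 / 2 : ℝ) * (|x| + |y| * (|Real.log T| + 2)), by positivity, fun η hη => ?_⟩
  have hη0 := hη.1
  have hτ : 0 < η / T := div_pos hη0 hT
  have hτ1 : η / T ≤ 1 := (div_le_one hT).2 hη.2
  have h1 := (Real.abs_log_mul_self_rpow_lt (η / T) (1 / 2) hτ hτ1 (by norm_num)).le
  have hr1 : (η / T) ^ (1 / 2 : ℝ) ≤ 1 := Real.rpow_le_one hτ.le hτ1 (by norm_num)
  have hlog : Real.log η = Real.log T + Real.log (η / T) := by
    rw [Real.log_div hη0.ne' hT.ne']; ring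
  have hsplit : η ^ (1 / 2 : ℝ) = T ^ (1 / 2 : ℝ) * (η / T) ^ (1 / 2 : ℝ) := by
    rw [← Real.mul_rpow hT.le hτ.le, mul_div_cancel₀ _ hT.ne']
  have hpos : 0 < η ^ (1 / 2 : ℝ) := Real.rpow_pos_of_pos hη0 _
  rw [Real.rpow_neg hη0.le, ← div_eq_mul_inv, le_div_iff₀ hpos]
  set R := (η / T) ^ (1 / 2 : ℝ)
  have hR0 : 0 ≤ R := Real.rpow_nonneg hτ.le _
  have hT0 : 0 ≤ T ^ (1 / 2 : ℝ) := Real.rpow_nonneg hT.le _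
  rw [abs_mul, abs_of_nonneg hR0] at h1
  norm_num at h1
  have h2 : |x + y * Real.log η| ≤ |x| + |y| * (|Real.log T| + |Real.log (η / T)|) := by
    refine (abs_add_le _ _).trans ?_
    rw [abs_mul, hlog]
    gcongr
    exact abs_add_le _ _
  calc |x + y * Real.log η| * η ^ (1 / 2 : ℝ)
      ≤ (|x| + |y| * (|Real.log T| + |Real.log (η / T)|)) * (T ^ (1 / 2 : ℝ) * R) := by
        rw [hsplit]; gcongr
    _ = T ^ (1 / 2 : ℝ) * (|x| * R + |y| * (|Real.log T| * R + |Real.log (η / T)| * R)) := by ring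
    _ ≤ T ^ (1 / 2 : ℝ) * (|x| * 1 + |y| * (|Real.log T| * 1 + 2)) := by gcongr
    _ = _ := by ring

/-- For the energy e = v² + μ u², with v = u' and source f, the terms in μ cancel: e' = -2(a + 1) v²
/ η + 2 v f. As 2 v f ≤ v² / η + η f², the friction absorbs the first part and e' ≤ η f² ≤ B² η ^
(2s - 4). Integrating from 0, where u and v vanish because s ≥ 2, bounds v without reference to μ,
and a second integration bounds u. -/
theorem IsFrobenius.energy_bound {a s x y : ℝ} {p q : ℕ → ℝ} (h : IsFrobenius a s x y p q)
    (ha : 0 ≤ a) (hs : 2 ≤ s) {T : ℝ} (hT : 0 < T) :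
    ∃ C : ℝ, 0 ≤ C ∧ ∀ μ : ℝ, 0 ≤ μ → ∀ η ∈ Set.Ioc 0 T,
      |frob s (-μ) p q η| ≤ C * η ^ (s - 1 / 2) ∧
      |frobDeriv s (-μ) p q η| ≤ C * η ^ (s - 3 / 2) := by
  obtain ⟨B, hB, hbound⟩ := exists_bound_log x y hT
  refine ⟨B, hB, fun μ hμ => ?_⟩
  set u := frob s (-μ) p q
  set v := frobDeriv s (-μ) p q
  have hu0 : Filter.Tendsto u (𝓝[>] 0) (𝓝 0) := by
    simpa using tendsto_frob_mul_rpow (s := s) (z := -μ) (r := 0) h.entire_fst h.entire_snd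
      (by linarith)
  have hv0 : Filter.Tendsto v (𝓝[>] 0) (𝓝 0) := by
    refine (tendsto_frob_mul_rpow (s := s) (z := -μ) (r := -1)
      ((h.entire_fst.affine_mul s).add h.entire_snd) (h.entire_snd.affine_mul s)
      (by linarith)).congr' ?_
    filter_upwards [self_mem_nhdsWithin] with η hη
    rw [Real.rpow_neg_one, inv_mul_eq_div]
    rfl
  set f : ℝ → ℝ := fun η => (x + y * Real.log η) * η ^ (s - 2)
  have hu : ∀ η, 0 < η → HasDerivAt u (v η) η := fun η hη => h.hasDerivAt hη
  have hv : ∀ η, 0 < η → HasDerivAt v (-((a + 1) / η) * v η + -μ * u η + f η) η :=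
    fun η hη => h.hasDerivAt_frobDeriv hη
  have he : ∀ η ∈ Set.Ioc 0 T, (v η) ^ 2 + μ * (u η) ^ 2
      ≤ B ^ 2 / (2 * s - 4 + 1) * η ^ (2 * s - 4 + 1) := by
    intro η hη
    refine le_rpow_of_deriv_le (T := T) (g := fun η => (v η) ^ 2 + μ * (u η) ^ 2)
      (g' := fun η => 2 * v η * (-((a + 1) / η) * v η + -μ * u η + f η) + μ * (2 * u η * v η))
      (by linarith) ?_ (fun η hη => ?_) (fun η hη => ?_) hη
    · simpa using (hv0.pow 2).add ((hu0.pow 2).const_mul μ)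
    · refine HasDerivAt.congr_deriv (((hv η hη.1).pow 2).add (((hu η hη.1).pow 2).const_mul μ)) ?_
      norm_num
    · have hη0 := hη.1
      have hf : η * f η ^ 2 ≤ B ^ 2 * η ^ (2 * s - 4) := by
        have h1 := hbound η hη
        have h2 : (x + y * Real.log η) ^ 2 ≤ (B * η ^ (-(1 / 2) : ℝ)) ^ 2 :=
          sq_le_sq' (by linarith [neg_abs_le (x + y * Real.log η)]) ((le_abs_self _).trans h1)
        have h3 : (η ^ (-(1 / 2) : ℝ)) ^ 2 = η⁻¹ := by
          rw [← Real.rpow_natCast, ← Real.rpow_mul hη0.le, ← Real.rpow_neg_one]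
          norm_num
        have h4 : η ^ (2 * s - 4) = (η ^ (s - 2)) ^ 2 := by
          rw [← Real.rpow_natCast, ← Real.rpow_mul hη0.le]
          congr 1; push_cast; ring
        rw [mul_pow, h3] at h2
        calc η * f η ^ 2 = (x + y * Real.log η) ^ 2 * (η * (η ^ (s - 2)) ^ 2) := by
              simp only [f]; ring
          _ ≤ B ^ 2 * η⁻¹ * (η * (η ^ (s - 2)) ^ 2) := by gcongr
          _ = _ := by rw [h4]; field_simp
      have h5 : 2 * v η * f η ≤ (v η) ^ 2 / η + η * f η ^ 2 := by
        have : 0 ≤ (v η - η * f η) ^ 2 / η := by positivity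
        have e : (v η - η * f η) ^ 2 / η = (v η) ^ 2 / η + η * f η ^ 2 - 2 * v η * f η := by
          field_simp; ring
        linarith
      have h6 : (v η) ^ 2 / η ≤ 2 * ((a + 1) / η) * (v η) ^ 2 := by
        have h7 : 0 ≤ (v η) ^ 2 / η := by positivity
        have e : 2 * ((a + 1) / η) * (v η) ^ 2 = (2 * a + 2) * ((v η) ^ 2 / η) := by ring
        rw [e]
        nlinarith
      linarith
  have hv1 : ∀ η ∈ Set.Ioc 0 T, |v η| ≤ B * η ^ (s - 3 / 2) := by
    intro η hη
    have hη0 := hη.1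
    refine abs_le_of_sq_le_sq ?_ (by positivity)
    have h1 := he η hη
    have h2 : (η ^ (s - 3 / 2)) ^ 2 = η ^ (2 * s - 4 + 1) := by
      rw [← Real.rpow_natCast, ← Real.rpow_mul hη0.le]
      congr 1; push_cast; ring
    rw [mul_pow, h2]
    -- The denominator 2s - 3 is at least 1.
    have h3 : B ^ 2 / (2 * s - 4 + 1) ≤ B ^ 2 := div_le_self (by positivity) (by linarith)
    have h4 : B ^ 2 / (2 * s - 4 + 1) * η ^ (2 * s - 4 + 1) ≤ B ^ 2 * η ^ (2 * s - 4 + 1) := by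
      gcongr
    have h5 : 0 ≤ μ * (u η) ^ 2 := by positivity
    linarith
  intro η hη
  refine ⟨?_, hv1 η hη⟩
  have hη0 := hη.1
  have e : s - 3 / 2 + 1 = s - 1 / 2 := by ring
  have h1 := le_rpow_of_deriv_le (by linarith : -1 < s - 3 / 2) hu0
    (fun η hη => hu η hη.1) (fun η hη => (le_abs_self _).trans (hv1 η hη)) hη
  have h2 := le_rpow_of_deriv_le (g := fun η => -u η) (by linarith : -1 < s - 3 / 2)
    (by simpa using hu0.neg)
    (fun η hη => (hu η hη.1).neg) (fun η hη => (neg_le_abs _).trans (hv1 η hη)) hη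
  have h3 : B / (s - 3 / 2 + 1) * η ^ (s - 3 / 2 + 1) ≤ B * η ^ (s - 1 / 2) := by
    rw [e]
    gcongr
    exact div_le_self hB (by linarith)
  exact abs_le.2 ⟨by linarith, by linarith⟩

/-! ### Polynomial bounds in the spectral parameter -/

/-- `g η μ` is polynomially bounded in `μ ≥ 0`, locally uniformly in `η > 0`. -/
def PolyBdd (g : ℝ → ℝ → ℝ) : Prop :=
  ∀ ε T : ℝ, 0 < ε → ∃ C : ℝ, 0 ≤ C ∧ ∃ K : ℕ, ∀ μ : ℝ, 0 ≤ μ → ∀ η ∈ Set.Icc ε T,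
    |g η μ| ≤ C * (1 + μ) ^ K

namespace PolyBdd

variable {g h : ℝ → ℝ → ℝ}

lemma of_continuousOn {h : ℝ → ℝ} (hh : ContinuousOn h (Set.Ioi 0)) :
    PolyBdd fun η _ => h η := by
  intro ε T hε
  obtain ⟨C, hC⟩ := isCompact_Icc.exists_bound_of_continuousOn
    (hh.mono fun x (hx : x ∈ Set.Icc ε T) => hε.trans_le hx.1)
  refine ⟨max C 0, le_max_right _ _, 0, fun μ _ η hη => ?_⟩
  simpa using Or.inl (hC η hη)

lemma param : PolyBdd fun _ μ => μ := fun ε T _ =>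
  ⟨1, zero_le_one, 1, fun μ hμ η _ => by rw [abs_of_nonneg hμ]; linarith⟩

lemma add (hg : PolyBdd g) (hh : PolyBdd h) : PolyBdd fun η μ => g η μ + h η μ := by
  intro ε T hε
  obtain ⟨C, hC, K, hK⟩ := hg ε T hε
  obtain ⟨D, hD, L, hL⟩ := hh ε T hε
  refine ⟨C + D, by positivity, K + L, fun μ hμ η hη => ?_⟩
  have h1 : (1 + μ) ^ K ≤ (1 + μ) ^ (K + L) := pow_le_pow_right₀ (by linarith) (by omega)
  have h2 : (1 + μ) ^ L ≤ (1 + μ) ^ (K + L) := pow_le_pow_right₀ (by linarith) (by omega)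
  calc _ ≤ |g η μ| + |h η μ| := abs_add_le _ _
    _ ≤ C * (1 + μ) ^ K + D * (1 + μ) ^ L := add_le_add (hK μ hμ η hη) (hL μ hμ η hη)
    _ ≤ C * (1 + μ) ^ (K + L) + D * (1 + μ) ^ (K + L) := by gcongr
    _ = _ := by ring

lemma mul (hg : PolyBdd g) (hh : PolyBdd h) : PolyBdd fun η μ => g η μ * h η μ := by
  intro ε T hε
  obtain ⟨C, hC, K, hK⟩ := hg ε T hε
  obtain ⟨D, hD, L, hL⟩ := hh ε T hε
  refine ⟨C * D, by positivity, K + L, fun μ hμ η hη => ?_⟩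
  calc |g η μ * h η μ| = |g η μ| * |h η μ| := abs_mul _ _
    _ ≤ C * (1 + μ) ^ K * (D * (1 + μ) ^ L) := by
      gcongr
      exacts [hK μ hμ η hη, hL μ hμ η hη]
    _ = _ := by ring

lemma const (c : ℝ) : PolyBdd fun _ _ => c := of_continuousOn continuousOn_const

lemma sum {ι : Type*} (s : Finset ι) {g : ι → ℝ → ℝ → ℝ} (hg : ∀ i, PolyBdd (g i)) :
    PolyBdd fun η μ => ∑ i ∈ s, g i η μ := by
  classical
  induction s using Finset.induction_on with
  | empty => simpa using const 0
  | insert i s hi ih => simpa [Finset.sum_insert hi] using (hg i).add ih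

lemma pow (hg : PolyBdd g) (n : ℕ) : PolyBdd fun η μ => g η μ ^ n := by
  induction n with
  | zero => simpa using const 1
  | succ n ih => simpa [pow_succ] using ih.mul hg

lemma of_le (hg : PolyBdd g) (hle : ∀ T : ℝ, 0 < T → ∃ C : ℝ, 0 ≤ C ∧
    ∀ μ, 0 ≤ μ → ∀ η ∈ Set.Ioc 0 T, |h η μ| ≤ C * |g η μ|) : PolyBdd h := by
  intro ε T hε
  by_cases hT : 0 < T
  · obtain ⟨C, hC, K, hK⟩ := hg ε T hε
    obtain ⟨D, hD, h1⟩ := hle T hT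
    refine ⟨D * C, by positivity, K, fun μ hμ η hη => ?_⟩
    rw [mul_assoc]
    exact (h1 μ hμ η ⟨hε.trans_le hη.1, hη.2⟩).trans
      (mul_le_mul_of_nonneg_left (hK μ hμ η hη) hD)
  · exact ⟨0, le_rfl, 0, fun μ _ η hη => absurd (hε.trans_le (hη.1.trans hη.2)) hT⟩

end PolyBdd

/-- `g` and its first `k` derivatives in `η > 0` are polynomially bounded in `μ ≥ 0`. -/
def SmoothPolyBdd : ℕ → (ℝ → ℝ → ℝ) → Prop
  | 0, g => PolyBdd g
  | k + 1, g => PolyBdd g ∧ ∃ g' : ℝ → ℝ → ℝ,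
      (∀ μ, 0 ≤ μ → ∀ η, 0 < η → HasDerivAt (fun η => g η μ) (g' η μ) η) ∧ SmoothPolyBdd k g'

namespace SmoothPolyBdd

variable {g h : ℝ → ℝ → ℝ} {k : ℕ}

lemma polyBdd (hg : SmoothPolyBdd k g) : PolyBdd g := by
  cases k with
  | zero => exact hg
  | succ k => exact hg.1

lemma of_succ (hg : SmoothPolyBdd (k + 1) g) : SmoothPolyBdd k g := by
  induction k generalizing g with
  | zero => exact hg.1
  | succ k ih =>
    obtain ⟨h0, g', h1, h2⟩ := hg
    exact ⟨h0, g', h1, ih h2⟩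

lemma add (hg : SmoothPolyBdd k g) (hh : SmoothPolyBdd k h) :
    SmoothPolyBdd k fun η μ => g η μ + h η μ := by
  induction k generalizing g h with
  | zero => exact PolyBdd.add hg hh
  | succ k ih =>
    obtain ⟨h0, g', h1, h2⟩ := hg
    obtain ⟨i0, h', i1, i2⟩ := hh
    exact ⟨h0.add i0, _, fun μ hμ η hη => (h1 μ hμ η hη).add (i1 μ hμ η hη), ih h2 i2⟩

lemma mul (hg : SmoothPolyBdd k g) (hh : SmoothPolyBdd k h) :
    SmoothPolyBdd k fun η μ => g η μ * h η μ := by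
  induction k generalizing g h with
  | zero => exact PolyBdd.mul hg hh
  | succ k ih =>
    have hg' := hg.of_succ
    have hh' := hh.of_succ
    obtain ⟨h0, g', h1, h2⟩ := hg
    obtain ⟨i0, h', i1, i2⟩ := hh
    exact ⟨h0.mul i0, _, fun μ hμ η hη => (h1 μ hμ η hη).mul (i1 μ hμ η hη),
      (ih h2 hh').add (ih hg' i2)⟩

lemma of_contDiffOn {f : ℝ → ℝ} (hf : ContDiffOn ℝ ∞ f (Set.Ioi 0)) (k : ℕ) :
    SmoothPolyBdd k fun η _ => f η := by
  induction k generalizing f with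
  | zero => exact PolyBdd.of_continuousOn hf.continuousOn
  | succ k ih =>
    have h := (contDiffOn_infty_iff_deriv_of_isOpen isOpen_Ioi).1 hf
    exact ⟨PolyBdd.of_continuousOn hf.continuousOn, fun η _ => deriv f η,
      fun μ _ η hη => ((h.1 η hη).differentiableAt (isOpen_Ioi.mem_nhds hη)).hasDerivAt, ih h.2⟩

lemma param (k : ℕ) : SmoothPolyBdd k fun _ μ => μ := by
  cases k with
  | zero => exact PolyBdd.param
  | succ k => exact ⟨PolyBdd.param, fun _ _ => 0, fun μ _ η _ => hasDerivAt_const η μ,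
      of_contDiffOn contDiffOn_const k⟩

end SmoothPolyBdd

/-! ### The two fundamental solutions of the mode equation -/

/-- The Frobenius solution with exponent `s ∈ {0, -a}` of `u'' + (a + 1) / η * u' = -μ * u`. -/
def mode (a s η μ : ℝ) : ℝ := frob s (-μ) (frobFst a s) (frobSnd a s) η

/-- The derivative of `mode` with respect to `η`. -/
def modeDeriv (a s η μ : ℝ) : ℝ := frobDeriv s (-μ) (frobFst a s) (frobSnd a s) η

section mode

variable {a s : ℝ}

lemma hasDerivAt_mode (ha : 0 < a) (hs : s = 0 ∨ s = -a) (μ : ℝ) {η : ℝ} (hη : 0 < η) :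
    HasDerivAt (fun η => mode a s η μ) (modeDeriv a s η μ) η :=
  (isFrobenius_frobCoeff ha hs).hasDerivAt hη

lemma hasDerivAt_modeDeriv (ha : 0 < a) (hs : s = 0 ∨ s = -a) (μ : ℝ) {η : ℝ} (hη : 0 < η) :
    HasDerivAt (fun η => modeDeriv a s η μ)
      (-((a + 1) / η) * modeDeriv a s η μ + -1 * (μ * mode a s η μ)) η := by
  refine ((isFrobenius_frobCoeff ha hs).hasDerivAt_frobDeriv (z := -μ) hη).congr_deriv ?_
  rw [modeDeriv, mode]
  ring

/-- The remainder is (-μ) ^ (N + 1) times a tail series, to which the energy estimate applies with a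
constant independent of μ. -/
lemma mode_remainder (ha : 0 < a) (hs : s = 0 ∨ s = -a) {N : ℕ}
    (hN : 2 ≤ s + 2 * ((N + 1 : ℕ) : ℝ)) {T : ℝ} (hT : 0 < T) :
    ∃ C : ℝ, 0 ≤ C ∧ ∀ μ : ℝ, 0 ≤ μ → ∀ η ∈ Set.Ioc 0 T,
      |mode a s η μ - ∑ i ∈ Finset.range (N + 1),
          (frobFst a s i + frobSnd a s i * Real.log η) * (-μ) ^ i * η ^ (s + 2 * i)|
        ≤ C * μ ^ (N + 1) * η ^ (s + 2 * ((N + 1 : ℕ) : ℝ) - 1 / 2) := by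
  have hF := isFrobenius_frobCoeff ha hs
  obtain ⟨C, hC, hb⟩ := (hF.tail N).energy_bound ha.le hN hT
  refine ⟨C, hC, fun μ hμ η hη => ?_⟩
  rw [mode, frob_eq_sum_add hF.entire_fst hF.entire_snd (N + 1) hη.1, add_sub_cancel_left, abs_mul,
    abs_pow, abs_neg, abs_of_nonneg hμ, mul_comm C, mul_assoc]
  gcongr
  exact (hb μ hμ η hη).1

lemma modeDeriv_remainder (ha : 0 < a) (hs : s = 0 ∨ s = -a) {N : ℕ}
    (hN : 2 ≤ s + 2 * ((N + 1 : ℕ) : ℝ)) {T : ℝ} (hT : 0 < T) :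
    ∃ C : ℝ, 0 ≤ C ∧ ∀ μ : ℝ, 0 ≤ μ → ∀ η ∈ Set.Ioc 0 T,
      |modeDeriv a s η μ - (∑ i ∈ Finset.range (N + 1),
          ((s + 2 * i) * frobFst a s i + frobSnd a s i
            + (s + 2 * i) * frobSnd a s i * Real.log η) * (-μ) ^ i * η ^ (s + 2 * i)) / η|
        ≤ C * μ ^ (N + 1) * η ^ (s + 2 * ((N + 1 : ℕ) : ℝ) - 3 / 2) := by
  have hF := isFrobenius_frobCoeff ha hs
  obtain ⟨C, hC, hb⟩ := (hF.tail N).energy_bound ha.le hN hT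
  refine ⟨C, hC, fun μ hμ η hη => ?_⟩
  have e := frob_eq_sum_add (s := s) (z := -μ) ((hF.entire_fst.affine_mul s).add hF.entire_snd)
    (hF.entire_snd.affine_mul s) (N + 1) hη.1
  have e2 : frob (s + 2 * ((N + 1 : ℕ) : ℝ)) (-μ)
      (fun i => (s + 2 * ((i + (N + 1) : ℕ) : ℝ)) * frobFst a s (i + (N + 1))
        + frobSnd a s (i + (N + 1)))
      (fun i => (s + 2 * ((i + (N + 1) : ℕ) : ℝ)) * frobSnd a s (i + (N + 1))) η / η
      = frobDeriv (s + 2 * ((N + 1 : ℕ) : ℝ)) (-μ) (fun i => frobFst a s (i + (N + 1)))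
        (fun i => frobSnd a s (i + (N + 1))) η := by
    rw [frobDeriv]
    congr 2 <;> ext i <;> push_cast <;> ring
  rw [modeDeriv, frobDeriv, e, add_div, add_sub_cancel_left, mul_div_assoc, e2, abs_mul,
    abs_pow, abs_neg, abs_of_nonneg hμ, mul_comm C, mul_assoc]
  gcongr
  exact (hb μ hμ η hη).2

/-! ### Polynomial growth of the modes in the spectral parameter -/

lemma exists_large_exponent (s K : ℝ) : ∃ N : ℕ, K ≤ s + 2 * ((N + 1 : ℕ) : ℝ) := by
  obtain ⟨N, hN⟩ := exists_nat_ge ((K - s) / 2)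
  refine ⟨N, ?_⟩
  push_cast
  linarith

lemma continuousOn_log_rpow (x y r : ℝ) :
    ContinuousOn (fun η : ℝ => (x + y * Real.log η) * η ^ r) (Set.Ioi 0) := by
  have h1 : ContinuousOn Real.log (Set.Ioi 0) :=
    Real.continuousOn_log.mono fun x hx => (Set.mem_Ioi.1 hx).ne'
  have h2 : ContinuousOn (fun η : ℝ => η ^ r) (Set.Ioi 0) :=
    fun η hη => (Real.continuousAt_rpow_const η r (Or.inl (Set.mem_Ioi.1 hη).ne')).continuousWithinAt
  fun_prop

lemma polyBdd_partial (x y : ℕ → ℝ) (s : ℝ) (N : ℕ) :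
    PolyBdd fun η μ => ∑ i ∈ Finset.range N,
      (x i + y i * Real.log η) * (-μ) ^ i * η ^ (s + 2 * i) := by
  refine PolyBdd.sum _ fun i => ?_
  have h := (PolyBdd.of_continuousOn (continuousOn_log_rpow (x i) (y i) (s + 2 * i))).mul
    (((PolyBdd.const (-1)).mul PolyBdd.param).pow i)
  convert h using 3
  ring

lemma polyBdd_pow_mul_rpow (n : ℕ) (r : ℝ) : PolyBdd fun η μ => μ ^ n * η ^ r := by
  have h := (PolyBdd.of_continuousOn (continuousOn_log_rpow 1 0 r))
  simp only [zero_mul, add_zero, one_mul] at h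
  exact (PolyBdd.param.pow n).mul h

/-- A partial sum is a polynomial in μ, and the energy estimate controls the rest by a power of μ.
Absolute values taken term by term in the power series would ignore the cancellation and give no
polynomial bound. -/
lemma polyBdd_mode (ha : 0 < a) (hs : s = 0 ∨ s = -a) : PolyBdd (mode a s) := by
  obtain ⟨N, hN⟩ := exists_large_exponent s 2
  have hR : PolyBdd fun η μ => mode a s η μ - ∑ i ∈ Finset.range (N + 1),
      (frobFst a s i + frobSnd a s i * Real.log η) * (-μ) ^ i * η ^ (s + 2 * i) := by
    refine (polyBdd_pow_mul_rpow (N + 1) (s + 2 * ((N + 1 : ℕ) : ℝ) - 1 / 2)).of_le fun T hT => ?_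
    obtain ⟨C, hC, h⟩ := mode_remainder ha hs hN hT
    refine ⟨C, hC, fun μ hμ η hη => (h μ hμ η hη).trans ?_⟩
    rw [mul_assoc]
    gcongr
    exact le_abs_self _
  convert hR.add (polyBdd_partial (frobFst a s) (frobSnd a s) s (N + 1)) using 3
  ring

lemma polyBdd_modeDeriv (ha : 0 < a) (hs : s = 0 ∨ s = -a) : PolyBdd (modeDeriv a s) := by
  obtain ⟨N, hN⟩ := exists_large_exponent s 2
  have hR : PolyBdd fun η μ => modeDeriv a s η μ - (∑ i ∈ Finset.range (N + 1),
      ((s + 2 * i) * frobFst a s i + frobSnd a s i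
        + (s + 2 * i) * frobSnd a s i * Real.log η) * (-μ) ^ i * η ^ (s + 2 * i)) / η := by
    refine (polyBdd_pow_mul_rpow (N + 1) (s + 2 * ((N + 1 : ℕ) : ℝ) - 3 / 2)).of_le fun T hT => ?_
    obtain ⟨C, hC, h⟩ := modeDeriv_remainder ha hs hN hT
    refine ⟨C, hC, fun μ hμ η hη => (h μ hμ η hη).trans ?_⟩
    rw [mul_assoc]
    gcongr
    exact le_abs_self _
  have hinv : PolyBdd fun η _ => η⁻¹ :=
    PolyBdd.of_continuousOn (continuousOn_inv₀.mono fun x hx => (Set.mem_Ioi.1 hx).ne')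
  convert hR.add ((polyBdd_partial (fun i => (s + 2 * i) * frobFst a s i + frobSnd a s i)
    (fun i => (s + 2 * i) * frobSnd a s i) s (N + 1)).mul hinv) using 3
  ring

/-- The differential equation expresses the second derivative through the mode and its first
derivative, at the price of one factor μ, so both are treated in one induction. -/
lemma smoothPolyBdd_mode (ha : 0 < a) (hs : s = 0 ∨ s = -a) (k : ℕ) :
    SmoothPolyBdd k (mode a s) ∧ SmoothPolyBdd k (modeDeriv a s) := by
  induction k with
  | zero => exact ⟨polyBdd_mode ha hs, polyBdd_modeDeriv ha hs⟩
  | succ k ih =>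
    have hinv : SmoothPolyBdd k fun η _ => -((a + 1) / η) :=
      SmoothPolyBdd.of_contDiffOn (contDiffOn_const.div contDiffOn_id
        fun x hx => (Set.mem_Ioi.1 hx).ne').neg k
    have hneg : SmoothPolyBdd k fun _ _ => (-1 : ℝ) :=
      SmoothPolyBdd.of_contDiffOn contDiffOn_const k
    exact ⟨⟨polyBdd_mode ha hs, modeDeriv a s, fun μ _ η hη => hasDerivAt_mode ha hs μ hη, ih.2⟩,
      ⟨polyBdd_modeDeriv ha hs, _, fun μ _ η hη => hasDerivAt_modeDeriv ha hs μ hη,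
        (hinv.mul ih.2).add (hneg.mul ((SmoothPolyBdd.param k).mul ih.1))⟩⟩

/-- The normalized limit of a fundamental solution at `η = 0`. -/
lemma tendsto_mode_leading (ha : 0 < a) (hs : s = 0 ∨ s = -a) (μ : ℝ) :
    Filter.Tendsto (fun η => η ^ (-s) * mode a s η μ) (𝓝[>] 0) (𝓝 1) :=
  tendsto_frob_leading s (-μ) (isFrobenius_frobCoeff ha hs).entire_fst
    (isFrobenius_frobCoeff ha hs).entire_snd rfl

lemma tendsto_modeDeriv_leading (ha : 0 < a) (hs : s = 0 ∨ s = -a) (μ : ℝ) :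
    Filter.Tendsto (fun η => η ^ (-s) * (η * modeDeriv a s η μ)) (𝓝[>] 0) (𝓝 s) := by
  have hF := isFrobenius_frobCoeff ha hs
  have h := tendsto_frob_leading s (-μ) ((hF.entire_fst.affine_mul s).add hF.entire_snd)
    (hF.entire_snd.affine_mul s) (by simp [frobSnd, frobCoeff])
  have e : (s + 2 * ((0 : ℕ) : ℝ)) * frobFst a s 0 + frobSnd a s 0 = s := by
    simp [frobFst, frobSnd, frobCoeff]
  rw [e] at h
  refine h.congr' ?_
  filter_upwards [self_mem_nhdsWithin] with η hη
  have hη' : η ≠ 0 := (Set.mem_Ioi.1 hη).ne'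
  rw [modeDeriv, frobDeriv, mul_div_cancel₀ _ hη']

/-- Abel's identity, with integrating factor η ^ (a + 1). The general field allows both real modes
and complex Fourier coefficients. -/
lemma hasDerivAt_wronskian {𝕜 : Type*} [NontriviallyNormedField 𝕜] [NormedAlgebra ℝ 𝕜]
    {a μ η : ℝ} {f f' g g' : ℝ → 𝕜} (hη : 0 < η)
    (hf : HasDerivAt f (f' η) η) (hg : HasDerivAt g (g' η) η)
    (hf' : HasDerivAt f' (-((a + 1) / η) • f' η - μ • f η) η)
    (hg' : HasDerivAt g' (-((a + 1) / η) • g' η - μ • g η) η) :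
    HasDerivAt (fun η : ℝ => η ^ (a + 1) • (f η * g' η - f' η * g η)) 0 η := by
  have h0 : HasDerivAt (fun η : ℝ => η ^ (a + 1)) ((a + 1) * η ^ (a + 1 - 1)) η :=
    Real.hasDerivAt_rpow_const (Or.inl hη.ne')
  have h := h0.smul ((hf.mul hg').sub (hf'.mul hg))
  refine h.congr_deriv ?_
  have e : (a + 1) * η ^ (a + 1 - 1) = η ^ (a + 1) * ((a + 1) / η) := by
    rw [Real.rpow_sub_one hη.ne']; ring
  simp only [e, Algebra.smul_def, Pi.sub_apply, Pi.mul_apply, map_mul, map_neg]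
  ring

lemma eq_of_hasDerivAt_zero {F : Type*} [NormedAddCommGroup F] [NormedSpace ℝ F] {f : ℝ → F}
    (hf : ∀ η, 0 < η → HasDerivAt f 0 η) {x y : ℝ} (hx : 0 < x) (hy : 0 < y) : f x = f y :=
  isOpen_Ioi.is_const_of_deriv_eq_zero isPreconnected_Ioi
    (fun η hη => (hf η hη).differentiableAt.differentiableWithinAt)
    (fun η hη => (hf η hη).deriv) hx hy

/-- The Wronskian is constant, hence equal to its limit at η = 0, which the leading terms η ^ (-a)
and 1 determine. -/
lemma wronskian_mode (ha : 0 < a) (μ : ℝ) {η : ℝ} (hη : 0 < η) :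
    η ^ (a + 1) * (mode a (-a) η μ * modeDeriv a 0 η μ - modeDeriv a (-a) η μ * mode a 0 η μ)
      = a := by
  set W : ℝ → ℝ := fun η => η ^ (a + 1) *
    (mode a (-a) η μ * modeDeriv a 0 η μ - modeDeriv a (-a) η μ * mode a 0 η μ) with hW
  have hW0 : ∀ η, 0 < η → HasDerivAt W 0 η := fun η hη => by
    have h1 := hasDerivAt_modeDeriv ha (Or.inr rfl : (-a) = 0 ∨ (-a) = -a) μ hη
    have h2 := hasDerivAt_modeDeriv ha (Or.inl rfl : (0 : ℝ) = 0 ∨ (0 : ℝ) = -a) μ hη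
    exact hasDerivAt_wronskian (μ := μ) hη (hasDerivAt_mode ha (Or.inr rfl) μ hη)
      (hasDerivAt_mode ha (Or.inl rfl) μ hη) (h1.congr_deriv (by simp [sub_eq_add_neg]))
      (h2.congr_deriv (by simp [sub_eq_add_neg]))
  have hlim : Filter.Tendsto W (𝓝[>] 0) (𝓝 a) := by
    have h := ((tendsto_mode_leading ha (Or.inr rfl : (-a) = 0 ∨ (-a) = -a) μ).mul
      (tendsto_modeDeriv_leading ha (Or.inl rfl : (0 : ℝ) = 0 ∨ (0 : ℝ) = -a) μ)).sub
      ((tendsto_modeDeriv_leading ha (Or.inr rfl : (-a) = 0 ∨ (-a) = -a) μ).mul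
      (tendsto_mode_leading ha (Or.inl rfl : (0 : ℝ) = 0 ∨ (0 : ℝ) = -a) μ))
    have e : (1 : ℝ) * 0 - -a * 1 = a := by ring
    rw [e] at h
    refine h.congr' ?_
    filter_upwards [self_mem_nhdsWithin] with η hη
    simp only [hW, neg_neg, neg_zero, Real.rpow_zero, one_mul]
    rw [Real.rpow_add_one (Set.mem_Ioi.1 hη).ne']
    ring
  have hconst : W =ᶠ[𝓝[>] 0] fun _ => W η := by
    filter_upwards [self_mem_nhdsWithin] with ε hε
    exact eq_of_hasDerivAt_zero hW0 hε hη
  exact tendsto_nhds_unique (tendsto_const_nhds.congr' hconst.symm) hlim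

end mode

/-! ### Fourier series on the torus `ℝ³ / (ℤ b₀ + ℤ b₁ + ℤ b₂)` -/

section Fourier

open MeasureTheory UnitAddTorus

-- The Haar probability measure is the one against which `mFourierCoeff` integrates.
local instance : MeasureSpace UnitAddCircle := ⟨AddCircle.haarAddCircle⟩

local instance : Measure.IsAddHaarMeasure (volume : Measure UnitAddCircle) :=
  inferInstanceAs (Measure.IsAddHaarMeasure AddCircle.haarAddCircle)

local instance : IsProbabilityMeasure (volume : Measure UnitAddCircle) :=
  inferInstanceAs (IsProbabilityMeasure AddCircle.haarAddCircle)

variable (b : Module.Basis (Fin 3) ℝ E3)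

/-- The linear form `x ↦ 2π ∑ j, n j * x j` in the coordinates with respect to `b`. -/
def phase (n : Fin 3 → ℤ) : E3 →L[ℝ] ℝ :=
  LinearMap.toContinuousLinearMap (∑ j, (2 * Real.pi * n j) • b.coord j)

/-- The eigenvalue of `-Δ` on the character with index `n`. -/
def eigenvalue (n : Fin 3 → ℤ) : ℝ := ∑ i, (phase b n (EuclideanSpace.basisFun (Fin 3) ℝ i)) ^ 2

/-- The character `x ↦ exp (i * phase b n x)`. -/
def torusChar (n : Fin 3 → ℤ) (x : E3) : ℂ := Complex.exp (phase b n x * Complex.I)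

/-- The projection of `ℝ³` onto the standard torus. -/
def toTorus (x : E3) : UnitAddTorus (Fin 3) := fun i => ((b.equivFunL x i : ℝ) : UnitAddCircle)

/-- A periodic function viewed on the standard torus. -/
def onTorus (f : E3 → ℝ) (t : UnitAddTorus (Fin 3)) : ℝ := f (Function.surjInv (f := toTorus b)
  (by
    intro t
    choose y hy using fun i => QuotientAddGroup.mk_surjective (t i)
    refine ⟨b.equivFunL.symm y, funext fun i => ?_⟩
    rw [toTorus, ContinuousLinearEquiv.apply_symm_apply]
    exact hy i) t)

/-- The Fourier coefficients of a periodic function. -/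
def torusCoeff (f : E3 → ℝ) (n : Fin 3 → ℤ) : ℂ :=
  mFourierCoeff (fun t => (onTorus b f t : ℂ)) n

/-- Functions on `ℝ³` that are periodic with respect to `b`. -/
def IsPeriodic (f : E3 → ℝ) : Prop := ∀ (i : Fin 3) (x : E3), f (x + b i) = f x

variable {b}

lemma phase_apply (n : Fin 3 → ℤ) (x : E3) :
    phase b n x = ∑ j, 2 * Real.pi * n j * b.equivFunL x j := by
  simp [phase]

lemma phase_basis (n : Fin 3 → ℤ) (j : Fin 3) : phase b n (b j) = 2 * Real.pi * n j := by
  rw [phase_apply]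
  simp [Finsupp.single_apply]

lemma eigenvalue_nonneg (n : Fin 3 → ℤ) : 0 ≤ eigenvalue b n :=
  Finset.sum_nonneg fun _ _ => sq_nonneg _

/-- Cauchy–Schwarz: the eigenvalue is the squared length of the wave vector. -/
lemma phase_sq_le (n : Fin 3 → ℤ) (x : E3) : (phase b n x) ^ 2 ≤ eigenvalue b n * ‖x‖ ^ 2 := by
  have h1 : phase b n x = ∑ i, x i * phase b n (EuclideanSpace.basisFun (Fin 3) ℝ i) := by
    conv_lhs => rw [← (EuclideanSpace.basisFun (Fin 3) ℝ).sum_repr x]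
    simp
  rw [h1, EuclideanSpace.norm_sq_eq, eigenvalue, mul_comm]
  refine (Finset.sum_mul_sq_le_sq_mul_sq _ _ _).trans_eq ?_
  simp

lemma phase_norm_sq_le (n : Fin 3 → ℤ) : ‖phase b n‖ ^ 2 ≤ eigenvalue b n := by
  have h : ‖phase b n‖ ≤ Real.sqrt (eigenvalue b n) := by
    refine ContinuousLinearMap.opNorm_le_bound _ (Real.sqrt_nonneg _) fun x => ?_
    rw [Real.norm_eq_abs]
    refine abs_le_of_sq_le_sq ?_ (by positivity)
    rw [mul_pow, Real.sq_sqrt (eigenvalue_nonneg n)]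
    exact phase_sq_le n x
  calc ‖phase b n‖ ^ 2 ≤ Real.sqrt (eigenvalue b n) ^ 2 := by gcongr
    _ = _ := Real.sq_sqrt (eigenvalue_nonneg n)

lemma phase_norm_le (n : Fin 3 → ℤ) : ‖phase b n‖ ≤ 1 + eigenvalue b n := by
  nlinarith [phase_norm_sq_le (b := b) n, sq_nonneg (‖phase b n‖ - 1), norm_nonneg (phase b n)]

lemma isOpenQuotientMap_toTorus : IsOpenQuotientMap (toTorus b) := by
  have h1 : IsOpenQuotientMap (Pi.map fun (_ : Fin 3) (x : ℝ) => (x : UnitAddCircle)) :=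
    IsOpenQuotientMap.piMap fun _ => QuotientAddGroup.isOpenQuotientMap_mk
  exact h1.comp b.equivFunL.toHomeomorph.isOpenQuotientMap

lemma toTorus_surjective : Function.Surjective (toTorus b) := isOpenQuotientMap_toTorus.surjective

lemma toTorus_add (x y : E3) : toTorus b (x + y) = toTorus b x + toTorus b y := by
  ext i
  simp [toTorus]

lemma IsPeriodic.eq_of_toTorus_eq {f : E3 → ℝ} (hf : IsPeriodic b f) {x y : E3}
    (h : toTorus b x = toTorus b y) : f x = f y := by
  have h1 : ∀ i, ∃ m : ℤ, b.equivFunL x i = b.equivFunL y i + m := fun i => by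
    have := congrFun h i
    simp only [toTorus] at this
    rw [← sub_eq_zero, ← AddCircle.coe_sub, AddCircle.coe_eq_zero_iff] at this
    obtain ⟨m, hm⟩ := this
    exact ⟨m, by rw [zsmul_eq_mul, mul_one] at hm; linarith⟩
  choose m hm using h1
  have h2 : x = y + ∑ i, m i • b i := by
    apply b.equivFunL.injective
    ext j
    rw [hm, map_add, map_sum]
    simp [Finsupp.single_apply]
  have h3 : Function.Periodic f (∑ i, m i • b i) := by
    refine Finset.sum_induction _ (Function.Periodic f) (fun _ _ => Function.Periodic.add_period)
      (fun x => by simp) fun i _ => Function.Periodic.zsmul (fun x => hf i x) _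
  rw [h2]
  exact h3 y

lemma onTorus_toTorus {f : E3 → ℝ} (hf : IsPeriodic b f) (x : E3) :
    onTorus b f (toTorus b x) = f x :=
  hf.eq_of_toTorus_eq (Function.surjInv_eq _ _)

lemma continuous_onTorus {f : E3 → ℝ} (hf : IsPeriodic b f) (hc : Continuous f) :
    Continuous (onTorus b f) := by
  rw [isOpenQuotientMap_toTorus (b := b).isQuotientMap.continuous_iff]
  convert hc using 1
  ext x
  exact onTorus_toTorus hf x

lemma mFourier_toTorus (n : Fin 3 → ℤ) (x : E3) : mFourier n (toTorus b x) = torusChar b n x := by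
  rw [torusChar, phase_apply]
  simp only [mFourier, toTorus, ContinuousMap.coe_mk, fourier_coe_apply]
  rw [← Complex.exp_sum]
  congr 1
  push_cast
  rw [Finset.sum_mul]
  refine Finset.sum_congr rfl fun i _ => ?_
  simp
  ring

lemma torusChar_add (n : Fin 3 → ℤ) (x y : E3) :
    torusChar b n (x + y) = torusChar b n x * torusChar b n y := by
  rw [torusChar, map_add, torusChar, torusChar, ← Complex.exp_add]
  push_cast
  ring_nf

lemma norm_torusChar (n : Fin 3 → ℤ) (x : E3) : ‖torusChar b n x‖ = 1 := by
  rw [torusChar, Complex.norm_exp_ofReal_mul_I]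

/-- The closed fundamental cell of the lattice. Through it, continuous periodic functions are
bounded by compactness. -/
lemma exists_compact_representatives :
    ∃ K : Set E3, IsCompact K ∧ ∀ t : UnitAddTorus (Fin 3), ∃ x ∈ K, toTorus b x = t := by
  refine ⟨b.equivFunL.symm '' (Set.Icc 0 1), isCompact_Icc.image (by fun_prop), fun t => ?_⟩
  obtain ⟨x, rfl⟩ := toTorus_surjective (b := b) t
  refine ⟨_, ⟨fun i => Int.fract (b.equivFunL x i), ⟨fun i => Int.fract_nonneg _,
    fun i => (Int.fract_lt_one _).le⟩, rfl⟩, funext fun i => ?_⟩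
  rw [toTorus, ContinuousLinearEquiv.apply_symm_apply, toTorus, Int.fract, AddCircle.coe_sub]
  rw [sub_eq_self, AddCircle.coe_eq_zero_iff]
  exact ⟨⌊b.equivFunL x i⌋, by simp⟩

lemma IsPeriodic.exists_bound {S : Set ℝ} (hS : IsCompact S) {G : ℝ → E3 → ℝ}
    (hG : ∀ η ∈ S, IsPeriodic b (G η))
    (hc : ContinuousOn (fun p : ℝ × E3 => G p.1 p.2) (S ×ˢ Set.univ)) :
    ∃ C : ℝ, ∀ η ∈ S, ∀ x, |G η x| ≤ C := by
  obtain ⟨K, hK, hrep⟩ := exists_compact_representatives (b := b)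
  obtain ⟨C, hC⟩ := (hS.prod hK).exists_bound_of_continuousOn
    (hc.mono (Set.prod_mono subset_rfl (Set.subset_univ K)))
  refine ⟨C, fun η hη x => ?_⟩
  obtain ⟨y, hy, hyx⟩ := hrep (toTorus b x)
  rw [(hG η hη).eq_of_toTorus_eq hyx.symm]
  exact hC (η, y) ⟨hη, hy⟩

/-- The integrand of the Fourier coefficients. -/
lemma continuous_coeff_integrand {f : E3 → ℝ} (hf : IsPeriodic b f) (hc : Continuous f)
    (n : Fin 3 → ℤ) : Continuous fun t => mFourier (-n) t • (onTorus b f t : ℂ) := by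
  have := continuous_onTorus hf hc
  fun_prop

lemma integrable_coeff_integrand {f : E3 → ℝ} (hf : IsPeriodic b f) (hc : Continuous f)
    (n : Fin 3 → ℤ) : Integrable (fun t => mFourier (-n) t • (onTorus b f t : ℂ)) volume :=
  (continuous_coeff_integrand hf hc n).integrable_of_hasCompactSupport
    (HasCompactSupport.of_compactSpace _)

lemma norm_torusCoeff_le {f : E3 → ℝ} {C : ℝ} (h : ∀ x, |f x| ≤ C) (n : Fin 3 → ℤ) :
    ‖torusCoeff b f n‖ ≤ C := by
  have h1 := norm_integral_le_of_norm_le_const (μ := (volume : Measure (UnitAddTorus (Fin 3))))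
    (f := fun t => mFourier (-n) t • (onTorus b f t : ℂ)) (C := C)
    (Filter.Eventually.of_forall fun t => ?_)
  · simpa [torusCoeff, mFourierCoeff] using h1
  · obtain ⟨x, rfl⟩ := toTorus_surjective (b := b) t
    rw [norm_smul, mFourier_toTorus, norm_torusChar, one_mul, Complex.norm_real]
    exact h _

lemma torusCoeff_add_const_mul {f g : E3 → ℝ} (hf : IsPeriodic b f) (hfc : Continuous f)
    (hg : IsPeriodic b g) (hgc : Continuous g) (c : ℝ) (n : Fin 3 → ℤ) :
    torusCoeff b (fun x => f x + c * g x) n = torusCoeff b f n + c * torusCoeff b g n := by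
  have e : ∀ t, mFourier (-n) t • (onTorus b (fun x => f x + c * g x) t : ℂ)
      = mFourier (-n) t • (onTorus b f t : ℂ)
        + (c : ℂ) * (mFourier (-n) t • (onTorus b g t : ℂ)) := fun t => by
    simp only [onTorus, smul_eq_mul]
    push_cast
    ring
  simp only [torusCoeff, mFourierCoeff, e]
  rw [integral_add (integrable_coeff_integrand hf hfc n)
    ((integrable_coeff_integrand hg hgc n).const_mul _), integral_const_mul]

lemma IsPeriodic.translate {f : E3 → ℝ} (hf : IsPeriodic b f) (v : E3) :
    IsPeriodic b fun x => f (x + v) := fun i x => by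
  change f (x + b i + v) = f (x + v)
  rw [add_right_comm]
  exact hf i _

/-- Invariance of Haar measure. Differentiating this identity in v replaces an integration by parts.
-/
lemma torusCoeff_translate {f : E3 → ℝ} (hf : IsPeriodic b f) (v : E3) (n : Fin 3 → ℤ) :
    torusCoeff b (fun x => f (x + v)) n = torusChar b n v * torusCoeff b f n := by
  have hv := hf.translate v
  have e : ∀ t, mFourier (-n) t • (onTorus b (fun x => f (x + v)) t : ℂ)
      = torusChar b n v * (mFourier (-n) (t + toTorus b v)
        • (onTorus b f (t + toTorus b v) : ℂ)) := fun t => by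
    obtain ⟨x, rfl⟩ := toTorus_surjective (b := b) t
    rw [← toTorus_add, onTorus_toTorus hv, onTorus_toTorus hf, mFourier_toTorus, mFourier_toTorus,
      torusChar_add, smul_eq_mul, smul_eq_mul]
    have : torusChar b n v * torusChar b (-n) v = 1 := by
      rw [← mFourier_toTorus, ← mFourier_toTorus, ← mFourier_add, add_neg_cancel, mFourier_zero,
        ContinuousMap.one_apply]
    linear_combination (-(torusChar b (-n) x * (f (x + v) : ℂ))) * this
  simp only [torusCoeff, mFourierCoeff, e]
  rw [integral_const_mul, integral_add_right_eq_self
    (fun t => mFourier (-n) t • (onTorus b f t : ℂ))]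

/-- Differentiation under the integral; for parameters in a small closed ball periodicity leaves a
compact set, which provides a constant dominating bound. -/
lemma hasDerivAt_torusCoeff {S : Set ℝ} (hS : IsOpen S) {G G' : ℝ → E3 → ℝ}
    (hG : ∀ η ∈ S, IsPeriodic b (G η)) (hG' : ∀ η ∈ S, IsPeriodic b (G' η))
    (hc : ∀ η ∈ S, Continuous (G η))
    (hc' : ContinuousOn (fun p : ℝ × E3 => G' p.1 p.2) (S ×ˢ Set.univ))
    (hd : ∀ η ∈ S, ∀ x, HasDerivAt (fun η => G η x) (G' η x) η) (n : Fin 3 → ℤ)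
    {η : ℝ} (hη : η ∈ S) :
    HasDerivAt (fun η => torusCoeff b (G η) n) (torusCoeff b (G' η) n) η := by
  obtain ⟨δ, hδ, hball⟩ := Metric.nhds_basis_closedBall.mem_iff.1 (hS.mem_nhds hη)
  obtain ⟨C, hC⟩ := IsPeriodic.exists_bound (isCompact_closedBall η δ)
    (fun y hy => hG' y (hball hy)) (hc'.mono (Set.prod_mono hball subset_rfl))
  have hcη : Continuous (G' η) := by
    rw [← continuousOn_univ]
    exact hc'.comp (f := fun x => (η, x)) (by fun_prop) fun x _ => ⟨hη, trivial⟩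
  refine (hasDerivAt_integral_of_dominated_loc_of_deriv_le
    (F := fun η t => mFourier (-n) t • (onTorus b (G η) t : ℂ))
    (F' := fun η t => mFourier (-n) t • (onTorus b (G' η) t : ℂ)) (bound := fun _ => C)
    (Metric.closedBall_mem_nhds η hδ) ?_ (integrable_coeff_integrand (hG η hη) (hc η hη) n)
    (integrable_coeff_integrand (hG' η hη) hcη n).aestronglyMeasurable
    (Filter.Eventually.of_forall fun t y hy => ?_) (integrable_const _)
    (Filter.Eventually.of_forall fun t y hy => ?_)).2
  · filter_upwards [hS.mem_nhds hη] with y hy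
    exact (integrable_coeff_integrand (hG y hy) (hc y hy) n).aestronglyMeasurable
  · obtain ⟨x, rfl⟩ := toTorus_surjective (b := b) t
    rw [norm_smul, mFourier_toTorus, norm_torusChar, one_mul, Complex.norm_real]
    exact hC y hy _
  · have h1 := (hd y (hball hy) (Function.surjInv (toTorus_surjective (b := b)) t)).ofReal_comp
    exact h1.const_mul (mFourier (-n) t)

lemma IsPeriodic.fderiv_apply {f : E3 → ℝ} (hf : IsPeriodic b f) (v : E3) :
    IsPeriodic b fun x => fderiv ℝ f x v := fun i x => by
  have h := fderiv_comp_add_right (𝕜 := ℝ) (f := f) (x := x) (b i)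
  have e : (fun x => f (x + b i)) = f := funext fun x => hf i x
  rw [e] at h
  change fderiv ℝ f (x + b i) v = fderiv ℝ f x v
  rw [h]

/-- The coefficient of x ↦ f (x + t v) is differentiated at t = 0 in two ways: under the integral,
and through the factor exp(i t phase(v)). -/
lemma torusCoeff_fderiv {f : E3 → ℝ} (hf : IsPeriodic b f) (hs : ContDiff ℝ 1 f) (v : E3)
    (n : Fin 3 → ℤ) :
    torusCoeff b (fun x => fderiv ℝ f x v) n
      = phase b n v * Complex.I * torusCoeff b f n := by
  have hfd : Continuous (fderiv ℝ f) := hs.continuous_fderiv one_ne_zero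
  have h1 := hasDerivAt_torusCoeff (b := b) isOpen_univ
    (G := fun t x => f (x + t • v)) (G' := fun t x => fderiv ℝ f (x + t • v) v)
    (fun t _ => hf.translate _) (fun t _ => (hf.fderiv_apply v).translate _)
    (fun t _ => hs.continuous.comp (by fun_prop))
    (by
      refine Continuous.continuousOn ?_
      exact (hfd.comp (by fun_prop : Continuous fun p : ℝ × E3 => p.2 + p.1 • v)).clm_apply
        continuous_const)
    (fun t _ x => by
      have h2 : HasDerivAt (fun t : ℝ => x + t • v) v t := by
        simpa using ((hasDerivAt_id t).smul_const v).const_add x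
      exact ((hs.differentiable one_ne_zero _).hasFDerivAt).comp_hasDerivAt t h2) n
    (Set.mem_univ 0)
  have h2 : HasDerivAt (fun t : ℝ => torusCoeff b (fun x => f (x + t • v)) n)
      (phase b n v * Complex.I * torusCoeff b f n) 0 := by
    simp only [torusCoeff_translate hf]
    refine HasDerivAt.mul_const ?_ _
    have h3 : HasDerivAt (fun t : ℝ => ((phase b n (t • v) : ℝ) : ℂ) * Complex.I)
        (phase b n v * Complex.I) 0 := by
      refine HasDerivAt.mul_const ?_ _
      refine HasDerivAt.ofReal_comp ?_
      simpa using (hasDerivAt_id (0 : ℝ)).mul_const (phase b n v)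
    simpa [torusChar] using h3.cexp
  simpa using h1.unique h2

end Fourier

/-! ### Smooth periodic functions and rapidly decreasing coefficients -/

section RapidDecay

variable {b : Module.Basis (Fin 3) ℝ E3}

/-- Coefficients that decrease faster than any power of the eigenvalue. -/
def RapidDecay (b : Module.Basis (Fin 3) ℝ E3) (A : (Fin 3 → ℤ) → ℂ) : Prop :=
  ∀ M : ℕ, ∃ C : ℝ, ∀ n, ‖A n‖ * (1 + eigenvalue b n) ^ M ≤ C

lemma laplacian_eq_sum {f : E3 → ℝ} (hf : ContDiff ℝ 2 f) (x : E3) :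
    Laplacian.laplacian f x = ∑ i, fderiv ℝ
      (fun y => fderiv ℝ f y (EuclideanSpace.basisFun (Fin 3) ℝ i)) x
      (EuclideanSpace.basisFun (Fin 3) ℝ i) := by
  rw [InnerProductSpace.laplacian_eq_iteratedFDeriv_orthonormalBasis f
    (EuclideanSpace.basisFun (Fin 3) ℝ)]
  refine Finset.sum_congr rfl fun i _ => ?_
  have h : DifferentiableAt ℝ (fderiv ℝ f) x :=
    ((hf.fderiv_right (m := 1) (by norm_num)).differentiable one_ne_zero) x
  rw [iteratedFDeriv_two_apply, fderiv_clm_apply h (differentiableAt_const _)]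
  simp

namespace IsSmoothOnTorus

variable {f g : E3 → ℝ}

lemma isPeriodic (hf : IsSmoothOnTorus b f) : IsPeriodic b f := hf.periodic

lemma add (hf : IsSmoothOnTorus b f) (hg : IsSmoothOnTorus b g) :
    IsSmoothOnTorus b (fun x => f x + g x) :=
  ⟨hf.smooth.add hg.smooth, fun i x => by rw [hf.periodic, hg.periodic]⟩

lemma const_mul (hf : IsSmoothOnTorus b f) (c : ℝ) : IsSmoothOnTorus b (fun x => c * f x) :=
  ⟨contDiff_const.mul hf.smooth, fun i x => by rw [hf.periodic]⟩

lemma fderiv_apply (hf : IsSmoothOnTorus b f) (v : E3) :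
    IsSmoothOnTorus b (fun x => fderiv ℝ f x v) :=
  ⟨(hf.smooth.fderiv_right (m := ∞) (by simp)).clm_apply contDiff_const,
    hf.isPeriodic.fderiv_apply v⟩

lemma laplacian_eq (hf : IsSmoothOnTorus b f) :
    Laplacian.laplacian f = fun x => ∑ i, fderiv ℝ
      (fun y => fderiv ℝ f y (EuclideanSpace.basisFun (Fin 3) ℝ i)) x
      (EuclideanSpace.basisFun (Fin 3) ℝ i) :=
  funext fun x => laplacian_eq_sum (contDiff_infty.1 hf.smooth 2) x

lemma laplacian (hf : IsSmoothOnTorus b f) : IsSmoothOnTorus b (Laplacian.laplacian f) := by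
  rw [hf.laplacian_eq]
  simp only [Fin.sum_univ_three]
  exact (((hf.fderiv_apply _).fderiv_apply _).add ((hf.fderiv_apply _).fderiv_apply _)).add
    ((hf.fderiv_apply _).fderiv_apply _)

lemma torusCoeff_add_const_mul (hf : IsSmoothOnTorus b f) (hg : IsSmoothOnTorus b g) (c : ℝ)
    (n : Fin 3 → ℤ) :
    torusCoeff b (fun x => f x + c * g x) n = torusCoeff b f n + c * torusCoeff b g n :=
  _root_.torusCoeff_add_const_mul hf.isPeriodic hf.smooth.continuous hg.isPeriodic
    hg.smooth.continuous c n

lemma torusCoeff_fderiv_twice (hf : IsSmoothOnTorus b f) (v : E3) (n : Fin 3 → ℤ) :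
    torusCoeff b (fun x => fderiv ℝ (fun y => fderiv ℝ f y v) x v) n
      = -(phase b n v : ℂ) ^ 2 * torusCoeff b f n := by
  have h := hf.fderiv_apply v
  rw [torusCoeff_fderiv h.isPeriodic (h.smooth.of_le (by exact_mod_cast le_top)),
    torusCoeff_fderiv hf.isPeriodic (hf.smooth.of_le (by exact_mod_cast le_top))]
  linear_combination (phase b n v : ℂ) ^ 2 * torusCoeff b f n * Complex.I_sq

lemma torusCoeff_laplacian (hf : IsSmoothOnTorus b f) (n : Fin 3 → ℤ) :
    torusCoeff b (Laplacian.laplacian f) n = -(eigenvalue b n : ℂ) * torusCoeff b f n := by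
  have h := fun i => (hf.fderiv_apply (EuclideanSpace.basisFun (Fin 3) ℝ i)).fderiv_apply
    (EuclideanSpace.basisFun (Fin 3) ℝ i)
  have e1 := ((h 0).add (h 1)).torusCoeff_add_const_mul (h 2) 1 n
  have e2 := (h 0).torusCoeff_add_const_mul (h 1) 1 n
  simp only [one_mul, Complex.ofReal_one] at e1 e2
  rw [hf.laplacian_eq]
  simp only [Fin.sum_univ_three]
  rw [e1, e2, hf.torusCoeff_fderiv_twice, hf.torusCoeff_fderiv_twice, hf.torusCoeff_fderiv_twice,
    eigenvalue, Fin.sum_univ_three]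
  push_cast
  ring

/-- Passing from f to (1 - Δ) f, which is again smooth, multiplies the coefficients by 1 + λ; each
power of decay costs one such step. -/
lemma rapidDecay (hf : IsSmoothOnTorus b f) : RapidDecay b (torusCoeff b f) := by
  intro M
  induction M generalizing f with
  | zero =>
    obtain ⟨C, hC⟩ := IsPeriodic.exists_bound (b := b) (S := {0}) isCompact_singleton
      (G := fun _ => f) (fun _ _ => hf.isPeriodic)
      (hf.smooth.continuous.comp continuous_snd).continuousOn
    exact ⟨C, fun n => by simpa using norm_torusCoeff_le (hC 0 rfl) n⟩
  | succ M ih =>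
    obtain ⟨C, hC⟩ := ih (hf.add (hf.laplacian.const_mul (-1)))
    refine ⟨C, fun n => ?_⟩
    have h := hC n
    have e := hf.torusCoeff_add_const_mul hf.laplacian (-1) n
    rw [hf.torusCoeff_laplacian] at e
    have e2 : torusCoeff b f n + ((-1 : ℝ) : ℂ) * (-(eigenvalue b n : ℂ) * torusCoeff b f n)
        = ((1 + eigenvalue b n : ℝ) : ℂ) * torusCoeff b f n := by
      push_cast; ring
    rw [e, e2, norm_mul, Complex.norm_real, Real.norm_of_nonneg
      (by linarith [eigenvalue_nonneg (b := b) n])] at h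
    calc _ = _ := by ring
      _ ≤ C := h

end IsSmoothOnTorus

/-- The phase takes the value 2π n j on the basis vector b j, so the Cauchy–Schwarz bound recovers
the lattice index from the eigenvalue. -/
lemma exists_sq_le_eigenvalue (b : Module.Basis (Fin 3) ℝ E3) :
    ∃ D : ℝ, 0 ≤ D ∧ ∀ (n : Fin 3 → ℤ) (j : Fin 3),
      1 + (n j : ℝ) ^ 2 ≤ D * (1 + eigenvalue b n) := by
  refine ⟨1 + ∑ j, ‖b j‖ ^ 2, by positivity, fun n j => ?_⟩
  have h1 := phase_sq_le (b := b) n (b j)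
  rw [phase_basis] at h1
  have h2 : ‖b j‖ ^ 2 ≤ ∑ j, ‖b j‖ ^ 2 :=
    Finset.single_le_sum (f := fun j => ‖b j‖ ^ 2) (fun _ _ => by positivity) (Finset.mem_univ j)
  have h3 := eigenvalue_nonneg (b := b) n
  have h4 : (n j : ℝ) ^ 2 ≤ (2 * Real.pi * n j) ^ 2 := by
    rw [mul_pow]
    have : (1 : ℝ) ≤ (2 * Real.pi) ^ 2 := by nlinarith [Real.pi_gt_three]
    nlinarith [sq_nonneg (n j : ℝ)]
  have h5 : eigenvalue b n * ‖b j‖ ^ 2 ≤ eigenvalue b n * ∑ j, ‖b j‖ ^ 2 := by gcongr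
  have h6 : 0 ≤ ∑ j, ‖b j‖ ^ 2 := by positivity
  nlinarith

/-- The cube leaves one factor for each coordinate, and the sum is dominated by a product of three
convergent series of 1 / (1 + m²). -/
lemma summable_eigenvalue (b : Module.Basis (Fin 3) ℝ E3) :
    Summable fun n => ((1 + eigenvalue b n) ^ 3)⁻¹ := by
  obtain ⟨D, hD, h⟩ := exists_sq_le_eigenvalue b
  have hZ : Summable fun m : ℤ => (1 + (m : ℝ) ^ 2)⁻¹ := by
    refine Summable.of_norm_bounded_eventually
      (g := fun m : ℤ => 1 / (m : ℝ) ^ 2) (Real.summable_one_div_int_pow.2 (by norm_num)) ?_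
    filter_upwards [(Set.finite_singleton (0 : ℤ)).compl_mem_cofinite] with m hm
    have hm' : (m : ℝ) ≠ 0 := by exact_mod_cast hm
    rw [Real.norm_of_nonneg (by positivity), one_div]
    gcongr
    linarith
  have h0 : ∀ m : ℤ, 0 ≤ (1 + (m : ℝ) ^ 2)⁻¹ := fun m => by positivity
  have hP := hZ.mul_of_nonneg (hZ.mul_of_nonneg hZ h0 h0) h0
    (fun p => mul_nonneg (h0 p.1) (h0 p.2))
  have hP' := hP.comp_injective (i := fun n : Fin 3 → ℤ => (n 0, n 1, n 2)) (by
    intro n m hnm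
    simp only [Prod.mk.injEq] at hnm
    ext j
    fin_cases j
    exacts [hnm.1, hnm.2.1, hnm.2.2])
  refine Summable.of_nonneg_of_le (fun n => ?_) (fun n => ?_) (hP'.mul_left (D ^ 3))
  · have := eigenvalue_nonneg (b := b) n
    positivity
  · have hl := eigenvalue_nonneg (b := b) n
    have h1 : (1 + (n 0 : ℝ) ^ 2) * ((1 + (n 1 : ℝ) ^ 2) * (1 + (n 2 : ℝ) ^ 2))
        ≤ (D * (1 + eigenvalue b n)) * ((D * (1 + eigenvalue b n)) * (D * (1 + eigenvalue b n))) := by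
      gcongr <;> exact h n _
    simp only [Function.comp]
    rw [← mul_inv, ← mul_inv, inv_le_iff_one_le_mul₀ (by positivity), mul_right_comm,
      ← div_eq_mul_inv, le_div_iff₀ (by positivity), one_mul]
    calc _ ≤ _ := h1
      _ = _ := by ring

lemma RapidDecay.summable {A : (Fin 3 → ℤ) → ℂ} (hA : RapidDecay b A) : Summable A := by
  obtain ⟨C, hC⟩ := hA 3
  refine Summable.of_norm_bounded ((summable_eigenvalue b).mul_left C) fun n => ?_
  have hl := eigenvalue_nonneg (b := b) n
  rw [← div_eq_mul_inv, le_div_iff₀ (by positivity)]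
  exact hC n

lemma IsSmoothOnTorus.hasSum {f : E3 → ℝ} (hf : IsSmoothOnTorus b f) (x : E3) :
    HasSum (fun n => torusCoeff b f n * torusChar b n x) (f x : ℂ) := by
  have hc : Continuous fun t => (onTorus b f t : ℂ) :=
    Complex.continuous_ofReal.comp (continuous_onTorus hf.isPeriodic hf.smooth.continuous)
  have h := UnitAddTorus.hasSum_mFourier_series_apply_of_summable
    (f := (⟨fun t => (onTorus b f t : ℂ), hc⟩ : C(UnitAddTorus (Fin 3), ℂ)))
    hf.rapidDecay.summable (toTorus b x)
  simpa [mFourier_toTorus, onTorus_toTorus hf.isPeriodic, torusCoeff] using h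

end RapidDecay

/-! ### Real plane waves -/

section Wave

variable {b : Module.Basis (Fin 3) ℝ E3}

/-- The real plane wave `x ↦ Re (A * exp (i * phase b n x))`. -/
def wave (b : Module.Basis (Fin 3) ℝ E3) (A : ℂ) (n : Fin 3 → ℤ) (x : E3) : ℝ :=
  (A * torusChar b n x).re

/-- The function `t ↦ Re (A * exp (i * t))`. -/
def circleWave (A : ℂ) (t : ℝ) : ℝ := (A * Complex.exp (t * Complex.I)).re

lemma wave_eq_comp (A : ℂ) (n : Fin 3 → ℤ) : wave b A n = circleWave A ∘ phase b n := rfl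

lemma hasDerivAt_circleWave (A : ℂ) (t : ℝ) :
    HasDerivAt (circleWave A) (circleWave (A * Complex.I) t) t := by
  have h1 : HasDerivAt (fun t : ℝ => (t : ℂ) * Complex.I) (1 * Complex.I) t :=
    ((hasDerivAt_id t).ofReal_comp).mul_const _
  have h2 := (h1.cexp.const_mul A)
  have h3 := Complex.reCLM.hasFDerivAt.comp_hasDerivAt t h2
  refine h3.congr_deriv ?_
  simp only [circleWave, Complex.reCLM_apply]
  congr 1
  ring

lemma contDiff_circleWave (A : ℂ) : ContDiff ℝ ∞ (circleWave A) := by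
  have h : ContDiff ℝ ∞ fun t : ℝ => A * Complex.exp (t * Complex.I) :=
    contDiff_const.mul ((Complex.ofRealCLM.contDiff.mul contDiff_const).cexp)
  exact Complex.reCLM.contDiff.comp h

lemma iteratedDeriv_circleWave (A : ℂ) (m : ℕ) :
    iteratedDeriv m (circleWave A) = circleWave (A * Complex.I ^ m) := by
  induction m with
  | zero => simp
  | succ m ih =>
    rw [iteratedDeriv_succ, ih]
    ext t
    rw [(hasDerivAt_circleWave _ t).deriv, pow_succ, mul_assoc]

lemma abs_circleWave_le (A : ℂ) (t : ℝ) : |circleWave A t| ≤ ‖A‖ := by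
  refine (Complex.abs_re_le_norm _).trans ?_
  rw [norm_mul, Complex.norm_exp_ofReal_mul_I, mul_one]

lemma contDiff_wave (A : ℂ) (n : Fin 3 → ℤ) : ContDiff ℝ ∞ (wave b A n) :=
  (contDiff_circleWave A).comp (phase b n).contDiff

lemma norm_iteratedFDeriv_wave_le (A : ℂ) (n : Fin 3 → ℤ) (m : ℕ) (x : E3) :
    ‖iteratedFDeriv ℝ m (wave b A n) x‖ ≤ ‖A‖ * (1 + eigenvalue b n) ^ m := by
  rw [wave_eq_comp, (phase b n).iteratedFDeriv_comp_right (contDiff_circleWave A) x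
    (by exact_mod_cast le_top)]
  refine (ContinuousMultilinearMap.norm_compContinuousLinearMap_le _ _).trans ?_
  rw [norm_iteratedFDeriv_eq_norm_iteratedDeriv, iteratedDeriv_circleWave, Finset.prod_const,
    Finset.card_univ, Fintype.card_fin]
  gcongr
  · refine (abs_circleWave_le _ _).trans ?_
    simp
  · exact phase_norm_le n

lemma laplacian_wave (A : ℂ) (n : Fin 3 → ℤ) (x : E3) :
    Laplacian.laplacian (wave b A n) x = -eigenvalue b n * wave b A n x := by
  rw [InnerProductSpace.laplacian_eq_iteratedFDeriv_orthonormalBasis _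
    (EuclideanSpace.basisFun (Fin 3) ℝ), wave_eq_comp]
  simp only [(phase b n).iteratedFDeriv_comp_right
    (contDiff_infty.1 (contDiff_circleWave A) 2) x (i := 2) le_rfl, ContinuousMultilinearMap.compContinuousLinearMap_apply,
    iteratedFDeriv_apply_eq_iteratedDeriv_mul_prod, iteratedDeriv_circleWave, Fin.prod_univ_two,
    Matrix.cons_val_zero, Matrix.cons_val_one, Complex.I_sq, smul_eq_mul]
  rw [← Finset.sum_mul, eigenvalue]
  have : circleWave (A * -1) (phase b n x) = -circleWave A (phase b n x) := by
    simp [circleWave]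
  rw [this]
  simp only [Function.comp, sq]
  ring

lemma torusChar_basis (n : Fin 3 → ℤ) (j : Fin 3) : torusChar b n (b j) = 1 := by
  rw [torusChar, phase_basis]
  convert Complex.exp_int_mul_two_pi_mul_I (n j) using 2
  push_cast
  ring

lemma wave_periodic (A : ℂ) (n : Fin 3 → ℤ) (j : Fin 3) (x : E3) :
    wave b A n (x + b j) = wave b A n x := by
  rw [wave, torusChar_add, torusChar_basis, mul_one, wave]

end Wave

/-! ### Series of rapidly decreasing smooth functions -/

section RapidFamily

variable {b : Module.Basis (Fin 3) ℝ E3}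
variable {F G : Type} [NormedAddCommGroup F] [NormedSpace ℝ F]
  [NormedAddCommGroup G] [NormedSpace ℝ G]

/-- Smooth functions `E n`, all of whose derivatives decrease faster than any power of the
eigenvalue, uniformly. -/
structure RapidFamily (b : Module.Basis (Fin 3) ℝ E3) (E : (Fin 3 → ℤ) → E3 → F) : Prop where
  smooth : ∀ n, ContDiff ℝ ∞ (E n)
  bound : ∀ m M : ℕ, ∃ C : ℝ, ∀ n x,
    ‖iteratedFDeriv ℝ m (E n) x‖ * (1 + eigenvalue b n) ^ M ≤ C

namespace RapidFamily

variable {E : (Fin 3 → ℤ) → E3 → F}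

lemma of_rapidDecay {A : (Fin 3 → ℤ) → ℂ} (hA : RapidDecay b A) :
    RapidFamily b fun n => wave b (A n) n where
  smooth n := contDiff_wave _ n
  bound m M := by
    obtain ⟨C, hC⟩ := hA (m + M)
    refine ⟨C, fun n x => ?_⟩
    have hl := eigenvalue_nonneg (b := b) n
    calc _ ≤ ‖A n‖ * (1 + eigenvalue b n) ^ m * (1 + eigenvalue b n) ^ M := by
          gcongr
          exact norm_iteratedFDeriv_wave_le _ _ _ _
      _ = ‖A n‖ * (1 + eigenvalue b n) ^ (m + M) := by ring
      _ ≤ C := hC n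

lemma fderiv (hE : RapidFamily b E) : RapidFamily b fun n => fderiv ℝ (E n) where
  smooth n := (hE.smooth n).fderiv_right (by simp)
  bound m M := by
    obtain ⟨C, hC⟩ := hE.bound (m + 1) M
    exact ⟨C, fun n x => by rw [norm_iteratedFDeriv_fderiv]; exact hC n x⟩

lemma clm_comp (hE : RapidFamily b E) (L : F →L[ℝ] G) : RapidFamily b fun n x => L (E n x) where
  smooth n := L.contDiff.comp (hE.smooth n)
  bound m M := by
    obtain ⟨C, hC⟩ := hE.bound m M
    refine ⟨‖L‖ * C, fun n x => ?_⟩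
    have hl := eigenvalue_nonneg (b := b) n
    have h := L.norm_iteratedFDeriv_comp_left (hE.smooth n).contDiffAt (x := x) (N := ∞) (n := m)
      (by exact_mod_cast le_top)
    calc _ ≤ ‖L‖ * ‖iteratedFDeriv ℝ m (E n) x‖ * (1 + eigenvalue b n) ^ M := by
          gcongr
          exact h
      _ = ‖L‖ * (‖iteratedFDeriv ℝ m (E n) x‖ * (1 + eigenvalue b n) ^ M) := by ring
      _ ≤ _ := by
          gcongr
          exact hC n x

lemma smul (hE : RapidFamily b E) {c : (Fin 3 → ℤ) → ℝ} {C : ℝ} {K : ℕ}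
    (hc : ∀ n, |c n| ≤ C * (1 + eigenvalue b n) ^ K) : RapidFamily b fun n x => c n • E n x where
  smooth n := contDiff_const.smul (hE.smooth n)
  bound m M := by
    obtain ⟨D, hD⟩ := hE.bound m (K + M)
    refine ⟨C * D, fun n x => ?_⟩
    have hl := eigenvalue_nonneg (b := b) n
    have hC : 0 ≤ C := by
      by_contra h
      have := (abs_nonneg _).trans (hc n)
      have : C * (1 + eigenvalue b n) ^ K < 0 := mul_neg_of_neg_of_pos (by linarith) (by positivity)
      linarith
    rw [iteratedFDeriv_const_smul_apply' ((hE.smooth n).of_le (by exact_mod_cast le_top)).contDiffAt,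
      norm_smul, Real.norm_eq_abs]
    calc _ ≤ (C * (1 + eigenvalue b n) ^ K) * ‖iteratedFDeriv ℝ m (E n) x‖
            * (1 + eigenvalue b n) ^ M := by
          gcongr
          exact hc n
      _ = C * (‖iteratedFDeriv ℝ m (E n) x‖ * (1 + eigenvalue b n) ^ (K + M)) := by ring
      _ ≤ _ := by
          gcongr
          exact hD n x

lemma exists_summable_bound (hE : RapidFamily b E) (m M : ℕ) :
    ∃ C : ℝ, ∀ n x, (1 + eigenvalue b n) ^ M * ‖iteratedFDeriv ℝ m (E n) x‖
      ≤ C * ((1 + eigenvalue b n) ^ 3)⁻¹ := by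
  obtain ⟨C, hC⟩ := hE.bound m (M + 3)
  refine ⟨C, fun n x => ?_⟩
  have hl := eigenvalue_nonneg (b := b) n
  rw [← div_eq_mul_inv, le_div_iff₀ (by positivity)]
  calc _ = _ := by ring
    _ ≤ C := hC n x

lemma exists_summable_bound_zero (hE : RapidFamily b E) (M : ℕ) :
    ∃ C : ℝ, ∀ n x, (1 + eigenvalue b n) ^ M * ‖E n x‖ ≤ C * ((1 + eigenvalue b n) ^ 3)⁻¹ := by
  simpa using hE.exists_summable_bound 0 M

/-- A dominating sequence for the derivatives of order `m`. -/
lemma exists_bounds (hE : RapidFamily b E) : ∃ v : ℕ → (Fin 3 → ℤ) → ℝ, (∀ m, Summable (v m)) ∧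
    ∀ m n x, ‖iteratedFDeriv ℝ m (E n) x‖ ≤ v m n := by
  choose C hC using fun m => hE.exists_summable_bound m 0
  refine ⟨fun m n => C m * ((1 + eigenvalue b n) ^ 3)⁻¹,
    fun m => (summable_eigenvalue b).mul_left _, fun m n x => ?_⟩
  simpa using hC m n x

variable [CompleteSpace F]

lemma summable (hE : RapidFamily b E) (x : E3) : Summable fun n => E n x := by
  obtain ⟨v, hv, h⟩ := hE.exists_bounds
  exact Summable.of_norm_bounded (hv 0) fun n => by simpa using h 0 n x

lemma contDiff_tsum (hE : RapidFamily b E) : ContDiff ℝ ∞ fun x => ∑' n, E n x := by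
  obtain ⟨v, hv, h⟩ := hE.exists_bounds
  exact _root_.contDiff_tsum (N := ⊤) hE.smooth (fun m _ => hv m) fun m n x _ => h m n x

lemma iteratedFDeriv_tsum (hE : RapidFamily b E) (m : ℕ) (x : E3) :
    HasSum (fun n => iteratedFDeriv ℝ m (E n) x) (iteratedFDeriv ℝ m (fun x => ∑' n, E n x) x) := by
  obtain ⟨v, hv, h⟩ := hE.exists_bounds
  rw [iteratedFDeriv_tsum_apply (N := ⊤) hE.smooth (fun m _ => hv m) (fun m n x _ => h m n x) le_top]
  exact (Summable.of_norm_bounded (hv m) fun n => h m n x).hasSum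

lemma laplacian_tsum {E : (Fin 3 → ℤ) → E3 → ℝ} (hE : RapidFamily b E) (x : E3) :
    HasSum (fun n => Laplacian.laplacian (E n) x) (Laplacian.laplacian (fun x => ∑' n, E n x) x) := by
  simp only [InnerProductSpace.laplacian_eq_iteratedFDeriv_orthonormalBasis _
    (EuclideanSpace.basisFun (Fin 3) ℝ)]
  refine hasSum_sum fun i _ => ?_
  exact (hE.iteratedFDeriv_tsum 2 x).mapL (ContinuousMultilinearMap.apply ℝ (fun _ : Fin 2 => E3) ℝ
    ![EuclideanSpace.basisFun (Fin 3) ℝ i, EuclideanSpace.basisFun (Fin 3) ℝ i])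

end RapidFamily

/-! ### Synthesis of functions of time and space from modes -/

/-- The superposition of the functions `E n` with time dependent coefficients. -/
def synth (b : Module.Basis (Fin 3) ℝ E3) (w : ℝ) (g : ℝ → ℝ → ℝ) (E : (Fin 3 → ℤ) → E3 → F)
    (p : ℝ × E3) : F := ∑' n, g p.1 (w * eigenvalue b n) • E n p.2

variable {w : ℝ} {g g' : ℝ → ℝ → ℝ} {E : (Fin 3 → ℤ) → E3 → F}

lemma PolyBdd.eigenvalue_bound (hg : PolyBdd g) (hw : w ∈ Set.Icc (0 : ℝ) 1) {ε T : ℝ}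
    (hε : 0 < ε) : ∃ C : ℝ, 0 ≤ C ∧ ∃ K : ℕ, ∀ n, ∀ η ∈ Set.Icc ε T,
      |g η (w * eigenvalue b n)| ≤ C * (1 + eigenvalue b n) ^ K := by
  obtain ⟨C, hC, K, hK⟩ := hg ε T hε
  refine ⟨C, hC, K, fun n η hη => ?_⟩
  have hl := eigenvalue_nonneg (b := b) n
  refine (hK _ (mul_nonneg hw.1 hl) η hη).trans ?_
  have h0 := mul_nonneg hw.1 hl
  have h1 := mul_le_of_le_one_left hl hw.2
  gcongr

lemma RapidFamily.coeff_smul (hE : RapidFamily b E) (hg : PolyBdd g) (hw : w ∈ Set.Icc (0 : ℝ) 1)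
    {η : ℝ} (hη : 0 < η) : RapidFamily b fun n x => g η (w * eigenvalue b n) • E n x := by
  obtain ⟨C, hC, K, hK⟩ := hg.eigenvalue_bound (b := b) (T := η) hw hη
  exact hE.smul fun n => hK n η ⟨le_rfl, le_rfl⟩

lemma synth_term_bound (hE : RapidFamily b E) (hg : PolyBdd g) (hw : w ∈ Set.Icc (0 : ℝ) 1)
    {ε T : ℝ} (hε : 0 < ε) : ∃ C : ℝ, ∀ n, ∀ η ∈ Set.Icc ε T, ∀ x,
      ‖g η (w * eigenvalue b n) • E n x‖ ≤ C * ((1 + eigenvalue b n) ^ 3)⁻¹ := by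
  obtain ⟨C, hC, K, hK⟩ := hg.eigenvalue_bound (b := b) (T := T) hw hε
  obtain ⟨D, hD⟩ := hE.exists_summable_bound_zero K
  refine ⟨C * D, fun n η hη x => ?_⟩
  rw [norm_smul, Real.norm_eq_abs]
  calc _ ≤ C * (1 + eigenvalue b n) ^ K * ‖E n x‖ := by
        gcongr
        exact hK n η hη
    _ = C * ((1 + eigenvalue b n) ^ K * ‖E n x‖) := by ring
    _ ≤ C * (D * ((1 + eigenvalue b n) ^ 3)⁻¹) := mul_le_mul_of_nonneg_left (hD n x) hC
    _ = _ := by ring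

variable [CompleteSpace F]

lemma summable_synth (hE : RapidFamily b E) (hg : PolyBdd g) (hw : w ∈ Set.Icc (0 : ℝ) 1)
    {p : ℝ × E3} (hp : 0 < p.1) : Summable fun n => g p.1 (w * eigenvalue b n) • E n p.2 :=
  (hE.coeff_smul hg hw hp).summable p.2

lemma hasDerivAt_synth (hE : RapidFamily b E) (hg : PolyBdd g) (hg' : PolyBdd g')
    (hd : ∀ μ, 0 ≤ μ → ∀ η, 0 < η → HasDerivAt (fun η => g η μ) (g' η μ) η)
    (hw : w ∈ Set.Icc (0 : ℝ) 1) {η : ℝ} (hη : 0 < η) (x : E3) :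
    HasDerivAt (fun η => synth b w g E (η, x)) (synth b w g' E (η, x)) η := by
  obtain ⟨C, hC⟩ := synth_term_bound hE hg' hw (ε := η / 2) (T := 2 * η) (by linarith)
  have hmem : η ∈ Set.Ioo (η / 2) (2 * η) := ⟨by linarith, by linarith⟩
  refine hasDerivAt_tsum_of_isPreconnected (t := Set.Ioo (η / 2) (2 * η))
    (g := fun n η => g η (w * eigenvalue b n) • E n x)
    (g' := fun n η => g' η (w * eigenvalue b n) • E n x)
    ((summable_eigenvalue b).mul_left C) isOpen_Ioo isPreconnected_Ioo
    (fun n y hy => (hd _ (mul_nonneg hw.1 (eigenvalue_nonneg n)) y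
      (by linarith [hy.1])).smul_const _)
    (fun n y hy => hC n y ⟨hy.1.le, hy.2.le⟩ x) hmem (summable_synth hE hg hw (p := (η, x)) hη) hmem

/-- The total derivative is a sum of two syntheses of the same type, with values in a space of
linear maps: one with the time derivative of the coefficients, one with the spatial derivatives of
the functions. This is why the value space is arbitrary. -/
lemma hasFDerivAt_synth (hE : RapidFamily b E) (hg : PolyBdd g) (hg' : PolyBdd g')
    (hd : ∀ μ, 0 ≤ μ → ∀ η, 0 < η → HasDerivAt (fun η => g η μ) (g' η μ) η)
    (hw : w ∈ Set.Icc (0 : ℝ) 1) {p : ℝ × E3} (hp : 0 < p.1) :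
    HasFDerivAt (synth b w g E)
      (synth b w g' (fun n x => ContinuousLinearMap.smulRightL ℝ (ℝ × E3) F
          (ContinuousLinearMap.fst ℝ ℝ E3) (E n x)) p
        + synth b w g (fun n x => (ContinuousLinearMap.compL ℝ (ℝ × E3) E3 F).flip
          (ContinuousLinearMap.snd ℝ ℝ E3) (fderiv ℝ (E n) x)) p) p := by
  have hE1 := hE.clm_comp (ContinuousLinearMap.smulRightL ℝ (ℝ × E3) F
    (ContinuousLinearMap.fst ℝ ℝ E3))
  have hE2 := hE.fderiv.clm_comp ((ContinuousLinearMap.compL ℝ (ℝ × E3) E3 F).flip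
    (ContinuousLinearMap.snd ℝ ℝ E3))
  obtain ⟨C, hC⟩ := synth_term_bound hE1 hg' hw (ε := p.1 / 2) (T := 2 * p.1) (by linarith)
  obtain ⟨D, hD⟩ := synth_term_bound hE2 hg hw (ε := p.1 / 2) (T := 2 * p.1) (by linarith)
  have hmem : p ∈ Set.Ioo (p.1 / 2) (2 * p.1) ×ˢ (Set.univ : Set E3) :=
    ⟨⟨by linarith, by linarith⟩, trivial⟩
  have h := hasFDerivAt_tsum_of_isPreconnected (𝕜 := ℝ)
    (s := Set.Ioo (p.1 / 2) (2 * p.1) ×ˢ (Set.univ : Set E3))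
    (f := fun n (p : ℝ × E3) => g p.1 (w * eigenvalue b n) • E n p.2)
    (f' := fun n p => g' p.1 (w * eigenvalue b n) • ContinuousLinearMap.smulRightL ℝ (ℝ × E3) F
          (ContinuousLinearMap.fst ℝ ℝ E3) (E n p.2)
        + g p.1 (w * eigenvalue b n) • (ContinuousLinearMap.compL ℝ (ℝ × E3) E3 F).flip
          (ContinuousLinearMap.snd ℝ ℝ E3) (fderiv ℝ (E n) p.2))
    ((summable_eigenvalue b).mul_left (C + D)) (isOpen_Ioo.prod isOpen_univ)
    (isPreconnected_Ioo.prod isPreconnected_univ) (fun n q hq => ?_) (fun n q hq => ?_) hmem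
    (summable_synth hE hg hw hp) hmem
  · rwa [(summable_synth hE1 hg' hw hp).tsum_add (summable_synth hE2 hg hw hp)] at h
  · have hq1 : 0 < q.1 := by linarith [hq.1.1]
    have h1 : HasFDerivAt (fun p : ℝ × E3 => g p.1 (w * eigenvalue b n))
        (g' q.1 (w * eigenvalue b n) • ContinuousLinearMap.fst ℝ ℝ E3) q :=
      (hd _ (mul_nonneg hw.1 (eigenvalue_nonneg n)) q.1 hq1).comp_hasFDerivAt q hasFDerivAt_fst
    have h2 : HasFDerivAt (fun p : ℝ × E3 => E n p.2)
        ((fderiv ℝ (E n) q.2).comp (ContinuousLinearMap.snd ℝ ℝ E3)) q :=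
      (((hE.smooth n).differentiable (by simp)) q.2).hasFDerivAt.comp q hasFDerivAt_snd
    refine (h1.smul h2).congr_fderiv ?_
    ext v
    · simp
    · simp
  · rw [add_mul]
    exact (norm_add_le _ _).trans (add_le_add (hC n q.1 ⟨hq.1.1.le, hq.1.2.le⟩ q.2)
      (hD n q.1 ⟨hq.1.1.le, hq.1.2.le⟩ q.2))

end RapidFamily

/-- Induction over all value spaces, as differentiation changes the space. One extra η-derivative is
required because continuity is obtained from differentiability. -/
lemma contDiffOn_synth_nat {b : Module.Basis (Fin 3) ℝ E3} {w : ℝ} (hw : w ∈ Set.Icc (0 : ℝ) 1)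
    (k : ℕ) {F : Type} [NormedAddCommGroup F] [NormedSpace ℝ F] [CompleteSpace F]
    {g : ℝ → ℝ → ℝ} {E : (Fin 3 → ℤ) → E3 → F} (hE : RapidFamily b E)
    (hg : SmoothPolyBdd (k + 1) g) :
    ContDiffOn ℝ k (synth b w g E) (Set.Ioi 0 ×ˢ Set.univ) := by
  induction k generalizing F g with
  | zero =>
    obtain ⟨h0, g', h1, h2⟩ := hg
    rw [Nat.cast_zero, contDiffOn_zero]
    exact fun p hp => (hasFDerivAt_synth hE h0 h2.polyBdd h1 hw
      hp.1).continuousAt.continuousWithinAt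
  | succ k ih =>
    have hg1 := hg.of_succ
    obtain ⟨h0, g', h1, h2⟩ := hg
    have hder := fun (p : ℝ × E3) (hp : p ∈ Set.Ioi (0 : ℝ) ×ˢ (Set.univ : Set E3)) =>
      hasFDerivAt_synth hE h0 h2.polyBdd h1 hw hp.1
    rw [Nat.cast_succ, contDiffOn_succ_iff_fderiv_of_isOpen (isOpen_Ioi.prod isOpen_univ)]
    refine ⟨fun p hp => (hder p hp).differentiableAt.differentiableWithinAt, by simp, ?_⟩
    refine ContDiffOn.congr ?_ fun p hp => (hder p hp).fderiv
    exact (ih (hE.clm_comp _) h2).add (ih (hE.fderiv.clm_comp _) hg1)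

lemma contDiffOn_synth {b : Module.Basis (Fin 3) ℝ E3} {w : ℝ} (hw : w ∈ Set.Icc (0 : ℝ) 1)
    {g : ℝ → ℝ → ℝ} {E : (Fin 3 → ℤ) → E3 → ℝ} (hE : RapidFamily b E)
    (hg : ∀ k, SmoothPolyBdd k g) :
    ContDiffOn ℝ ∞ (synth b w g E) (Set.Ioi 0 ×ˢ Set.univ) :=
  contDiffOn_infty.2 fun k => contDiffOn_synth_nat hw k hE (hg (k + 1))

/-! ### Asymptotic expansions at `η = 0` -/

/-- `g η` is smooth and `o(η ^ K)` as `η → 0`, uniformly and with all spatial derivatives. -/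
structure IsLittleORpow (g : ℝ → E3 → ℝ) (K : ℝ) : Prop where
  smooth : ∀ η, 0 < η → ContDiff ℝ ∞ (g η)
  bound : ∀ (m : ℕ) (ε : ℝ), 0 < ε → ∀ᶠ η in 𝓝[>] (0 : ℝ), ∀ x : E3,
    ‖iteratedFDeriv ℝ m (g η) x‖ ≤ ε * η ^ K

namespace IsLittleORpow

variable {g h : ℝ → E3 → ℝ} {K : ℝ}

lemma add (hg : IsLittleORpow g K) (hh : IsLittleORpow h K) :
    IsLittleORpow (fun η x => g η x + h η x) K where
  smooth η hη := (hg.smooth η hη).add (hh.smooth η hη)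
  bound m ε hε := by
    filter_upwards [hg.bound m (ε / 2) (by linarith), hh.bound m (ε / 2) (by linarith),
      self_mem_nhdsWithin] with η h1 h2 hη x
    have e : iteratedFDeriv ℝ m (fun x => g η x + h η x) x
        = iteratedFDeriv ℝ m (g η) x + iteratedFDeriv ℝ m (h η) x :=
      iteratedFDeriv_add_apply (contDiff_infty.1 (hg.smooth η hη) m).contDiffAt
        (contDiff_infty.1 (hh.smooth η hη) m).contDiffAt
    rw [e]
    refine (norm_add_le _ _).trans ((add_le_add (h1 x) (h2 x)).trans_eq ?_)
    ring

lemma neg (hg : IsLittleORpow g K) : IsLittleORpow (fun η x => -g η x) K where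
  smooth η hη := (hg.smooth η hη).neg
  bound m ε hε := by
    filter_upwards [hg.bound m ε hε] with η h1 x
    have e : iteratedFDeriv ℝ m (fun x => -g η x) x = -iteratedFDeriv ℝ m (g η) x :=
      iteratedFDeriv_neg_apply
    rw [e, norm_neg]
    exact h1 x

lemma sub (hg : IsLittleORpow g K) (hh : IsLittleORpow h K) :
    IsLittleORpow (fun η x => g η x - h η x) K := by
  simpa [sub_eq_add_neg] using hg.add hh.neg

lemma of_bound {σ : ℝ} (hσ : K < σ) (hs : ∀ η, 0 < η → ContDiff ℝ ∞ (g η))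
    (hb : ∀ m : ℕ, ∃ C : ℝ, ∀ η ∈ Set.Ioc (0 : ℝ) 1, ∀ x,
      ‖iteratedFDeriv ℝ m (g η) x‖ ≤ C * η ^ σ) : IsLittleORpow g K where
  smooth := hs
  bound m ε hε := by
    obtain ⟨C, hC⟩ := hb m
    have hlim := (tendsto_rpow_nhdsGT_zero (sub_pos.2 hσ)).const_mul C
    rw [mul_zero] at hlim
    filter_upwards [hlim.eventually_le_const hε, Ioo_mem_nhdsGT (zero_lt_one (α := ℝ))]
      with η h1 hη x
    have e : η ^ σ = η ^ (σ - K) * η ^ K := by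
      rw [← Real.rpow_add hη.1]; ring_nf
    calc _ ≤ C * η ^ σ := hC η ⟨hη.1, hη.2.le⟩ x
      _ = C * η ^ (σ - K) * η ^ K := by rw [e]; ring
      _ ≤ ε * η ^ K := mul_le_mul_of_nonneg_right h1 (Real.rpow_nonneg hη.1.le _)

lemma mono (hg : IsLittleORpow g K) {K' : ℝ} (hK : K' ≤ K) : IsLittleORpow g K' where
  smooth := hg.smooth
  bound m ε hε := by
    filter_upwards [hg.bound m ε hε, Ioo_mem_nhdsGT (zero_lt_one (α := ℝ))] with η h1 hη x
    refine (h1 x).trans ?_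
    gcongr ?_ * ?_
    exact Real.rpow_le_rpow_of_exponent_ge hη.1 hη.2.le hK

lemma zero (K : ℝ) : IsLittleORpow (fun _ _ => 0) K where
  smooth _ _ := contDiff_const
  bound m ε hε := by
    filter_upwards [self_mem_nhdsWithin] with η hη x
    have : iteratedFDeriv ℝ m (fun _ : E3 => (0 : ℝ)) x = 0 := by
      simp
    rw [this, norm_zero]
    exact mul_nonneg hε.le (Real.rpow_nonneg (Set.mem_Ioi.1 hη).le _)

lemma sum {ι : Type*} (s : Finset ι) {g : ι → ℝ → E3 → ℝ}
    (hg : ∀ i ∈ s, IsLittleORpow (g i) K) : IsLittleORpow (fun η x => ∑ i ∈ s, g i η x) K := by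
  classical
  induction s using Finset.induction_on with
  | empty => simpa using zero K
  | insert i s hi ih =>
    simp only [Finset.sum_insert hi]
    exact (hg i (Finset.mem_insert_self _ _)).add
      (ih fun j hj => hg j (Finset.mem_insert_of_mem hj))

end IsLittleORpow

lemma IsSmoothOnTorus.exists_iteratedFDeriv_bound {b : Module.Basis (Fin 3) ℝ E3} {f : E3 → ℝ}
    (hf : IsSmoothOnTorus b f) (m : ℕ) : ∃ C : ℝ, ∀ x, ‖iteratedFDeriv ℝ m f x‖ ≤ C := by
  have hper : IsPeriodic b fun x => ‖iteratedFDeriv ℝ m f x‖ := fun i x => by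
    have e : (fun x => f (x + b i)) = f := funext fun x => hf.periodic i x
    have h := iteratedFDeriv_comp_add_right (𝕜 := ℝ) (f := f) m (b i) x
    rw [e] at h
    simp only [h]
  have hc : Continuous fun x => ‖iteratedFDeriv ℝ m f x‖ :=
    ((contDiff_infty.1 hf.smooth m).continuous_iteratedFDeriv le_rfl).norm
  obtain ⟨C, hC⟩ := IsPeriodic.exists_bound (b := b) (S := {0}) isCompact_singleton
    (G := fun _ x => ‖iteratedFDeriv ℝ m f x‖) (fun _ _ => hper)
    (hc.comp continuous_snd).continuousOn
  exact ⟨C, fun x => (le_abs_self _).trans (hC 0 rfl x)⟩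

/-- The term with exponent `k` of an expansion. -/
def expansionTerm (c : ℝ → Fin 2 → E3 → ℝ) (k η : ℝ) (x : E3) : ℝ :=
  (c k 0 x + c k 1 x * Real.log η) * η ^ k

lemma contDiff_expansionTerm {b : Module.Basis (Fin 3) ℝ E3} {c : ℝ → Fin 2 → E3 → ℝ}
    (hc : ∀ k l, IsSmoothOnTorus b (c k l)) (k η : ℝ) : ContDiff ℝ ∞ (expansionTerm c k η) :=
  ((hc k 0).smooth.add ((hc k 1).smooth.mul contDiff_const)).mul contDiff_const

lemma isLittleORpow_expansionTerm {b : Module.Basis (Fin 3) ℝ E3} {c : ℝ → Fin 2 → E3 → ℝ}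
    (hc : ∀ k l, IsSmoothOnTorus b (c k l)) {k K : ℝ} (hk : K < k) :
    IsLittleORpow (expansionTerm c k) K := by
  -- Part of the gap between K and k, the power η ^ r, is spent on the logarithm.
  obtain ⟨r, hr0, hr⟩ : ∃ r : ℝ, 0 < r ∧ K < k - r := ⟨(k - K) / 2, by linarith, by linarith⟩
  refine IsLittleORpow.of_bound hr (fun η _ => contDiff_expansionTerm hc k η) fun m => ?_
  obtain ⟨C, hC⟩ := (hc k 0).exists_iteratedFDeriv_bound m
  obtain ⟨D, hD⟩ := (hc k 1).exists_iteratedFDeriv_bound m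
  have hC0 := (norm_nonneg _).trans (hC 0)
  have hD0 := (norm_nonneg _).trans (hD 0)
  refine ⟨C + D * (1 / r), fun η hη x => ?_⟩
  have e1 : expansionTerm c k η
      = fun x => (η ^ k) • c k 0 x + (Real.log η * η ^ k) • c k 1 x := by
    ext x
    simp only [expansionTerm, smul_eq_mul]
    ring
  have s0 := contDiff_infty.1 (hc k 0).smooth m
  have s1 := contDiff_infty.1 (hc k 1).smooth m
  have e2 : iteratedFDeriv ℝ m (expansionTerm c k η) x
      = (η ^ k) • iteratedFDeriv ℝ m (c k 0) x
        + (Real.log η * η ^ k) • iteratedFDeriv ℝ m (c k 1) x := by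
    have t0 : ContDiff ℝ m fun x => (η ^ k) • c k 0 x := s0.const_smul _
    have t1 : ContDiff ℝ m fun x => (Real.log η * η ^ k) • c k 1 x := s1.const_smul _
    rw [e1]
    refine (iteratedFDeriv_add_apply t0.contDiffAt t1.contDiffAt).trans ?_
    rw [iteratedFDeriv_const_smul_apply' s0.contDiffAt,
      iteratedFDeriv_const_smul_apply' s1.contDiffAt]
  have e3 : η ^ k = η ^ r * η ^ (k - r) := by
    rw [← Real.rpow_add hη.1]; ring_nf
  have h1 : η ^ r ≤ 1 := Real.rpow_le_one hη.1.le hη.2 hr0.le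
  have h2 := (Real.abs_log_mul_self_rpow_lt η r hη.1 hη.2 hr0).le
  have h3 : 0 ≤ η ^ (k - r) := Real.rpow_nonneg hη.1.le _
  have h4 : 0 ≤ η ^ r := Real.rpow_nonneg hη.1.le _
  rw [e2]
  refine (norm_add_le _ _).trans ?_
  rw [norm_smul, norm_smul, e3, ← mul_assoc, norm_mul, norm_mul, Real.norm_of_nonneg h3,
    Real.norm_of_nonneg h4, Real.norm_eq_abs]
  calc _ ≤ 1 * η ^ (k - r) * C + 1 / r * η ^ (k - r) * D := by
        gcongr
        exacts [hC x, hD x]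
    _ = _ := by ring

/-- `Φ` has the expansion with coefficients `c`, in terms of finite sets of exponents. -/
def HasExpansion (Φ : ℝ → E3 → ℝ) (c : ℝ → Fin 2 → E3 → ℝ) : Prop :=
  ∀ K : ℝ, ∃ H : Finset ℝ, (∀ k, c k ≠ 0 → k ≤ K → k ∈ H) ∧
    IsLittleORpow (fun η x => Φ η x - ∑ k ∈ H, expansionTerm c k η x) K

/-! ### Change of exponent set and uniqueness of coefficients -/

section HasExpansion

variable {b : Module.Basis (Fin 3) ℝ E3} {Φ Φ' : ℝ → E3 → ℝ} {c c' : ℝ → Fin 2 → E3 → ℝ}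

lemma expansionTerm_of_eq_zero {k : ℝ} (h : c k = 0) (η : ℝ) (x : E3) :
    expansionTerm c k η x = 0 := by
  simp [expansionTerm, h]

lemma isLittleORpow_sum_of_not_mem (hc : ∀ k l, IsSmoothOnTorus b (c k l)) {K : ℝ} (H : Finset ℝ)
    (hH : ∀ k ∈ H, c k ≠ 0 → K < k) :
    IsLittleORpow (fun η x => ∑ k ∈ H, expansionTerm c k η x) K := by
  refine IsLittleORpow.sum H fun k hk => ?_
  by_cases h0 : c k = 0
  · convert IsLittleORpow.zero K using 3
    exact expansionTerm_of_eq_zero h0 _ _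
  · exact isLittleORpow_expansionTerm hc (hH k hk h0)

/-- Two admissible finite sets differ only by terms with zero coefficient or exponent above K, which
are negligible. Expansions can thus be compared on a common set. -/
lemma HasExpansion.remainder (h : HasExpansion Φ c) (hc : ∀ k l, IsSmoothOnTorus b (c k l))
    {K : ℝ} {H : Finset ℝ} (hH : ∀ k, c k ≠ 0 → k ≤ K → k ∈ H) :
    IsLittleORpow (fun η x => Φ η x - ∑ k ∈ H, expansionTerm c k η x) K := by
  classical
  obtain ⟨H', hH', ho⟩ := h K
  have h1 := isLittleORpow_sum_of_not_mem hc (K := K) (H \ H') fun k hk h0 => by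
    by_contra hlt
    exact (Finset.mem_sdiff.1 hk).2 (hH' k h0 (not_lt.1 hlt))
  have h2 := isLittleORpow_sum_of_not_mem hc (K := K) (H' \ H) fun k hk h0 => by
    by_contra hlt
    exact (Finset.mem_sdiff.1 hk).2 (hH k h0 (not_lt.1 hlt))
  convert (ho.add h2).sub h1 using 3 with η x
  have := Finset.sum_sdiff_sub_sum_sdiff (s₁ := H) (s₂ := H') (f := fun k => expansionTerm c k η x)
  linarith

lemma HasExpansion.add (h : HasExpansion Φ c) (h' : HasExpansion Φ' c')
    (hc : ∀ k l, IsSmoothOnTorus b (c k l)) (hc' : ∀ k l, IsSmoothOnTorus b (c' k l)) :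
    HasExpansion (fun η x => Φ η x + Φ' η x) (fun k l x => c k l x + c' k l x) := by
  classical
  intro K
  obtain ⟨H, hH, -⟩ := h K
  obtain ⟨H', hH', -⟩ := h' K
  refine ⟨H ∪ H', fun k hk hkK => ?_, ?_⟩
  · by_contra hmem
    rw [Finset.mem_union, not_or] at hmem
    refine hk (funext fun l => funext fun x => ?_)
    have h1 : c k = 0 := by_contra fun h0 => hmem.1 (hH k h0 hkK)
    have h2 : c' k = 0 := by_contra fun h0 => hmem.2 (hH' k h0 hkK)
    simp [h1, h2]
  · have h1 := h.remainder hc (K := K) (H := H ∪ H') fun k hk hkK =>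
      Finset.mem_union_left _ (hH k hk hkK)
    have h2 := h'.remainder hc' (K := K) (H := H ∪ H') fun k hk hkK =>
      Finset.mem_union_right _ (hH' k hk hkK)
    convert h1.add h2 using 3 with η x
    have : ∑ k ∈ H ∪ H', expansionTerm (fun k l x => c k l x + c' k l x) k η x
        = ∑ k ∈ H ∪ H', expansionTerm c k η x + ∑ k ∈ H ∪ H', expansionTerm c' k η x := by
      rw [← Finset.sum_add_distrib]
      refine Finset.sum_congr rfl fun k _ => ?_
      simp only [expansionTerm]
      ring
    rw [this]
    ring

/-- After division by η ^ k the expression c₀ + c₁ log η tends to zero; dividing by log η yields c₁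
= 0, and then c₀ = 0. -/
lemma eq_zero_of_expansionTerm {k : ℝ} (h : IsLittleORpow (expansionTerm c k) k) : c k = 0 := by
  have hx : ∀ x, c k 1 x = 0 ∧ c k 0 x = 0 := fun x => by
    have hlim : Filter.Tendsto (fun η => c k 0 x + c k 1 x * Real.log η) (𝓝[>] 0) (𝓝 0) := by
      rw [Metric.tendsto_nhds]
      intro ε hε
      filter_upwards [h.bound 0 (ε / 2) (by linarith), self_mem_nhdsWithin] with η h1 hη
      have hpos : 0 < η ^ k := Real.rpow_pos_of_pos hη _
      have h2 := h1 x
      rw [norm_iteratedFDeriv_zero, expansionTerm, norm_mul, Real.norm_of_nonneg hpos.le] at h2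
      have h3 := le_of_mul_le_mul_right h2 hpos
      rw [dist_zero_right]
      linarith
    have hinv : Filter.Tendsto (fun η : ℝ => (Real.log η)⁻¹) (𝓝[>] 0) (𝓝 0) :=
      tendsto_inv_atBot_zero.comp Real.tendsto_log_nhdsGT_zero
    have h1 : c k 1 x = 0 := by
      have h2 := (hlim.mul hinv).sub (hinv.const_mul (c k 0 x))
      simp only [mul_zero, sub_zero] at h2
      refine tendsto_nhds_unique (tendsto_const_nhds.congr' ?_) h2
      filter_upwards [Ioo_mem_nhdsGT (zero_lt_one (α := ℝ))] with η hη
      have : Real.log η ≠ 0 := (Real.log_neg hη.1 hη.2).ne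
      field_simp
      ring
    refine ⟨h1, ?_⟩
    simp only [h1, zero_mul, add_zero] at hlim
    exact tendsto_nhds_unique tendsto_const_nhds hlim
  funext l x
  fin_cases l
  exacts [(hx x).2, (hx x).1]

/-- The coefficients of an expansion are unique. -/
theorem HasExpansion.unique (h : HasExpansion Φ c) (h' : HasExpansion Φ c')
    (hc : ∀ k l, IsSmoothOnTorus b (c k l)) (hc' : ∀ k l, IsSmoothOnTorus b (c' k l)) :
    c = c' := by
  classical
  by_contra hne
  obtain ⟨k₁, hk₁⟩ := Function.ne_iff.1 hne
  obtain ⟨H, hH, -⟩ := h k₁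
  obtain ⟨H', hH', -⟩ := h' k₁
  have hmem : ∀ k, c k ≠ c' k → k ≤ k₁ → k ∈ H ∪ H' := fun k hk hle => by
    by_contra hn
    rw [Finset.mem_union, not_or] at hn
    have h1 : c k = 0 := by_contra fun h0 => hn.1 (hH k h0 hle)
    have h2 : c' k = 0 := by_contra fun h0 => hn.2 (hH' k h0 hle)
    exact hk (h1.trans h2.symm)
  -- The exponents up to k₁ at which the coefficients differ form a finite set. At the smallest one,
  -- k₀, lower terms of the difference cancel and higher ones are o(η ^ k₀), so the single remaining
  -- term is o(η ^ k₀) as well.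
  set B := (H ∪ H').filter fun k => c k ≠ c' k ∧ k ≤ k₁ with hB
  have hBne : B.Nonempty := ⟨k₁, by simpa [hB, hk₁] using hmem k₁ hk₁ le_rfl⟩
  set k₀ := B.min' hBne
  have hk₀ : k₀ ∈ B := B.min'_mem hBne
  rw [hB, Finset.mem_filter] at hk₀
  have hlt : ∀ k < k₀, c k = c' k := fun k hk => by
    by_contra hck
    have hle : k ≤ k₁ := hk.le.trans hk₀.2.2
    have : k ∈ B := by
      rw [hB, Finset.mem_filter]
      exact ⟨hmem k hck hle, hck, hle⟩
    exact absurd (B.min'_le k this) (not_le.2 hk)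
  have h1 := (h.remainder hc (K := k₁) (H := H ∪ H') fun k hk hle =>
    Finset.mem_union_left _ (hH k hk hle)).mono hk₀.2.2
  have h2 := (h'.remainder hc' (K := k₁) (H := H ∪ H') fun k hk hle =>
    Finset.mem_union_right _ (hH' k hk hle)).mono hk₀.2.2
  set d : ℝ → Fin 2 → E3 → ℝ := fun k l x => c k l x + -1 * c' k l x with hd
  have hds : ∀ k l, IsSmoothOnTorus b (d k l) := fun k l => (hc k l).add ((hc' k l).const_mul _)
  have h3 := isLittleORpow_sum_of_not_mem hds (K := k₀) ((H ∪ H').erase k₀) fun k hk hdk => by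
    by_contra hle
    have hlt' : k < k₀ := lt_of_le_of_ne (not_lt.1 hle) (Finset.ne_of_mem_erase hk)
    exact hdk (funext fun l => funext fun x => by simp [hd, hlt k hlt'])
  have h4 : IsLittleORpow (expansionTerm d k₀) k₀ := by
    convert (h2.sub h1).sub h3 using 1
    ext η x
    have e1 : ∑ k ∈ H ∪ H', expansionTerm d k η x
        = ∑ k ∈ H ∪ H', expansionTerm c k η x - ∑ k ∈ H ∪ H', expansionTerm c' k η x := by
      rw [← Finset.sum_sub_distrib]
      refine Finset.sum_congr rfl fun k _ => ?_
      simp only [expansionTerm, hd]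
      ring
    rw [← Finset.add_sum_erase _ _ hk₀.1] at e1
    linarith
  have h5 := eq_zero_of_expansionTerm h4
  refine hk₀.2.1 (funext fun l => funext fun x => ?_)
  have := congrFun (congrFun h5 l) x
  simp only [hd, Pi.zero_apply] at this
  linarith

/-- Finite exponent sets replace the sequence, so that expansions along different sequences become
comparable. -/
lemma IsSingularExpansion.hasExpansion {w : ℝ} (h : IsSingularExpansion b w Φ c)
    (hΦ : ∀ η, 0 < η → ContDiff ℝ ∞ (Φ η)) : HasExpansion Φ c := by
  classical
  obtain ⟨hc, κ, hmono, htop, -, hsupp, hrem⟩ := h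
  intro K
  obtain ⟨n, hn⟩ := (htop.eventually_ge_atTop K).exists
  refine ⟨(Finset.range (n + 1)).image κ, fun k hk hle => ?_, ?_⟩
  · obtain ⟨j, rfl⟩ : k ∈ Set.range κ := by
      by_contra hr
      exact hk (funext fun l => hsupp k hr l)
    have := hmono.le_iff_le.1 (hle.trans hn)
    exact Finset.mem_image_of_mem κ (Finset.mem_range.2 (by omega))
  · simp only [Finset.sum_image hmono.injective.injOn]
    refine IsLittleORpow.mono (K := κ n) ⟨fun η hη => ?_, fun m ε hε => hrem n m ε hε⟩ hn
    exact (hΦ η hη).sub (ContDiff.sum fun k _ => contDiff_expansionTerm hc _ η)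

lemma HasExpansion.isSingularExpansion {w : ℝ} (h : HasExpansion Φ c)
    (hc : ∀ k l, IsSmoothOnTorus b (c k l)) {κ : ℕ → ℝ} (hmono : StrictMono κ)
    (htop : Filter.Tendsto κ Filter.atTop Filter.atTop) (hlow : ∀ n, -2 * nuExp w ≤ κ n)
    (hsupp : ∀ k, c k ≠ 0 → k ∈ Set.range κ) : IsSingularExpansion b w Φ c := by
  classical
  refine ⟨hc, κ, hmono, htop, hlow, fun k hk l => ?_, fun n m ε hε => ?_⟩
  · have : c k = 0 := by_contra fun h0 => hk (hsupp k h0)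
    rw [this]
    rfl
  · have h1 := h.remainder hc (K := κ n) (H := (Finset.range (n + 1)).image κ) fun k hk hle => by
      obtain ⟨j, rfl⟩ := hsupp k hk
      have := hmono.le_iff_le.1 hle
      exact Finset.mem_image_of_mem κ (Finset.mem_range.2 (by omega))
    simp only [Finset.sum_image hmono.injective.injOn] at h1
    exact h1.bound m ε hε

end HasExpansion

/-! ### Solutions with a given leading exponent -/

section Family

variable {b : Module.Basis (Fin 3) ℝ E3} {w a s : ℝ} {A B : (Fin 3 → ℤ) → ℂ}

/-- The superposition of plane waves with amplitudes `A`. -/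
def waveSum (b : Module.Basis (Fin 3) ℝ E3) (A : (Fin 3 → ℤ) → ℂ) (x : E3) : ℝ :=
  ∑' n, wave b (A n) n x

/-- The solution with leading term `η ^ s * waveSum b A`. -/
def branchSolution (b : Module.Basis (Fin 3) ℝ E3) (w a s : ℝ) (A : (Fin 3 → ℤ) → ℂ)
    (η : ℝ) (x : E3) : ℝ := synth b w (mode a s) (fun n => wave b (A n) n) (η, x)

/-- The iterates of `w * Δ`. -/
def lapPow (w : ℝ) (f : E3 → ℝ) : ℕ → E3 → ℝ
  | 0 => f
  | i + 1 => fun x => w * Laplacian.laplacian (lapPow w f i) x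

/-- The coefficients of the expansion of the solution with leading term `η ^ s * f`. -/
def branchCoeff (w a s : ℝ) (f : E3 → ℝ) (k : ℝ) (l : Fin 2) (x : E3) : ℝ :=
  -- The floor is the only possible index i with k = s + 2i; for k < s it is 0 and the test fails.
  if k = s + 2 * (⌊(k - s) / 2⌋₊ : ℝ) then
    (if l = 0 then frobFst a s ⌊(k - s) / 2⌋₊ else frobSnd a s ⌊(k - s) / 2⌋₊)
      * lapPow w f ⌊(k - s) / 2⌋₊ x
  else 0

lemma floor_exponent (s : ℝ) (i : ℕ) : ⌊(s + 2 * (i : ℝ) - s) / 2⌋₊ = i := by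
  rw [show (s + 2 * (i : ℝ) - s) / 2 = i by ring, Nat.floor_natCast]

lemma branchCoeff_zero (f : E3 → ℝ) (i : ℕ) (x : E3) :
    branchCoeff w a s f (s + 2 * i) 0 x = frobFst a s i * lapPow w f i x := by
  simp only [branchCoeff, floor_exponent, if_true]

lemma branchCoeff_one (f : E3 → ℝ) (i : ℕ) (x : E3) :
    branchCoeff w a s f (s + 2 * i) 1 x = frobSnd a s i * lapPow w f i x := by
  simp [branchCoeff]

lemma branchCoeff_of_ne (f : E3 → ℝ) {k : ℝ} (hk : ∀ i : ℕ, k ≠ s + 2 * i) :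
    branchCoeff w a s f k = 0 := by
  funext l x
  rw [branchCoeff, if_neg (hk _)]
  rfl

lemma exists_of_branchCoeff_ne_zero {f : E3 → ℝ} {k : ℝ} (h : branchCoeff w a s f k ≠ 0) :
    ∃ i : ℕ, k = s + 2 * i := by
  by_contra hn
  push Not at hn
  exact h (branchCoeff_of_ne f hn)

lemma IsSmoothOnTorus.lapPow {f : E3 → ℝ} (hf : IsSmoothOnTorus b f) (i : ℕ) :
    IsSmoothOnTorus b (lapPow w f i) := by
  induction i with
  | zero => exact hf
  | succ i ih => exact ih.laplacian.const_mul w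

lemma isSmoothOnTorus_branchCoeff {f : E3 → ℝ} (hf : IsSmoothOnTorus b f) (k : ℝ) (l : Fin 2) :
    IsSmoothOnTorus b (branchCoeff w a s f k l) := by
  unfold branchCoeff
  split_ifs with h1 h2
  · exact (hf.lapPow _).const_mul _
  · exact (hf.lapPow _).const_mul _
  · exact ⟨contDiff_const, fun _ _ => rfl⟩

lemma laplacian_zero_fun (x : E3) : Laplacian.laplacian (0 : E3 → ℝ) x = 0 := by
  have : Laplacian.laplacian (fun _ : E3 => (0 : ℝ)) = 0 := InnerProductSpace.laplacian_const
  exact congrFun this x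

/-- The recursion satisfied by the coefficients of one branch. -/
lemma branchCoeff_recursion (ha : 0 < a) (hs : s = 0 ∨ s = -a) {f : E3 → ℝ}
    (hf : IsSmoothOnTorus b f) (k : ℝ) (x : E3) :
    k * (k + a) * branchCoeff w a s f k 0 x
      = w * Laplacian.laplacian (branchCoeff w a s f (k - 2) 0) x
        - (2 * k + a) * branchCoeff w a s f k 1 x ∧
    k * (k + a) * branchCoeff w a s f k 1 x
      = w * Laplacian.laplacian (branchCoeff w a s f (k - 2) 1) x := by
  have hF := isFrobenius_frobCoeff ha hs
  by_cases hk : ∃ i : ℕ, k = s + 2 * i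
  · obtain ⟨i, rfl⟩ := hk
    have h1 := hF.rec_fst i
    have h2 := hF.rec_snd i
    rw [branchCoeff_zero, branchCoeff_one]
    rcases i with _ | i
    · have h0 : branchCoeff w a s f (s + 2 * ((0 : ℕ) : ℝ) - 2) = 0 := by
        refine branchCoeff_of_ne f fun j hj => ?_
        have : (0 : ℝ) ≤ j := j.cast_nonneg
        push_cast at hj
        linarith
      rw [h0]
      simp only [Pi.zero_apply, laplacian_zero_fun]
      simp only [seqCons] at h1 h2
      constructor
      · linear_combination lapPow w f 0 x * h1
      · linear_combination lapPow w f 0 x * h2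
    · have e : s + 2 * ((i + 1 : ℕ) : ℝ) - 2 = s + 2 * i := by push_cast; ring
      have hlap : ContDiffAt ℝ 2 (lapPow w f i) x :=
        (contDiff_infty.1 (hf.lapPow i).smooth 2).contDiffAt
      have e0 : Laplacian.laplacian (branchCoeff w a s f (s + 2 * i) 0) x
          = frobFst a s i * Laplacian.laplacian (lapPow w f i) x := by
        rw [show branchCoeff w a s f (s + 2 * i) 0 = frobFst a s i • lapPow w f i from
          funext fun x => branchCoeff_zero f i x]
        exact InnerProductSpace.laplacian_smul _ hlap
      have e1 : Laplacian.laplacian (branchCoeff w a s f (s + 2 * i) 1) x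
          = frobSnd a s i * Laplacian.laplacian (lapPow w f i) x := by
        rw [show branchCoeff w a s f (s + 2 * i) 1 = frobSnd a s i • lapPow w f i from
          funext fun x => branchCoeff_one f i x]
        exact InnerProductSpace.laplacian_smul _ hlap
      rw [e, e0, e1]
      simp only [seqCons, lapPow] at h1 h2 ⊢
      constructor
      · linear_combination w * Laplacian.laplacian (lapPow w f i) x * h1
      · linear_combination w * Laplacian.laplacian (lapPow w f i) x * h2
  · push Not at hk
    have hk2 : ∀ i : ℕ, k - 2 ≠ s + 2 * i := fun i hi => hk (i + 1) (by push_cast; linarith)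
    rw [branchCoeff_of_ne f hk, branchCoeff_of_ne f hk2]
    simp only [Pi.zero_apply, laplacian_zero_fun]
    simp

lemma isSmoothOnTorus_waveSum (hA : RapidDecay b A) : IsSmoothOnTorus b (waveSum b A) :=
  ⟨(RapidFamily.of_rapidDecay hA).contDiff_tsum,
    fun i x => tsum_congr fun n => wave_periodic _ n i x⟩

lemma rapidFamily_pow (hA : RapidDecay b A) (hw : w ∈ Set.Icc (0 : ℝ) 1) (i : ℕ) :
    RapidFamily b fun n x => (-(w * eigenvalue b n)) ^ i • wave b (A n) n x := by
  refine (RapidFamily.of_rapidDecay hA).smul (C := 1) (K := i) fun n => ?_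
  have hl := eigenvalue_nonneg (b := b) n
  rw [abs_pow, abs_neg, abs_of_nonneg (mul_nonneg hw.1 hl), one_mul]
  have h1 := mul_le_of_le_one_left hl hw.2
  have h0 := mul_nonneg hw.1 hl
  gcongr
  linarith

lemma laplacian_smul_wave (c : ℝ) (A : ℂ) (n : Fin 3 → ℤ) (x : E3) :
    Laplacian.laplacian (fun x => c • wave b A n x) x = c * (-eigenvalue b n * wave b A n x) := by
  have h := InnerProductSpace.laplacian_smul c
    (contDiff_infty.1 (contDiff_wave (b := b) A n) 2).contDiffAt (x := x)
  rw [laplacian_wave] at h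
  exact h

/-- On a plane wave w Δ is multiplication by -μ, so powers of -μ in the Frobenius series of the
modes turn into iterates of w Δ on the data. -/
lemma lapPow_waveSum (hA : RapidDecay b A) (hw : w ∈ Set.Icc (0 : ℝ) 1) (i : ℕ) :
    lapPow w (waveSum b A) i
      = fun x => ∑' n, (-(w * eigenvalue b n)) ^ i • wave b (A n) n x := by
  induction i with
  | zero =>
    simp only [lapPow, pow_zero, one_smul]
    rfl
  | succ i ih =>
    funext x
    simp only [lapPow]
    rw [ih]
    have h := (rapidFamily_pow hA hw i).laplacian_tsum x
    rw [← h.tsum_eq, ← tsum_mul_left]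
    refine tsum_congr fun n => ?_
    rw [laplacian_smul_wave, smul_eq_mul]
    ring

/-- The remainder of each mode is at most C μ ^ (N + 1) times a power of η beyond K, and the rapidly
decreasing amplitudes absorb μ ^ (N + 1) and all spatial derivatives in the sum over modes. -/
theorem hasExpansion_branch (hA : RapidDecay b A) (hw : w ∈ Set.Icc (0 : ℝ) 1) (ha : 0 < a)
    (hs : s = 0 ∨ s = -a) :
    HasExpansion (branchSolution b w a s A) (branchCoeff w a s (waveSum b A)) := by
  classical
  intro K
  -- The energy estimate needs exponent at least 2; K + 1 leaves room for the half power lost to the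
  -- logarithm.
  obtain ⟨N, hN⟩ := exists_large_exponent s (max 2 (K + 1))
  have hN2 := (le_max_left _ _).trans hN
  have hNK := (le_max_right _ _).trans hN
  have hinj : Function.Injective fun i : ℕ => s + 2 * (i : ℝ) := fun i j h => by
    have : (i : ℝ) = j := by simpa using h
    exact_mod_cast this
  refine ⟨(Finset.range (N + 1)).image fun i : ℕ => s + 2 * (i : ℝ), fun k hk hle => ?_, ?_⟩
  · obtain ⟨i, rfl⟩ := exists_of_branchCoeff_ne_zero hk
    refine Finset.mem_image_of_mem _ (Finset.mem_range.2 ?_)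
    have : (i : ℝ) < ((N + 1 : ℕ) : ℝ) := by linarith
    exact_mod_cast this
  simp only [Finset.sum_image hinj.injOn]
  set r : ℝ → ℝ → ℝ := fun η μ => mode a s η μ - ∑ i ∈ Finset.range (N + 1),
      (frobFst a s i + frobSnd a s i * Real.log η) * (-μ) ^ i * η ^ (s + 2 * i) with hr
  obtain ⟨C, hC, hrem⟩ := mode_remainder ha hs hN2 zero_lt_one
  have hE := RapidFamily.of_rapidDecay hA
  have key : ∀ η, 0 < η → (fun x => branchSolution b w a s A η x - ∑ i ∈ Finset.range (N + 1),
      expansionTerm (branchCoeff w a s (waveSum b A)) (s + 2 * i) η x)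
        = fun x => ∑' n, r η (w * eigenvalue b n) • wave b (A n) n x := fun η hη => by
    funext x
    have h1 : HasSum (fun n => mode a s η (w * eigenvalue b n) • wave b (A n) n x)
        (branchSolution b w a s A η x) :=
      (summable_synth hE (polyBdd_mode ha hs) hw (p := (η, x)) hη).hasSum
    have h2 : HasSum (fun n => ∑ i ∈ Finset.range (N + 1),
        ((frobFst a s i + frobSnd a s i * Real.log η) * η ^ (s + 2 * (i : ℝ)))
          * ((-(w * eigenvalue b n)) ^ i • wave b (A n) n x))
        (∑ i ∈ Finset.range (N + 1),
          expansionTerm (branchCoeff w a s (waveSum b A)) (s + 2 * i) η x) := by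
      refine hasSum_sum fun i _ => ?_
      have h3 := (((rapidFamily_pow hA hw i).summable x).hasSum).mul_left
        ((frobFst a s i + frobSnd a s i * Real.log η) * η ^ (s + 2 * (i : ℝ)))
      have e : expansionTerm (branchCoeff w a s (waveSum b A)) (s + 2 * i) η x
          = ((frobFst a s i + frobSnd a s i * Real.log η) * η ^ (s + 2 * (i : ℝ)))
            * ∑' n, (-(w * eigenvalue b n)) ^ i • wave b (A n) n x := by
        rw [expansionTerm, branchCoeff_zero, branchCoeff_one, lapPow_waveSum hA hw]
        ring
      rw [e]
      exact h3
    rw [← (h1.sub h2).tsum_eq]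
    refine tsum_congr fun n => ?_
    simp only [hr, smul_eq_mul, sub_mul, Finset.sum_mul]
    congr 1
    refine Finset.sum_congr rfl fun i _ => ?_
    ring
  have hpoly : ∀ η ∈ Set.Ioc (0 : ℝ) 1, ∀ n, |r η (w * eigenvalue b n)|
      ≤ C * η ^ (s + 2 * ((N + 1 : ℕ) : ℝ) - 1 / 2) * (1 + eigenvalue b n) ^ (N + 1) := by
    intro η hη n
    have hl := eigenvalue_nonneg (b := b) n
    have h0 := mul_nonneg hw.1 hl
    have h1 := mul_le_of_le_one_left hl hw.2
    refine (hrem _ h0 η hη).trans ?_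
    rw [mul_right_comm]
    have h2 : 0 ≤ η ^ (s + 2 * ((N + 1 : ℕ) : ℝ) - 1 / 2) := Real.rpow_nonneg hη.1.le _
    gcongr
    linarith
  refine IsLittleORpow.of_bound (σ := s + 2 * ((N + 1 : ℕ) : ℝ) - 1 / 2) (by linarith) ?_ ?_
  · intro η hη
    refine ContDiff.sub ?_ (ContDiff.sum fun i _ => contDiff_expansionTerm
      (isSmoothOnTorus_branchCoeff (isSmoothOnTorus_waveSum hA)) _ η)
    exact (hE.coeff_smul (polyBdd_mode ha hs) hw hη).contDiff_tsum
  · intro m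
    obtain ⟨D, hD⟩ := hE.exists_summable_bound m (N + 1)
    refine ⟨C * (D * ∑' n, ((1 + eigenvalue b n) ^ 3)⁻¹), fun η hη x => ?_⟩
    have h2 : 0 ≤ η ^ (s + 2 * ((N + 1 : ℕ) : ℝ) - 1 / 2) := Real.rpow_nonneg hη.1.le _
    have hfam := hE.smul (hpoly η hη)
    rw [key η hη.1, ← (hfam.iteratedFDeriv_tsum m x).tsum_eq]
    have hsum := ((summable_eigenvalue b).hasSum.mul_left D).mul_left
      (C * η ^ (s + 2 * ((N + 1 : ℕ) : ℝ) - 1 / 2))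
    refine (tsum_of_norm_bounded hsum fun n => ?_).trans_eq (by ring)
    rw [iteratedFDeriv_const_smul_apply' (contDiff_infty.1 (hE.smooth n) m).contDiffAt,
      norm_smul, Real.norm_eq_abs]
    calc _ ≤ C * η ^ (s + 2 * ((N + 1 : ℕ) : ℝ) - 1 / 2) * (1 + eigenvalue b n) ^ (N + 1)
            * ‖iteratedFDeriv ℝ m (wave b (A n) n) x‖ := by
          gcongr
          exact hpoly η hη n
      _ = C * η ^ (s + 2 * ((N + 1 : ℕ) : ℝ) - 1 / 2) * ((1 + eigenvalue b n) ^ (N + 1)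
            * ‖iteratedFDeriv ℝ m (wave b (A n) n) x‖) := by ring
      _ ≤ _ := mul_le_mul_of_nonneg_left (hD n x) (mul_nonneg hC h2)

/-- Each branch solves the wave equation. -/
theorem branchSolution_equation (hA : RapidDecay b A) (hw : w ∈ Set.Icc (0 : ℝ) 1) (ha : 0 < a)
    (hs : s = 0 ∨ s = -a) {η : ℝ} (hη : 0 < η) (x : E3) :
    iteratedDeriv 2 (fun s' => branchSolution b w a s A s' x) η
      + (a + 1) * (1 / η) * deriv (fun s' => branchSolution b w a s A s' x) η
      = w * Laplacian.laplacian (branchSolution b w a s A η) x := by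
  have hE := RapidFamily.of_rapidDecay hA
  have hm := polyBdd_mode ha hs
  have hm' := polyBdd_modeDeriv ha hs
  have hinv : PolyBdd fun η _ => -((a + 1) / η) :=
    PolyBdd.of_continuousOn (continuousOn_const.div continuousOn_id
      fun x hx => (Set.mem_Ioi.1 hx).ne').neg
  have hm'' := (hinv.mul hm').add ((PolyBdd.const (-1)).mul (PolyBdd.param.mul hm))
  have d1 : ∀ y, 0 < y → HasDerivAt (fun s' => branchSolution b w a s A s' x)
      (synth b w (modeDeriv a s) (fun n => wave b (A n) n) (y, x)) y := fun y hy =>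
    hasDerivAt_synth hE hm hm' (fun μ _ η hη => hasDerivAt_mode ha hs μ hη) hw hy x
  have d2 := hasDerivAt_synth hE hm' hm'' (fun μ _ η hη => hasDerivAt_modeDeriv ha hs μ hη) hw hη x
  have e1 : deriv (fun s' => branchSolution b w a s A s' x)
      =ᶠ[𝓝 η] fun y => synth b w (modeDeriv a s) (fun n => wave b (A n) n) (y, x) := by
    filter_upwards [isOpen_Ioi.mem_nhds hη] with y hy
    exact (d1 y hy).deriv
  rw [iteratedDeriv_succ, iteratedDeriv_one, e1.deriv_eq, d2.deriv, (d1 η hη).deriv]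
  have h0 := (hE.coeff_smul hm hw hη).laplacian_tsum x
  have h1 := (summable_synth hE hm' hw (p := (η, x)) hη).hasSum
  have h2 := (summable_synth hE hm'' hw (p := (η, x)) hη).hasSum
  refine (h2.add (h1.mul_left ((a + 1) * (1 / η)))).unique
    ((h0.mul_left w).congr_fun fun n => ?_)
  rw [laplacian_smul_wave]
  simp only [smul_eq_mul]
  ring

theorem contDiffOn_branchSolution (hA : RapidDecay b A) (hw : w ∈ Set.Icc (0 : ℝ) 1) (ha : 0 < a)
    (hs : s = 0 ∨ s = -a) :
    ContDiffOn ℝ ∞ (fun p : ℝ × E3 => branchSolution b w a s A p.1 p.2)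
      (Set.Ioi 0 ×ˢ Set.univ) :=
  contDiffOn_synth hw (RapidFamily.of_rapidDecay hA) fun k => (smoothPolyBdd_mode ha hs k).1

lemma branchSolution_periodic (η : ℝ) (i : Fin 3) (x : E3) :
    branchSolution b w a s A η (x + b i) = branchSolution b w a s A η x :=
  tsum_congr fun n => by simp only [wave_periodic]

end Family

/-! ### Fourier analysis of arbitrary solutions -/

section SpaceTime

variable {b : Module.Basis (Fin 3) ℝ E3}

/-- Smooth functions on `(0, ∞) × T³`. -/
structure IsSmoothOnSpaceTime (b : Module.Basis (Fin 3) ℝ E3) (Φ : ℝ → E3 → ℝ) : Prop where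
  smooth : ContDiffOn ℝ ∞ (fun p : ℝ × E3 => Φ p.1 p.2) (Set.Ioi 0 ×ˢ Set.univ)
  periodic : ∀ η : ℝ, 0 < η → ∀ (i : Fin 3) (x : E3), Φ η (x + b i) = Φ η x

/-- The time derivative. -/
def timeDeriv (Φ : ℝ → E3 → ℝ) (η : ℝ) (x : E3) : ℝ := deriv (fun s => Φ s x) η

namespace IsSmoothOnSpaceTime

variable {Φ Φ' : ℝ → E3 → ℝ}

lemma slice (h : IsSmoothOnSpaceTime b Φ) {η : ℝ} (hη : 0 < η) : IsSmoothOnTorus b (Φ η) where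
  smooth := by
    rw [← contDiffOn_univ]
    exact h.smooth.comp (g := fun p : ℝ × E3 => Φ p.1 p.2) (f := fun x => (η, x))
      (contDiff_const.prodMk contDiff_id).contDiffOn fun x _ => ⟨hη, trivial⟩
  periodic := h.periodic η hη

lemma differentiableAt (h : IsSmoothOnSpaceTime b Φ) {η : ℝ} (hη : 0 < η) (x : E3) :
    DifferentiableAt ℝ (fun p : ℝ × E3 => Φ p.1 p.2) (η, x) :=
  (h.smooth.contDiffAt ((isOpen_Ioi.prod isOpen_univ).mem_nhds (x := (η, x)) ⟨hη, trivial⟩)).differentiableAt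
    (by simp)

lemma hasDerivAt_fderiv (h : IsSmoothOnSpaceTime b Φ) {η : ℝ} (hη : 0 < η) (x : E3) :
    HasDerivAt (fun s => Φ s x) (fderiv ℝ (fun p : ℝ × E3 => Φ p.1 p.2) (η, x) (1, 0)) η :=
  HasFDerivAt.comp_hasDerivAt (l := fun p : ℝ × E3 => Φ p.1 p.2) (f := fun s => (s, x)) η
    (h.differentiableAt hη x).hasFDerivAt ((hasDerivAt_id η).prodMk (hasDerivAt_const η x))

lemma hasDerivAt (h : IsSmoothOnSpaceTime b Φ) {η : ℝ} (hη : 0 < η) (x : E3) :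
    HasDerivAt (fun s => Φ s x) (timeDeriv Φ η x) η :=
  (h.hasDerivAt_fderiv hη x).differentiableAt.hasDerivAt

lemma timeDeriv (h : IsSmoothOnSpaceTime b Φ) : IsSmoothOnSpaceTime b (timeDeriv Φ) where
  smooth := by
    refine ContDiffOn.congr (f := fun p => fderiv ℝ (fun p : ℝ × E3 => Φ p.1 p.2) p (1, 0)) ?_
      fun p hp => (h.hasDerivAt_fderiv hp.1 p.2).deriv
    exact (h.smooth.fderiv_of_isOpen (isOpen_Ioi.prod isOpen_univ) (by simp)).clm_apply
      contDiffOn_const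
  periodic η hη i x := by
    refine Filter.EventuallyEq.deriv_eq ?_
    filter_upwards [isOpen_Ioi.mem_nhds hη] with s hs
    exact h.periodic s hs i x

lemma hasDerivAt_torusCoeff (h : IsSmoothOnSpaceTime b Φ) {η : ℝ} (hη : 0 < η) (n : Fin 3 → ℤ) :
    HasDerivAt (fun η => torusCoeff b (Φ η) n) (torusCoeff b (_root_.timeDeriv Φ η) n) η :=
  _root_.hasDerivAt_torusCoeff isOpen_Ioi (fun _ hs => (h.slice hs).isPeriodic)
    (fun _ hs => (h.timeDeriv.slice hs).isPeriodic) (fun _ hs => (h.slice hs).smooth.continuous)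
    h.timeDeriv.smooth.continuousOn (fun _ hs x => h.hasDerivAt hs x) n hη

lemma add_const_mul (h : IsSmoothOnSpaceTime b Φ) (h' : IsSmoothOnSpaceTime b Φ') (c : ℝ) :
    IsSmoothOnSpaceTime b (fun η x => Φ η x + c * Φ' η x) where
  smooth := h.smooth.add (contDiffOn_const.mul h'.smooth)
  periodic η hη i x := by rw [h.periodic η hη, h'.periodic η hη]

end IsSmoothOnSpaceTime

lemma two_nuExp_add_one {w : ℝ} (hw : w ∈ Set.Icc (0 : ℝ) 1) :
    6 * (1 + w) / (1 + 3 * w) = 2 * nuExp w + 1 := by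
  have : 1 + 3 * w ≠ 0 := by linarith [hw.1]
  have e : 2 * nuExp w = (5 + 3 * w) / (1 + 3 * w) := by rw [nuExp]; ring
  rw [e, div_add_one this]
  ring

lemma nuExp_pos {w : ℝ} (hw : w ∈ Set.Icc (0 : ℝ) 1) : 0 < 2 * nuExp w := by
  have h1 : 0 < 1 + 3 * w := by linarith [hw.1]
  have h2 : 0 < 5 + 3 * w := by linarith [hw.1]
  rw [nuExp]
  positivity

/-! ### Arbitrary solutions as combinations of the two modes -/

namespace IsSmoothSolution

variable {w : ℝ} {Φ Φ' : ℝ → E3 → ℝ}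

lemma isSmoothOnSpaceTime (h : IsSmoothSolution b w Φ) : IsSmoothOnSpaceTime b Φ :=
  ⟨h.smooth, h.periodic⟩

lemma timeDeriv_timeDeriv (h : IsSmoothSolution b w Φ) (hw : w ∈ Set.Icc (0 : ℝ) 1) {η : ℝ}
    (hη : 0 < η) (x : E3) : timeDeriv (timeDeriv Φ) η x
      = -((2 * nuExp w + 1) / η) * timeDeriv Φ η x + w * Laplacian.laplacian (Φ η) x := by
  have h1 := h.equation η hη x
  rw [iteratedDeriv_succ, iteratedDeriv_one, two_nuExp_add_one hw] at h1
  change timeDeriv (timeDeriv Φ) η x + (2 * nuExp w + 1) * (1 / η) * timeDeriv Φ η x = _ at h1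
  linear_combination h1

lemma add_const_mul (h : IsSmoothSolution b w Φ) (h' : IsSmoothSolution b w Φ') (c : ℝ) :
    IsSmoothSolution b w (fun η x => Φ η x + c * Φ' η x) where
  smooth := (h.isSmoothOnSpaceTime.add_const_mul h'.isSmoothOnSpaceTime c).smooth
  periodic := (h.isSmoothOnSpaceTime.add_const_mul h'.isSmoothOnSpaceTime c).periodic
  equation η hη x := by
    have hs := h.isSmoothOnSpaceTime
    have hs' := h'.isSmoothOnSpaceTime
    have d1 : ∀ y, 0 < y → deriv (fun s => Φ s x + c * Φ' s x) y
        = timeDeriv Φ y x + c * timeDeriv Φ' y x := fun y hy =>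
      ((hs.hasDerivAt hy x).add ((hs'.hasDerivAt hy x).const_mul c)).deriv
    have e1 : deriv (fun s => Φ s x + c * Φ' s x)
        =ᶠ[𝓝 η] fun y => timeDeriv Φ y x + c * timeDeriv Φ' y x := by
      filter_upwards [isOpen_Ioi.mem_nhds hη] with y hy
      exact d1 y hy
    have d2 : deriv (fun y => timeDeriv Φ y x + c * timeDeriv Φ' y x) η
        = timeDeriv (timeDeriv Φ) η x + c * timeDeriv (timeDeriv Φ') η x :=
      ((hs.timeDeriv.hasDerivAt hη x).add ((hs'.timeDeriv.hasDerivAt hη x).const_mul c)).deriv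
    have c1 := (contDiff_infty.1 (hs.slice hη).smooth 2).contDiffAt (x := x)
    have c2 := (contDiff_infty.1 (hs'.slice hη).smooth 2).contDiffAt (x := x)
    have e2 : Laplacian.laplacian (fun x => Φ η x + c * Φ' η x) x
        = Laplacian.laplacian (Φ η) x + c * Laplacian.laplacian (Φ' η) x := by
      have h1 := ContDiffAt.laplacian_add c1 (c2.const_smul c)
      change _ = _ + Laplacian.laplacian (c • Φ' η) x at h1
      rw [InnerProductSpace.laplacian_smul c c2] at h1
      exact h1
    rw [iteratedDeriv_succ, iteratedDeriv_one, e1.deriv_eq, d2, d1 η hη, e2]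
    have h1 := h.equation η hη x
    have h2 := h'.equation η hη x
    rw [iteratedDeriv_succ, iteratedDeriv_one] at h1 h2
    change timeDeriv (timeDeriv Φ) η x + _ * timeDeriv Φ η x = _ at h1
    change timeDeriv (timeDeriv Φ') η x + _ * timeDeriv Φ' η x = _ at h2
    linear_combination h1 + c * h2

/-- The amplitude of the singular mode. -/
def singularAmp (b : Module.Basis (Fin 3) ℝ E3) (w : ℝ) (Φ : ℝ → E3 → ℝ) (n : Fin 3 → ℤ) : ℂ :=
  ((2 * nuExp w)⁻¹ * modeDeriv (2 * nuExp w) 0 1 (w * eigenvalue b n) : ℝ)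
      * torusCoeff b (Φ 1) n
    - ((2 * nuExp w)⁻¹ * mode (2 * nuExp w) 0 1 (w * eigenvalue b n) : ℝ)
      * torusCoeff b (timeDeriv Φ 1) n

/-- The amplitude of the regular mode. -/
def regularAmp (b : Module.Basis (Fin 3) ℝ E3) (w : ℝ) (Φ : ℝ → E3 → ℝ) (n : Fin 3 → ℤ) : ℂ :=
  ((2 * nuExp w)⁻¹ * mode (2 * nuExp w) (-(2 * nuExp w)) 1 (w * eigenvalue b n) : ℝ)
      * torusCoeff b (timeDeriv Φ 1) n
    - ((2 * nuExp w)⁻¹ * modeDeriv (2 * nuExp w) (-(2 * nuExp w)) 1 (w * eigenvalue b n) : ℝ)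
      * torusCoeff b (Φ 1) n

lemma torusCoeff_ode (h : IsSmoothSolution b w Φ) (hw : w ∈ Set.Icc (0 : ℝ) 1) {η : ℝ}
    (hη : 0 < η) (n : Fin 3 → ℤ) :
    HasDerivAt (fun η => torusCoeff b (timeDeriv Φ η) n)
      (-((2 * nuExp w + 1) / η) • torusCoeff b (timeDeriv Φ η) n
        - (w * eigenvalue b n) • torusCoeff b (Φ η) n) η := by
  have hs := h.isSmoothOnSpaceTime
  refine (hs.timeDeriv.hasDerivAt_torusCoeff hη n).congr_deriv ?_
  rw [show timeDeriv (timeDeriv Φ) η = fun x => -((2 * nuExp w + 1) / η) * timeDeriv Φ η x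
    + w * Laplacian.laplacian (Φ η) x from funext fun x => h.timeDeriv_timeDeriv hw hη x]
  have h1 := hs.slice hη
  have h2 := hs.timeDeriv.slice hη
  have h0 : IsSmoothOnTorus b fun _ => (0 : ℝ) := ⟨contDiff_const, fun _ _ => rfl⟩
  have e0 : torusCoeff b (fun _ => (0 : ℝ)) n = 0 := by
    simpa using norm_torusCoeff_le (b := b) (f := fun _ => 0) (C := 0) (by simp) n
  have e1 := h0.torusCoeff_add_const_mul h2 (-((2 * nuExp w + 1) / η)) n
  simp only [zero_add, e0] at e1
  rw [(h2.const_mul _).torusCoeff_add_const_mul h1.laplacian, e1, h1.torusCoeff_laplacian]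
  simp only [Complex.real_smul]
  push_cast
  ring

/-- Cramer's rule: the Wronskians of the Fourier coefficient with the two modes are constant and may
be evaluated at η = 1, and the Wronskian of the modes is a ≠ 0. -/
lemma torusCoeff_eq (h : IsSmoothSolution b w Φ) (hw : w ∈ Set.Icc (0 : ℝ) 1) {η : ℝ}
    (hη : 0 < η) (n : Fin 3 → ℤ) : torusCoeff b (Φ η) n
      = (mode (2 * nuExp w) (-(2 * nuExp w)) η (w * eigenvalue b n) : ℂ) * singularAmp b w Φ n
        + (mode (2 * nuExp w) 0 η (w * eigenvalue b n) : ℂ) * regularAmp b w Φ n := by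
  have ha := nuExp_pos hw
  unfold singularAmp regularAmp
  set a := 2 * nuExp w
  set μ := w * eigenvalue b n
  set φ := fun η => torusCoeff b (Φ η) n
  set φ' := fun η => torusCoeff b (timeDeriv Φ η) n
  have hφ : ∀ y, 0 < y → HasDerivAt φ (φ' y) y := fun y hy =>
    h.isSmoothOnSpaceTime.hasDerivAt_torusCoeff hy n
  have hφ' : ∀ y, 0 < y → HasDerivAt φ' (-((a + 1) / y) • φ' y - μ • φ y) y := fun y hy =>
    h.torusCoeff_ode hw hy n
  have hu : ∀ s, s = 0 ∨ s = -a → ∀ y, 0 < y →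
      HasDerivAt (fun y => (mode a s y μ : ℂ)) (modeDeriv a s y μ : ℂ) y := fun s hs y hy =>
    (hasDerivAt_mode ha hs μ hy).ofReal_comp
  have hu' : ∀ s, s = 0 ∨ s = -a → ∀ y, 0 < y →
      HasDerivAt (fun y => (modeDeriv a s y μ : ℂ))
        (-((a + 1) / y) • (modeDeriv a s y μ : ℂ) - μ • (mode a s y μ : ℂ)) y :=
    fun s hs y hy => by
      refine (hasDerivAt_modeDeriv ha hs μ hy).ofReal_comp.congr_deriv ?_
      simp only [Complex.real_smul]
      push_cast
      ring
  have w1 := eq_of_hasDerivAt_zero (fun y hy => hasDerivAt_wronskian hy (hφ y hy)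
    (hu 0 (Or.inl rfl) y hy) (hφ' y hy) (hu' 0 (Or.inl rfl) y hy)) hη one_pos
  have w2 := eq_of_hasDerivAt_zero (fun y hy => hasDerivAt_wronskian hy (hu (-a) (Or.inr rfl) y hy)
    (hφ y hy) (hu' (-a) (Or.inr rfl) y hy) (hφ' y hy)) hη one_pos
  have w0 : ((η ^ (a + 1) : ℝ) : ℂ) * ((mode a (-a) η μ : ℂ) * (modeDeriv a 0 η μ : ℂ)
      - (modeDeriv a (-a) η μ : ℂ) * (mode a 0 η μ : ℂ)) = a := by
    exact_mod_cast wronskian_mode ha μ hη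
  simp only [Complex.real_smul, Real.one_rpow, Complex.ofReal_one, one_mul] at w1 w2
  have hane : (a : ℂ) ≠ 0 := by exact_mod_cast ha.ne'
  change φ η = _ * (_ * φ 1 - _ * φ' 1) + _ * (_ * φ' 1 - _ * φ 1)
  -- The identity φ W(u₋, u₀) = u₋ W(φ, u₀) + u₀ W(u₋, φ), with each Wronskian replaced by its
  -- constant value.
  have key : (a : ℂ) * φ η = (mode a (-a) η μ : ℂ) * (φ 1 * (modeDeriv a 0 1 μ : ℂ)
        - φ' 1 * (mode a 0 1 μ : ℂ)) + (mode a 0 η μ : ℂ) * ((mode a (-a) 1 μ : ℂ) * φ' 1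
        - (modeDeriv a (-a) 1 μ : ℂ) * φ 1) := by
    rw [← w1, ← w2, ← w0]
    ring
  refine mul_left_cancel₀ hane ?_
  rw [key]
  push_cast
  field_simp

end IsSmoothSolution

lemma RapidDecay.real_mul {A : (Fin 3 → ℤ) → ℂ} (hA : RapidDecay b A) {c : (Fin 3 → ℤ) → ℝ}
    {C : ℝ} (hC : 0 ≤ C) {K : ℕ} (hc : ∀ n, |c n| ≤ C * (1 + eigenvalue b n) ^ K) :
    RapidDecay b fun n => (c n : ℂ) * A n := by
  intro M
  obtain ⟨D, hD⟩ := hA (K + M)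
  refine ⟨C * D, fun n => ?_⟩
  have hl := eigenvalue_nonneg (b := b) n
  rw [norm_mul, Complex.norm_real, Real.norm_eq_abs]
  calc _ ≤ C * (1 + eigenvalue b n) ^ K * ‖A n‖ * (1 + eigenvalue b n) ^ M := by
        gcongr
        exact hc n
    _ = C * (‖A n‖ * (1 + eigenvalue b n) ^ (K + M)) := by ring
    _ ≤ _ := mul_le_mul_of_nonneg_left (hD n) hC

lemma RapidDecay.sub {A B : (Fin 3 → ℤ) → ℂ} (hA : RapidDecay b A) (hB : RapidDecay b B) :
    RapidDecay b fun n => A n - B n := by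
  intro M
  obtain ⟨C, hC⟩ := hA M
  obtain ⟨D, hD⟩ := hB M
  refine ⟨C + D, fun n => ?_⟩
  have hl := eigenvalue_nonneg (b := b) n
  calc _ ≤ (‖A n‖ + ‖B n‖) * (1 + eigenvalue b n) ^ M := by
        gcongr
        exact norm_sub_le _ _
    _ = ‖A n‖ * (1 + eigenvalue b n) ^ M + ‖B n‖ * (1 + eigenvalue b n) ^ M := by ring
    _ ≤ _ := add_le_add (hC n) (hD n)

lemma RapidDecay.polyBdd_mul {A : (Fin 3 → ℤ) → ℂ} (hA : RapidDecay b A) {g : ℝ → ℝ → ℝ}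
    (hg : PolyBdd g) {w : ℝ} (hw : w ∈ Set.Icc (0 : ℝ) 1) (c : ℝ) :
    RapidDecay b fun n => ((c * g 1 (w * eigenvalue b n) : ℝ) : ℂ) * A n := by
  obtain ⟨C, hC, K, hK⟩ := ((PolyBdd.const c).mul hg).eigenvalue_bound (b := b) hw (T := 1) one_pos
  exact hA.real_mul hC fun n => hK n 1 ⟨le_rfl, le_rfl⟩

namespace IsSmoothSolution

variable {w : ℝ} {Φ : ℝ → E3 → ℝ}

/-- The modes at η = 1 grow at most polynomially in the eigenvalue, so they do not spoil the rapid
decay of the coefficients of Φ and its time derivative. -/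
lemma rapidDecay_singularAmp (h : IsSmoothSolution b w Φ) (hw : w ∈ Set.Icc (0 : ℝ) 1) :
    RapidDecay b (singularAmp b w Φ) := by
  have ha := nuExp_pos hw
  have hs := h.isSmoothOnSpaceTime
  exact ((hs.slice one_pos).rapidDecay.polyBdd_mul (polyBdd_modeDeriv ha (Or.inl rfl)) hw _).sub
    ((hs.timeDeriv.slice one_pos).rapidDecay.polyBdd_mul (polyBdd_mode ha (Or.inl rfl)) hw _)

lemma rapidDecay_regularAmp (h : IsSmoothSolution b w Φ) (hw : w ∈ Set.Icc (0 : ℝ) 1) :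
    RapidDecay b (regularAmp b w Φ) := by
  have ha := nuExp_pos hw
  have hs := h.isSmoothOnSpaceTime
  exact ((hs.timeDeriv.slice one_pos).rapidDecay.polyBdd_mul (polyBdd_mode ha (Or.inr rfl)) hw _).sub
    ((hs.slice one_pos).rapidDecay.polyBdd_mul (polyBdd_modeDeriv ha (Or.inr rfl)) hw _)

/-- Every solution is the superposition of its singular and its regular branch. -/
theorem eq_branchSolution (h : IsSmoothSolution b w Φ) (hw : w ∈ Set.Icc (0 : ℝ) 1) {η : ℝ}
    (hη : 0 < η) (x : E3) :
    Φ η x = branchSolution b w (2 * nuExp w) (-(2 * nuExp w)) (singularAmp b w Φ) η x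
      + branchSolution b w (2 * nuExp w) 0 (regularAmp b w Φ) η x := by
  have ha := nuExp_pos hw
  have h1 := Complex.reCLM.hasSum ((h.isSmoothOnSpaceTime.slice hη).hasSum x)
  have h2 := (summable_synth (RapidFamily.of_rapidDecay (h.rapidDecay_singularAmp hw))
    (polyBdd_mode ha (Or.inr rfl)) hw (p := (η, x)) hη).hasSum
  have h3 := (summable_synth (RapidFamily.of_rapidDecay (h.rapidDecay_regularAmp hw))
    (polyBdd_mode ha (Or.inl rfl)) hw (p := (η, x)) hη).hasSum
  refine h1.unique ((h2.add h3).congr_fun fun n => ?_)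
  simp only [Complex.reCLM_apply, h.torusCoeff_eq hw hη n, wave, smul_eq_mul,
    add_mul, Complex.add_re, mul_assoc, Complex.re_ofReal_mul]

/-- A solution that tends to zero uniformly as `η → 0` vanishes. -/
theorem eq_zero_of_isLittleORpow (h : IsSmoothSolution b w Φ) (hw : w ∈ Set.Icc (0 : ℝ) 1)
    (h0 : IsLittleORpow Φ 0) {η : ℝ} (hη : 0 < η) (x : E3) : Φ η x = 0 := by
  have ha := nuExp_pos hw
  have hφ : ∀ n, torusCoeff b (Φ η) n = 0 := fun n => by
    have hlim : Filter.Tendsto (fun η => torusCoeff b (Φ η) n) (𝓝[>] 0) (𝓝 0) := by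
      rw [Metric.tendsto_nhds]
      intro ε hε
      filter_upwards [h0.bound 0 (ε / 2) (by linarith)] with η h1
      rw [dist_zero_right]
      have h2 : ∀ x, |Φ η x| ≤ ε / 2 := fun x => by simpa using h1 x
      linarith [norm_torusCoeff_le (b := b) h2 n]
    have e : (fun η => torusCoeff b (Φ η) n) =ᶠ[𝓝[>] 0] fun η =>
        (mode (2 * nuExp w) (-(2 * nuExp w)) η (w * eigenvalue b n) : ℂ) * singularAmp b w Φ n
        + (mode (2 * nuExp w) 0 η (w * eigenvalue b n) : ℂ) * regularAmp b w Φ n := by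
      filter_upwards [self_mem_nhdsWithin] with η hη
      exact h.torusCoeff_eq hw hη n
    rw [h.torusCoeff_eq hw hη n]
    replace hlim := hlim.congr' e
    set A := singularAmp b w Φ n
    set B := regularAmp b w Φ n
    set μ := w * eigenvalue b n
    set a := 2 * nuExp w
    have hu0 : Filter.Tendsto (fun η => (mode a 0 η μ : ℂ)) (𝓝[>] 0) (𝓝 1) := by
      have := (Complex.continuous_ofReal.tendsto _).comp
        (tendsto_mode_leading ha (Or.inl rfl : (0 : ℝ) = 0 ∨ (0 : ℝ) = -a) μ)
      simpa [Function.comp_def] using this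
    have hu1 : Filter.Tendsto (fun η => ((η ^ a * mode a (-a) η μ : ℝ) : ℂ)) (𝓝[>] 0) (𝓝 1) := by
      have := (Complex.continuous_ofReal.tendsto _).comp
        (tendsto_mode_leading ha (Or.inr rfl : (-a) = 0 ∨ (-a) = -a) μ)
      simpa [Function.comp_def] using this
    have hr : Filter.Tendsto (fun η : ℝ => ((η ^ a : ℝ) : ℂ)) (𝓝[>] 0) (𝓝 0) := by
      have := (Complex.continuous_ofReal.tendsto _).comp (tendsto_rpow_nhdsGT_zero ha)
      simpa [Function.comp_def] using this
    -- Multiplication by η ^ a leaves A in the limit and removes the regular mode; afterwards the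
    -- limit of the regular mode gives B.
    have hA : A = 0 := by
      have t1 := (hu1.mul_const A).add ((hr.mul hu0).mul_const B)
      have t2 := hr.mul hlim
      simp only [one_mul, zero_mul, mul_zero, add_zero] at t1 t2
      refine tendsto_nhds_unique (t1.congr fun η => ?_) t2
      push_cast
      ring
    rw [hA] at hlim
    have hB : B = 0 := by
      simp only [mul_zero, zero_add] at hlim
      have t1 := hu0.mul_const B
      rw [one_mul] at t1
      exact tendsto_nhds_unique t1 hlim
    rw [hA, hB, mul_zero, mul_zero, add_zero]
  have h1 := (h.isSmoothOnSpaceTime.slice hη).hasSum x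
  simp only [hφ, zero_mul] at h1
  exact_mod_cast h1.unique hasSum_zero

end IsSmoothSolution

end SpaceTime

/-! ### The solution with given data at `η = 0` -/

section Main

variable {b : Module.Basis (Fin 3) ℝ E3} {w : ℝ} {A B : (Fin 3 → ℤ) → ℂ}

/-- The increasing sequence of exponents, which starts at `-a` and contains all `-a + 2 * i` and
all `2 * i`. -/
def exponentSeq (a r : ℝ) (n : ℕ) : ℝ :=
  -a + 2 * ((n / 2 : ℕ) : ℝ) + if n % 2 = 1 then r else 0

/-- There is an increasing sequence, bounded below by its first term `-a` and tending to infinity,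
that contains all exponents of the two branches. -/
lemma exists_exponentSeq {a : ℝ} (ha : 0 < a) : ∃ κ : ℕ → ℝ, StrictMono κ ∧
    Filter.Tendsto κ Filter.atTop Filter.atTop ∧ (∀ n, -a ≤ κ n) ∧
    ∀ i : ℕ, -a + 2 * (i : ℝ) ∈ Set.range κ ∧ (2 * (i : ℝ)) ∈ Set.range κ := by
  set m := ⌊a / 2⌋₊
  have hm1 : (m : ℝ) ≤ a / 2 := Nat.floor_le (by positivity)
  have hm2 : a / 2 < m + 1 := Nat.lt_floor_add_one _
  -- r is the offset of the exponents 2i from the exponents -a + 2i. If a is an even integer the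
  -- families overlap and any value in (0, 2) serves; the additional exponents then have zero
  -- coefficients.
  obtain ⟨r, hr0, hr2, hr⟩ : ∃ r : ℝ, 0 < r ∧ r < 2 ∧ (a = 2 * m ∨ a = 2 * m + r) := by
    rcases hm1.eq_or_lt with h | h
    · exact ⟨1, one_pos, by norm_num, Or.inl (by linarith)⟩
    · exact ⟨a - 2 * m, by linarith, by linarith, Or.inr (by ring)⟩
  have heven : ∀ i : ℕ, exponentSeq a r (2 * i) = -a + 2 * i := fun i => by
    simp [exponentSeq]
  have hodd : ∀ i : ℕ, exponentSeq a r (2 * i + 1) = -a + 2 * i + r := fun i => by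
    have h1 : (2 * i + 1) / 2 = i := by omega
    have h2 : (2 * i + 1) % 2 = 1 := by omega
    simp [exponentSeq, h1, h2]
  have hmono : StrictMono (exponentSeq a r) := strictMono_nat_of_lt_succ fun n => by
    obtain ⟨i, rfl | rfl⟩ := n.even_or_odd'
    · rw [heven, hodd]; linarith
    · rw [hodd, show 2 * i + 1 + 1 = 2 * (i + 1) by ring, heven]
      push_cast
      linarith
  have hlow : ∀ n : ℕ, -a + (n - 1) ≤ exponentSeq a r n := fun n => by
    obtain ⟨i, rfl | rfl⟩ := n.even_or_odd'
    · rw [heven]; push_cast; linarith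
    · rw [hodd]; push_cast; linarith
  refine ⟨exponentSeq a r, hmono, ?_, fun n => ?_, fun i => ⟨⟨2 * i, heven i⟩, ?_⟩⟩
  · refine Filter.tendsto_atTop_mono hlow ?_
    exact Filter.tendsto_atTop_add_const_left _ _
      (Filter.tendsto_atTop_add_const_right _ (-1) tendsto_natCast_atTop_atTop)
  · refine le_trans (le_of_eq ?_) (hmono.monotone (Nat.zero_le n))
    simpa using (heven 0).symm
  · rcases hr with h | h
    · exact ⟨2 * (i + m), by rw [heven]; push_cast; linarith⟩
    · exact ⟨2 * (i + m) + 1, by rw [hodd]; push_cast; linarith⟩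

/-- The solution with amplitudes `A` of the singular and `B` of the regular modes. -/
def fullSolution (b : Module.Basis (Fin 3) ℝ E3) (w : ℝ) (A B : (Fin 3 → ℤ) → ℂ)
    (η : ℝ) (x : E3) : ℝ :=
  branchSolution b w (2 * nuExp w) (-(2 * nuExp w)) A η x
    + branchSolution b w (2 * nuExp w) 0 B η x

/-- The coefficients of the expansion with given data. -/
def fullCoeff (w : ℝ) (f g : E3 → ℝ) (k : ℝ) (l : Fin 2) (x : E3) : ℝ :=
  branchCoeff w (2 * nuExp w) (-(2 * nuExp w)) f k l x + branchCoeff w (2 * nuExp w) 0 g k l x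

lemma isSmoothSolution_branch (hA : RapidDecay b A) (hw : w ∈ Set.Icc (0 : ℝ) 1) {s : ℝ}
    (hs : s = 0 ∨ s = -(2 * nuExp w)) :
    IsSmoothSolution b w (branchSolution b w (2 * nuExp w) s A) where
  smooth := contDiffOn_branchSolution hA hw (nuExp_pos hw) hs
  periodic η _ i x := branchSolution_periodic η i x
  equation η hη x := by
    rw [two_nuExp_add_one hw]
    exact branchSolution_equation hA hw (nuExp_pos hw) hs hη x

lemma isSmoothSolution_full (hA : RapidDecay b A) (hB : RapidDecay b B)
    (hw : w ∈ Set.Icc (0 : ℝ) 1) : IsSmoothSolution b w (fullSolution b w A B) := by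
  have h := (isSmoothSolution_branch hA hw (Or.inr rfl)).add_const_mul
    (isSmoothSolution_branch hB hw (Or.inl rfl)) 1
  simp only [one_mul] at h
  exact h

lemma isSmoothOnTorus_fullCoeff {f g : E3 → ℝ} (hf : IsSmoothOnTorus b f)
    (hg : IsSmoothOnTorus b g) (k : ℝ) (l : Fin 2) : IsSmoothOnTorus b (fullCoeff w f g k l) :=
  (isSmoothOnTorus_branchCoeff hf k l).add (isSmoothOnTorus_branchCoeff hg k l)

lemma hasExpansion_full (hA : RapidDecay b A) (hB : RapidDecay b B)
    (hw : w ∈ Set.Icc (0 : ℝ) 1) :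
    HasExpansion (fullSolution b w A B) (fullCoeff w (waveSum b A) (waveSum b B)) :=
  (hasExpansion_branch hA hw (nuExp_pos hw) (Or.inr rfl)).add
    (hasExpansion_branch hB hw (nuExp_pos hw) (Or.inl rfl))
    (isSmoothOnTorus_branchCoeff (isSmoothOnTorus_waveSum hA))
    (isSmoothOnTorus_branchCoeff (isSmoothOnTorus_waveSum hB))

lemma fullCoeff_singular (hw : w ∈ Set.Icc (0 : ℝ) 1) (f g : E3 → ℝ) :
    fullCoeff w f g (-2 * nuExp w) 0 = f := by
  have ha := nuExp_pos hw
  funext x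
  have h1 := branchCoeff_zero (w := w) (a := 2 * nuExp w) (s := -(2 * nuExp w)) f 0 x
  have h2 : branchCoeff w (2 * nuExp w) 0 g (-2 * nuExp w) = 0 := branchCoeff_of_ne g fun i hi => by
    have : (0 : ℝ) ≤ i := i.cast_nonneg
    linarith
  rw [show -(2 * nuExp w) + 2 * ((0 : ℕ) : ℝ) = -2 * nuExp w by push_cast; ring] at h1
  rw [fullCoeff, h1, h2]
  simp [frobFst, frobCoeff, lapPow]

/-- The singular branch reaches the exponent 0 only in the resonant case, where its coefficient was
chosen to be zero. -/
lemma fullCoeff_regular (hw : w ∈ Set.Icc (0 : ℝ) 1) (f g : E3 → ℝ) :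
    fullCoeff w f g 0 0 = g := by
  have ha := nuExp_pos hw
  funext x
  have h1 := branchCoeff_zero (w := w) (a := 2 * nuExp w) (s := 0) g 0 x
  rw [show (0 : ℝ) + 2 * ((0 : ℕ) : ℝ) = 0 by simp] at h1
  have h2 : branchCoeff w (2 * nuExp w) (-(2 * nuExp w)) f 0 0 x = 0 := by
    by_cases h : ∃ i : ℕ, (0 : ℝ) = -(2 * nuExp w) + 2 * i
    · obtain ⟨i, hi⟩ := h
      have e := branchCoeff_zero (w := w) (a := 2 * nuExp w) (s := -(2 * nuExp w)) f i x
      rw [← hi] at e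
      rcases i with _ | i
      · push_cast at hi; linarith
      · rw [e, frobFst, frobCoeff_succ_of_resonant rfl (by linarith), zero_mul]
    · push Not at h
      rw [branchCoeff_of_ne f h]
      rfl
  rw [fullCoeff, h1, h2]
  simp [frobFst, frobCoeff, lapPow]

lemma isFormalSolution_full (hw : w ∈ Set.Icc (0 : ℝ) 1) {f g : E3 → ℝ}
    (hf : IsSmoothOnTorus b f) (hg : IsSmoothOnTorus b g) :
    IsFormalSolution w (fullCoeff w f g) := by
  have ha := nuExp_pos hw
  have hlap : ∀ k l x, Laplacian.laplacian (fullCoeff w f g k l) x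
      = Laplacian.laplacian (branchCoeff w (2 * nuExp w) (-(2 * nuExp w)) f k l) x
        + Laplacian.laplacian (branchCoeff w (2 * nuExp w) 0 g k l) x := fun k l x =>
    ContDiffAt.laplacian_add
      (contDiff_infty.1 (isSmoothOnTorus_branchCoeff hf k l).smooth 2).contDiffAt
      (contDiff_infty.1 (isSmoothOnTorus_branchCoeff hg k l).smooth 2).contDiffAt
  refine ⟨fun k hk => ?_, fun k hk => ?_, fun k x => ?_, fun k x => ?_⟩
  · by_contra hn
    push Not at hn
    have h1 : branchCoeff w (2 * nuExp w) (-(2 * nuExp w)) f k = 0 :=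
      branchCoeff_of_ne f fun i hi => (hn i).1 (by linarith)
    have h2 : branchCoeff w (2 * nuExp w) 0 g k = 0 :=
      branchCoeff_of_ne g fun i hi => (hn i).2 (by linarith)
    exact hk (funext fun x => by simp [fullCoeff, h1, h2])
  · by_contra hn
    push Not at hn
    have h2 : branchCoeff w (2 * nuExp w) 0 g k = 0 :=
      branchCoeff_of_ne g fun i hi => hn i (by linarith)
    have h1 : branchCoeff w (2 * nuExp w) (-(2 * nuExp w)) f k 1 = 0 := by
      by_cases h : ∃ i : ℕ, k = -(2 * nuExp w) + 2 * i
      · obtain ⟨i, rfl⟩ := h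
        funext x
        rw [branchCoeff_one]
        -- A logarithm requires a = 2m with m ≤ i, and then the exponent -a + 2i is the excluded
        -- even number 2(i - m).
        have : frobSnd (2 * nuExp w) (-(2 * nuExp w)) i = 0 := by
          by_contra h0
          obtain ⟨m, -, hmi, -, hm⟩ := frobCoeff_log_ne_zero ha (Or.inr rfl) i h0
          refine hn (i - m) ?_
          rw [Nat.cast_sub hmi]
          linarith
        rw [this, zero_mul]
        rfl
      · push Not at h
        rw [branchCoeff_of_ne f h]
        rfl
    exact hk (funext fun x => by simp [fullCoeff, h1, h2])
  · have h1 := (branchCoeff_recursion (w := w) ha (Or.inr rfl) hf k x).1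
    have h2 := (branchCoeff_recursion (w := w) ha (Or.inl rfl) hg k x).1
    rw [hlap]
    simp only [fullCoeff]
    linear_combination h1 + h2
  · have h1 := (branchCoeff_recursion (w := w) ha (Or.inr rfl) hf k x).2
    have h2 := (branchCoeff_recursion (w := w) ha (Or.inl rfl) hg k x).2
    rw [hlap]
    simp only [fullCoeff]
    linear_combination h1 + h2

lemma HasExpansion.congr {Φ Φ' : ℝ → E3 → ℝ} {c : ℝ → Fin 2 → E3 → ℝ} (h : HasExpansion Φ c)
    (he : ∀ η, 0 < η → Φ' η = Φ η) : HasExpansion Φ' c := by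
  intro K
  obtain ⟨H, hH, ho⟩ := h K
  refine ⟨H, hH, fun η hη => ?_, fun m ε hε => ?_⟩
  · rw [he η hη]
    exact ho.smooth η hη
  · filter_upwards [ho.bound m ε hε, self_mem_nhdsWithin] with η h1 hη
    rw [he η hη]
    exact h1

lemma isSingularExpansion_full {Φ : ℝ → E3 → ℝ} (hw : w ∈ Set.Icc (0 : ℝ) 1) {f g : E3 → ℝ}
    (hf : IsSmoothOnTorus b f) (hg : IsSmoothOnTorus b g)
    (h : HasExpansion Φ (fullCoeff w f g)) : IsSingularExpansion b w Φ (fullCoeff w f g) := by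
  obtain ⟨κ, hmono, htop, hlow, hrange⟩ := exists_exponentSeq (nuExp_pos hw)
  refine h.isSingularExpansion (isSmoothOnTorus_fullCoeff hf hg) hmono htop
    (fun n => by linarith [hlow n]) fun k hk => ?_
  by_contra hn
  have h1 : branchCoeff w (2 * nuExp w) (-(2 * nuExp w)) f k = 0 :=
    branchCoeff_of_ne f fun i hi => hn (hi ▸ (hrange i).1)
  have h2 : branchCoeff w (2 * nuExp w) 0 g k = 0 :=
    branchCoeff_of_ne g fun i hi => hn (by rw [hi, zero_add]; exact (hrange i).2)
  exact hk (funext fun l => funext fun x => by simp [fullCoeff, h1, h2])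

/-- Every solution has an expansion of the expected form. -/
lemma IsSmoothSolution.hasExpansion {Φ : ℝ → E3 → ℝ} (h : IsSmoothSolution b w Φ)
    (hw : w ∈ Set.Icc (0 : ℝ) 1) : HasExpansion Φ (fullCoeff w
      (waveSum b (IsSmoothSolution.singularAmp b w Φ))
      (waveSum b (IsSmoothSolution.regularAmp b w Φ))) :=
  (hasExpansion_full (h.rapidDecay_singularAmp hw) (h.rapidDecay_regularAmp hw) hw).congr
    fun _ hη => funext fun x => h.eq_branchSolution hw hη x

/-- The data of a solution are determined by it. -/
lemma IsSmoothSolution.data_eq {Φ : ℝ → E3 → ℝ} (h : IsSmoothSolution b w Φ)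
    (hw : w ∈ Set.Icc (0 : ℝ) 1) {Ψ₁ Ψ₂ : E3 → ℝ} (hd : HasSingularData b w Φ Ψ₁ Ψ₂) :
    Ψ₁ = waveSum b (IsSmoothSolution.singularAmp b w Φ) ∧
      Ψ₂ = waveSum b (IsSmoothSolution.regularAmp b w Φ) := by
  obtain ⟨c, hc, rfl, rfl⟩ := hd
  have h1 := isSmoothOnTorus_waveSum (h.rapidDecay_singularAmp hw)
  have h2 := isSmoothOnTorus_waveSum (h.rapidDecay_regularAmp hw)
  have e := (hc.hasExpansion fun η hη => (h.isSmoothOnSpaceTime.slice hη).smooth).unique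
    (h.hasExpansion hw) hc.1 (isSmoothOnTorus_fullCoeff h1 h2)
  rw [e]
  exact ⟨fullCoeff_singular hw _ _, fullCoeff_regular hw _ _⟩

/-- Two solutions with the same data coincide. -/
lemma IsSmoothSolution.eq_of_data_eq {Φ Φ' : ℝ → E3 → ℝ} (h : IsSmoothSolution b w Φ)
    (h' : IsSmoothSolution b w Φ') (hw : w ∈ Set.Icc (0 : ℝ) 1) {Ψ₁ Ψ₂ : E3 → ℝ}
    (hd : HasSingularData b w Φ Ψ₁ Ψ₂) (hd' : HasSingularData b w Φ' Ψ₁ Ψ₂) {η : ℝ} (hη : 0 < η)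
    (x : E3) : Φ' η x = Φ η x := by
  have e := h.hasExpansion hw
  have e' := h'.hasExpansion hw
  rw [← (h.data_eq hw hd).1, ← (h.data_eq hw hd).2] at e
  rw [← (h'.data_eq hw hd').1, ← (h'.data_eq hw hd').2] at e'
  have s1 : IsSmoothOnTorus b Ψ₁ := by
    rw [(h.data_eq hw hd).1]
    exact isSmoothOnTorus_waveSum (h.rapidDecay_singularAmp hw)
  have s2 : IsSmoothOnTorus b Ψ₂ := by
    rw [(h.data_eq hw hd).2]
    exact isSmoothOnTorus_waveSum (h.rapidDecay_regularAmp hw)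
  -- Both solutions have the same coefficients, so subtracting the same terms, including all with
  -- exponent up to 0, shows that the difference is o(1).
  obtain ⟨H, hH, ho⟩ := e 0
  have ho' := e'.remainder (isSmoothOnTorus_fullCoeff s1 s2) hH
  have hlittle : IsLittleORpow (fun η x => Φ' η x + -1 * Φ η x) 0 := by
    convert ho'.sub ho using 3
    ring
  have := (h'.add_const_mul h (-1)).eq_zero_of_isLittleORpow hw hlittle hη x
  linarith

lemma waveSum_torusCoeff {f : E3 → ℝ} (hf : IsSmoothOnTorus b f) :
    waveSum b (torusCoeff b f) = f := by
  funext x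
  exact (Complex.reCLM.hasSum (hf.hasSum x)).tsum_eq

end Main

end

theorem theorem2 (b : Module.Basis (Fin 3) ℝ E3) (w : ℝ) (hw : w ∈ Set.Icc (0 : ℝ) 1) :
    (∀ Ψ₁ Ψ₂ : E3 → ℝ, IsSmoothOnTorus b Ψ₁ → IsSmoothOnTorus b Ψ₂ →
      ∃ Φ : ℝ → E3 → ℝ, IsSmoothSolution b w Φ ∧
        (∃ c : ℝ → Fin 2 → E3 → ℝ, IsSingularExpansion b w Φ c ∧ IsFormalSolution w c ∧
          c (-2 * nuExp w) 0 = Ψ₁ ∧ c 0 0 = Ψ₂) ∧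
        ∀ Φ' : ℝ → E3 → ℝ, IsSmoothSolution b w Φ' → HasSingularData b w Φ' Ψ₁ Ψ₂ →
          ∀ η : ℝ, 0 < η → ∀ x : E3, Φ' η x = Φ η x) ∧
    (∀ Φ : ℝ → E3 → ℝ, IsSmoothSolution b w Φ →
      ∃! Ψ : (E3 → ℝ) × (E3 → ℝ),
        IsSmoothOnTorus b Ψ.1 ∧ IsSmoothOnTorus b Ψ.2 ∧ HasSingularData b w Φ Ψ.1 Ψ.2) := by
  refine ⟨fun Ψ₁ Ψ₂ h₁ h₂ => ?_, fun Φ hΦ => ?_⟩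
  · have hsol := isSmoothSolution_full h₁.rapidDecay h₂.rapidDecay hw
    have hexp := hasExpansion_full h₁.rapidDecay h₂.rapidDecay hw
    rw [waveSum_torusCoeff h₁, waveSum_torusCoeff h₂] at hexp
    have hsing := isSingularExpansion_full hw h₁ h₂ hexp
    refine ⟨_, hsol, ⟨_, hsing, isFormalSolution_full hw h₁ h₂, fullCoeff_singular hw _ _,
      fullCoeff_regular hw _ _⟩, fun Φ' hΦ' hd η hη x => ?_⟩
    exact hsol.eq_of_data_eq hΦ' hw ⟨_, hsing, fullCoeff_singular hw _ _, fullCoeff_regular hw _ _⟩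
      hd hη x
  · have s₁ := isSmoothOnTorus_waveSum (hΦ.rapidDecay_singularAmp hw)
    have s₂ := isSmoothOnTorus_waveSum (hΦ.rapidDecay_regularAmp hw)
    refine ⟨(_, _), ⟨s₁, s₂, _, isSingularExpansion_full hw s₁ s₂ (hΦ.hasExpansion hw),
      fullCoeff_singular hw _ _, fullCoeff_regular hw _ _⟩, fun Ψ hΨ => ?_⟩
    exact Prod.ext (hΦ.data_eq hw hΨ.2.2).1 (hΦ.data_eq hw hΨ.2.2).2
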